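/- Let $G$ be a compact Lie group (not necessarily connected), $K\subseteq G$ a closed subgroup and $M=G/K$, with normalized Haar measure $dx$ on $G$ and its image, the normalized $G$-invariant measure, on $M$. Fix an $\mathrm{Ad}(G)$-invariant inner product on the Lie algebra of $G$ and an orthonormal basis $Y_1,\dots,Y_n$ of it, and let $\mathcal L=\sum_i Y_i^2$ be the Laplacian (Casimir element) of $G$, the $Y_i$ acting as left-invariant vector fields. Let $\widehat G_0$ be the set of equivalence classes of continuous irreducible unitary representations $\xi:G\to U(d_\xi)$ that have a non-zero $K$-fixed vector. Choose in each class a matrix representative, in an orthonormal basis whose first $k_\xi$ vectors span the space of $K$-fixed vectors, and let $I_\xi$ be the diagonal matrix with $k_\xi$ ones followed by zeros. Let $\lambda_\xi\ge 0$ be determined by $-\mathcal L\,\xi(x)=\lambda_\xi\,\xi(x)$, and $\langle\xi\rangle=(1+\lambda_\xi)^{1/2}$. For $f\in C^\infty(M)$ put $\widehat f(\xi)=\int_G f(xK)\,\xi(x)^*\,dx$, and for a distribution $u\in\mathcal D'(M)$ put $\widehat u(\xi)=\langle u,I_\xi\,\xi(\cdot)^*\rangle$. For $r\in\mathbb R$,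 $1\le p\le\infty$ and $0<q\le\infty$, the Besov space $B^r_{p,q}(M)$ consists of all $u\in\mathcal D'(M)$ with $$\|u\|_{B^r_{p,q}}=\Big\|\Big(2^{mr}\Big\|\sum_{[\xi]\in\widehat G_0,\ 2^m\le\langle\xi\rangle<2^{m+1}}d_\xi\,\mathrm{Tr}[\xi(x)\widehat u(\xi)]\Big\|_{L^p(M)}\Big)_{m\in\mathbb N}\Big\|_{\ell^q(\mathbb N)}<\infty .$$ Let $\sigma$ assign to each $[\xi]\in\widehat G_0$ a matrix $\sigma(\xi)\in\mathbb C^{d_\xi\times d_\xi}$ with $\sigma(\xi)_{ij}=0$ whenever $i>k_\xi$ or $j>k_\xi$, and let $A=\mathrm{Op}(\sigma)$ be the Fourier multiplier $$Af(x)=\sum_{[\xi]\in\widehat G_0}d_\xi\,\mathrm{Tr}[\xi(x)\sigma(\xi)\widehat f(\xi)],\qquad f\in C^\infty(M).$$ Let $1\le p_1,p_2\le\infty$ and suppose that $A$ is bounded from $L^{p_1}(M)$ into $L^{p_2}(M)$, i.e. $\|Af\|_{L^{p_2}(M)}\le C_0\|f\|_{L^{p_1}(M)}$ for all $f\in C^\infty(M)$,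 with a constant $C_0$. Then $A$ extends from $C^\infty(M)$ to a linear operator $T$ on $\mathcal D'(M)$ with $\widehat{Tu}(\xi)=\sigma(\xi)\widehat u(\xi)$ for all $u\in\mathcal D'(M)$ and $[\xi]\in\widehat G_0$, and for all $r\in\mathbb R$ and $0<q\le\infty$ this $T$ maps $B^r_{p_1,q}(M)$ boundedly into $B^r_{p_2,q}(M)$: there is a constant $C$ with $\|Tu\|_{B^r_{p_2,q}}\le C\|u\|_{B^r_{p_1,q}}$ for all $u\in B^r_{p_1,q}(M)$. -/

import Mathlib

open MeasureTheory
open scoped Manifold ContDiff Matrix ENNReal NNReal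

noncomputable section

namespace HomBesov

section Reps

variable {G : Type*} [Group G]

/-- The representation of `G` on `ℂ^d` given by a homomorphism into the unitary group `U(d)`. -/
def toRep {d : ℕ} (ξ : G →* Matrix.unitaryGroup (Fin d) ℂ) : Representation ℂ G (Fin d → ℂ) where
  toFun g := Matrix.toLin' (ξ g : Matrix (Fin d) (Fin d) ℂ)
  map_one' := by simp; rfl
  map_mul' g h := by simp [Matrix.toLin'_mul]; rfl

/-- A continuous irreducible unitary representation `ξ : G → U(d)`, in matrix form, of type I with
respect to `K` (it has a non-zero `K`-fixed vector), written in an orthonormal basis of the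
representation space whose first `k` vectors span the space of `K`-fixed vectors. -/
structure TypeOneRep (G : Type*) [Group G] [TopologicalSpace G] (K : Subgroup G) where
  /-- the dimension `d_ξ` -/
  d : ℕ
  /-- the representation -/
  hom : G →* Matrix.unitaryGroup (Fin d) ℂ
  continuous_hom : Continuous fun g => (hom g : Matrix (Fin d) (Fin d) ℂ)
  irreducible : (toRep hom).IsIrreducible
  /-- the dimension `k_ξ` of the space of `K`-fixed vectors -/
  k : ℕ
  k_pos : 0 < k
  k_le : k ≤ d
  fixed_iff : ∀ v : Fin d → ℂ,
    (∀ h ∈ K, (hom h : Matrix (Fin d) (Fin d) ℂ) *ᵥ v = v) ↔ ∀ i : Fin d, k ≤ (i : ℕ) → v i = 0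

variable [TopologicalSpace G] {K : Subgroup G}

namespace TypeOneRep

/-- The matrix `ξ(g)`. -/
def mat (ξ : TypeOneRep G K) (g : G) : Matrix (Fin ξ.d) (Fin ξ.d) ℂ := (ξ.hom g).1

/-- Unitary equivalence of representations. -/
def Equivalent (ξ η : TypeOneRep G K) : Prop :=
  ∃ U : Matrix (Fin η.d) (Fin ξ.d) ℂ, U * Uᴴ = 1 ∧ Uᴴ * U = 1 ∧ ∀ g, U * ξ.mat g = η.mat g * U

instance setoid (G : Type*) [Group G] [TopologicalSpace G] (K : Subgroup G) :
    Setoid (TypeOneRep G K) where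
  r := Equivalent
  iseqv :=
    { refl := fun ξ => ⟨1, by simp, by simp, by simp⟩
      symm := by
        rintro ξ η ⟨U, h1, h2, h3⟩
        refine ⟨Uᴴ, by simpa using h2, by simpa using h1, fun g => ?_⟩
        calc Uᴴ * η.mat g = Uᴴ * (η.mat g * U) * Uᴴ := by
              rw [Matrix.mul_assoc, Matrix.mul_assoc, h1, Matrix.mul_one]
          _ = (Uᴴ * U) * ξ.mat g * Uᴴ := by rw [← h3 g]; simp only [Matrix.mul_assoc]
          _ = ξ.mat g * Uᴴ := by rw [h2, Matrix.one_mul]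
      trans := by
        rintro ξ η ζ ⟨U, h1, h2, h3⟩ ⟨V, k1, k2, k3⟩
        refine ⟨V * U, ?_, ?_, fun g => ?_⟩
        · rw [Matrix.conjTranspose_mul, Matrix.mul_assoc, ← Matrix.mul_assoc U, h1, Matrix.one_mul,
            k1]
        · rw [Matrix.conjTranspose_mul, Matrix.mul_assoc, ← Matrix.mul_assoc Vᴴ, k2,
            Matrix.one_mul, h2]
        · rw [Matrix.mul_assoc, h3, ← Matrix.mul_assoc, k3, Matrix.mul_assoc] }

/-- The matrix `I_ξ`: the diagonal matrix with ones in the first `k_ξ` places, i.e. the orthogonal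
projection onto the `K`-fixed vectors. -/
def proj (ξ : TypeOneRep G K) : Matrix (Fin ξ.d) (Fin ξ.d) ℂ :=
  Matrix.diagonal fun i => if (i : ℕ) < ξ.k then 1 else 0

theorem mat_mul_proj (ξ : TypeOneRep G K) {h : G} (hh : h ∈ K) : ξ.mat h * ξ.proj = ξ.proj := by
  ext i j
  rw [proj, Matrix.mul_diagonal]
  by_cases hj : (j : ℕ) < ξ.k
  · have h1 := (ξ.fixed_iff (Pi.single j 1)).2 (fun i hi => by
      rw [Pi.single_eq_of_ne]; rintro rfl; omega) h hh
    have h2 := congrFun h1 i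
    rw [Matrix.mulVec_single_one] at h2
    simp only [Matrix.col_apply] at h2
    rw [if_pos hj, mul_one, mat, h2]
    by_cases hij : i = j
    · subst hij; simp [hj]
    · simp [hij]
  · by_cases hij : i = j
    · subst hij; simp [hj]
    · simp [hij, hj]

/-- The function `xK ↦ ξ(x) I_ξ` on `M = G/K`. -/
def onM (ξ : TypeOneRep G K) : G ⧸ K → Matrix (Fin ξ.d) (Fin ξ.d) ℂ :=
  Quotient.lift (fun x => ξ.mat x * ξ.proj) (by
    intro x y hxy
    have hK : x⁻¹ * y ∈ K := QuotientGroup.leftRel_apply.1 hxy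
    have hy : ξ.mat y = ξ.mat x * ξ.mat (x⁻¹ * y) := by
      have : ξ.hom y = ξ.hom x * ξ.hom (x⁻¹ * y) := by rw [← map_mul]; simp
      simp only [mat]
      rw [this]; rfl
    show ξ.mat x * ξ.proj = ξ.mat y * ξ.proj
    rw [hy, Matrix.mul_assoc, ξ.mat_mul_proj hK])

end TypeOneRep

/-- The set `Ĝ₀` of equivalence classes of irreducible unitary representations of `G` of type I with
respect to `K`. -/
def Dual (G : Type*) [Group G] [TopologicalSpace G] (K : Subgroup G) : Type _ :=
  Quotient (TypeOneRep.setoid G K)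

/-- A fixed representative of a class in `Ĝ₀`. -/
def Dual.rep (ξ : Dual G K) : TypeOneRep G K := Quotient.out ξ

/-- A family of matrices `a(ξ) ∈ ℂ^{d_ξ × d_ξ}`, one for each `[ξ] ∈ Ĝ₀`. -/
abbrev MatFamily (G : Type*) [Group G] [TopologicalSpace G] (K : Subgroup G) : Type _ :=
  (ξ : Dual G K) → Matrix (Fin ξ.rep.d) (Fin ξ.rep.d) ℂ

/-- The symbol of a Fourier multiplier on `G/K`: `σ(ξ)_{ij} = 0` unless `i, j` both are among the
first `k_ξ` indices. -/
def IsMultiplierSymbol (σ : MatFamily G K) : Prop :=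
  ∀ (ξ : Dual G K) (i j : Fin ξ.rep.d), ξ.rep.k ≤ (i : ℕ) ∨ ξ.rep.k ≤ (j : ℕ) → σ ξ i j = 0

/-- The Fourier series `∑_{[ξ] ∈ Ĝ₀} d_ξ Tr[ξ(x) I_ξ a(ξ)]`, as a function of `xK ∈ G/K`. The
projection `I_ξ` may be left out when the rows of `a(ξ)` of index beyond `k_ξ` vanish, which holds
for Fourier coefficients of functions and distributions on `G/K` and for multiplier symbols. -/
def fourierSeries (a : MatFamily G K) (x : G ⧸ K) : ℂ :=
  ∑' ξ : Dual G K, (ξ.rep.d : ℂ) * (ξ.rep.onM x * a ξ).trace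

end Reps

section Measures

variable (G : Type*) [Group G] [TopologicalSpace G] [IsTopologicalGroup G] [CompactSpace G]
  [MeasurableSpace G] [BorelSpace G]

/-- The normalized Haar measure of the compact group `G`. -/
def haarG : Measure G := Measure.haarMeasure ⊤

/-- The normalized `G`-invariant measure of `M = G/K`. -/
def haarM (K : Subgroup G) : Measure (G ⧸ K) := (haarG G).map QuotientGroup.mk

instance : IsProbabilityMeasure (haarG G) :=
  ⟨by simpa [haarG] using Measure.haarMeasure_self (K₀ := (⊤ : TopologicalSpace.PositiveCompacts G))⟩

instance (K : Subgroup G) : IsProbabilityMeasure (haarM G K) :=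
  Measure.isProbabilityMeasure_map QuotientGroup.measurable_coe.aemeasurable

variable {G} {K : Subgroup G}

/-- The Fourier coefficients `f̂(ξ) = ∫_G f(xK) ξ(x)^* dx` of a function on `G/K`. -/
def fourier (f : G ⧸ K → ℂ) : MatFamily G K :=
  fun ξ => Matrix.of fun i j => ∫ x, f (x : G ⧸ K) * (ξ.rep.mat x)ᴴ i j ∂(haarG G)

/-- The operator `Op(σ)f(x) = ∑_{[ξ] ∈ Ĝ₀} d_ξ Tr[ξ(x) σ(ξ) f̂(ξ)]`. -/
def Op (σ : MatFamily G K) (f : G ⧸ K → ℂ) : G ⧸ K → ℂ :=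
  fourierSeries fun ξ => σ ξ * fourier f ξ

end Measures

section Smooth

variable {E : Type*} [NormedAddCommGroup E] [NormedSpace ℝ E]
  {G : Type*} [Group G] [TopologicalSpace G] [ChartedSpace E G]

/-- The adjoint representation of `G` on its Lie algebra. -/
def Ad (g : G) (X : GroupLieAlgebra 𝓘(ℝ, E) G) : GroupLieAlgebra 𝓘(ℝ, E) G :=
  mfderiv 𝓘(ℝ, E) 𝓘(ℝ, E) (fun x : G => g * x * g⁻¹) 1 X

/-- The derivative of a function along the left-invariant vector field of `X`. -/
def lieDeriv (X : GroupLieAlgebra 𝓘(ℝ, E) G) (f : G → ℂ) (g : G) : ℂ :=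
  mfderiv 𝓘(ℝ, E) 𝓘(ℝ, ℂ) f g (mulInvariantVectorField X g)

variable {n : ℕ} (Y : Module.Basis (Fin n) ℝ (GroupLieAlgebra 𝓘(ℝ, E) G))

/-- Iterated derivative along left-invariant vector fields. -/
def iterLieDeriv (w : List (Fin n)) (f : G → ℂ) : G → ℂ :=
  w.foldr (fun i u => lieDeriv (Y i) u) f

/-- The operator `∑ Y_i²`. It is the Laplacian (Casimir element) of `G` when the `Y_i` are
orthonormal for an `Ad`-invariant inner product. -/
def laplacian (f : G → ℂ) (g : G) : ℂ := ∑ i, lieDeriv (Y i) (lieDeriv (Y i) f) g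

variable {K : Subgroup G}

/-- The eigenvalue `λ_ξ` determined by `-L ξ(x) = λ_ξ ξ(x)`. -/
def eigenvalue (ξ : TypeOneRep G K) : ℝ :=
  Classical.epsilon fun l : ℝ =>
    ∀ (i j : Fin ξ.d) (x : G), -laplacian Y (fun y => ξ.mat y i j) x = (l : ℂ) * ξ.mat x i j

/-- The weight `⟨ξ⟩ = (1 + λ_ξ)^{1/2}`. -/
def weight (ξ : Dual G K) : ℝ := Real.sqrt (1 + eigenvalue Y ξ.rep)

variable (E K) in
/-- The space `C^∞(G/K)`. A function on `G/K` is smooth iff its lift to `G` is. -/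
def smoothFun : Submodule ℂ (G ⧸ K → ℂ) where
  carrier := {f | ContMDiff 𝓘(ℝ, E) 𝓘(ℝ, ℂ) ∞ fun x : G => f (x : G ⧸ K)}
  add_mem' hf hg := ContMDiff.add hf hg
  zero_mem' := contMDiff_const
  smul_mem' c f hf :=
    (show ContDiff ℝ ∞ (fun z : ℂ => c * z) by fun_prop).contMDiff.comp
      (show ContMDiff 𝓘(ℝ, E) 𝓘(ℝ, ℂ) ∞ fun x : G => f (x : G ⧸ K) from hf)

variable (K) in
/-- The space `D'(G/K)`: the linear functionals on `C^∞(G/K)` that are continuous for the seminorms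
`sup |Y_{i_1} ⋯ Y_{i_l} φ|`, which define the topology of `C^∞(G/K)`. -/
def Distribution : Submodule ℂ (smoothFun E K →ₗ[ℂ] ℂ) where
  carrier := {u | ∃ (N : ℕ) (C : ℝ), ∀ (φ : smoothFun E K) (A : ℝ),
    (∀ w : List (Fin n), w.length ≤ N →
      ∀ x : G, ‖iterLieDeriv Y w (fun y : G => φ.1 (y : G ⧸ K)) x‖ ≤ A) → ‖u φ‖ ≤ C * A}
  zero_mem' := ⟨0, 0, by simp⟩
  add_mem' := by
    rintro u v ⟨N, C, hu⟩ ⟨N', C', hv⟩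
    refine ⟨max N N', C + C', fun φ A h => ?_⟩
    calc ‖(u + v) φ‖ ≤ ‖u φ‖ + ‖v φ‖ := norm_add_le _ _
      _ ≤ C * A + C' * A := add_le_add
          (hu φ A fun w hw => h w (hw.trans (le_max_left _ _)))
          (hv φ A fun w hw => h w (hw.trans (le_max_right _ _)))
      _ = (C + C') * A := by ring
  smul_mem' := by
    rintro c u ⟨N, C, hu⟩
    refine ⟨N, ‖c‖ * C, fun φ A h => ?_⟩
    rw [LinearMap.smul_apply, norm_smul, mul_assoc]
    exact mul_le_mul_of_nonneg_left (hu φ A h) (norm_nonneg c)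

variable {Y}

open Classical in
/-- The pairing of a distribution with a smooth function (and `0` if the function is not smooth). -/
def distPair (u : Distribution Y K) (φ : G ⧸ K → ℂ) : ℂ :=
  if h : φ ∈ smoothFun E K then u.1 ⟨φ, h⟩ else 0

/-- The Fourier coefficients `û(ξ) = ⟨u, I_ξ ξ(·)^*⟩` of a distribution on `G/K`. -/
def distFourier (u : Distribution Y K) : MatFamily G K :=
  fun ξ => Matrix.of fun i j => distPair u fun x => (ξ.rep.onM x)ᴴ i j

open Classical in
/-- The dyadic block `∑_{2^m ≤ ⟨ξ⟩ < 2^{m+1}} d_ξ Tr[ξ(x) û(ξ)]`. -/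
def distBlock (u : Distribution Y K) (m : ℕ) : G ⧸ K → ℂ :=
  fourierSeries fun ξ =>
    if (2 : ℝ) ^ m ≤ weight Y ξ ∧ weight Y ξ < (2 : ℝ) ^ (m + 1) then distFourier u ξ else 0

variable [IsTopologicalGroup G] [CompactSpace G] [MeasurableSpace G] [BorelSpace G]

/-- The distribution `φ ↦ ∫_M f φ` defined by a smooth function `f`. -/
def distOfSmooth (Y : Module.Basis (Fin n) ℝ (GroupLieAlgebra 𝓘(ℝ, E) G))
    (f : smoothFun E K) : Distribution Y K :=
  have hc : ∀ φ : smoothFun E K, Continuous fun x : G => φ.1 (x : G ⧸ K) :=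
    fun φ => ContMDiff.continuous φ.2
  have hm : ∀ φ : smoothFun E K, Measurable φ.1 := fun φ =>
    QuotientGroup.measurable_from_quotient.2 (hc φ).measurable
  have hb : ∀ φ : smoothFun E K, ∃ C, ∀ x, ‖φ.1 x‖ ≤ C := fun φ => by
    obtain ⟨C, hC⟩ := isCompact_univ.exists_bound_of_continuousOn (hc φ).continuousOn
    exact ⟨C, fun x => QuotientGroup.induction_on x fun y => hC y (Set.mem_univ y)⟩
  have hi : ∀ φ : smoothFun E K, Integrable (fun x => f.1 x * φ.1 x) (haarM G K) := fun φ => by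
    obtain ⟨C, hC⟩ := hb f
    obtain ⟨D, hD⟩ := hb φ
    refine Integrable.of_bound ((hm f).mul (hm φ)).aestronglyMeasurable (C * D)
      (Filter.Eventually.of_forall fun x => ?_)
    rw [norm_mul]
    exact mul_le_mul (hC x) (hD x) (norm_nonneg _) ((norm_nonneg _).trans (hC x))
  ⟨{ toFun := fun φ => ∫ x, f.1 x * φ.1 x ∂(haarM G K)
     map_add' := fun φ ψ => by
      rw [← integral_add (hi φ) (hi ψ)]
      exact integral_congr_ae (Filter.Eventually.of_forall fun x => mul_add _ _ _)
     map_smul' := fun c φ => by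
      rw [RingHom.id_apply, smul_eq_mul, ← integral_const_mul]
      exact integral_congr_ae (Filter.Eventually.of_forall fun x => mul_left_comm _ _ _) }, by
    obtain ⟨C, hC⟩ := hb f
    refine ⟨0, C, fun φ A h => ?_⟩
    have hA : ∀ x, ‖φ.1 x‖ ≤ A := fun x =>
      QuotientGroup.induction_on x fun y => h [] (le_refl 0) y
    have := norm_integral_le_of_norm_le_const (μ := haarM G K) (f := fun x => f.1 x * φ.1 x)
      (C := C * A) (Filter.Eventually.of_forall fun x => by
        rw [norm_mul]
        exact mul_le_mul (hC x) (hA x) (norm_nonneg _) ((norm_nonneg _).trans (hC x)))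
    simpa using this⟩

/-- The Besov (quasi-)norm
`‖u‖_{B^r_{p,q}} = ‖ (2^{mr} ‖∑_{2^m ≤ ⟨ξ⟩ < 2^{m+1}} d_ξ Tr[ξ(x) û(ξ)]‖_{L^p(M)})_m ‖_{ℓ^q}`. -/
def besovNorm (r : ℝ) (p q : ℝ≥0∞) (u : Distribution Y K) : ℝ≥0∞ :=
  if q = ⊤ then ⨆ m : ℕ, (2 : ℝ≥0∞) ^ ((m : ℝ) * r) * eLpNorm (distBlock u m) p (haarM G K)
  else (∑' m : ℕ, ((2 : ℝ≥0∞) ^ ((m : ℝ) * r) * eLpNorm (distBlock u m) p (haarM G K)) ^ q.toReal)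
    ^ (1 / q.toReal)

variable (Y K) in
/-- The Besov space `B^r_{p,q}(G/K)`. -/
def besovSpace (r : ℝ) (p q : ℝ≥0∞) : Set (Distribution Y K) := {u | besovNorm r p q u < ⊤}

variable (E) in
/-- `Op(σ)` is bounded from `L^{p₁}(G/K)` into `L^{p₂}(G/K)`:
`‖Op(σ)f‖_{L^{p₂}} ≤ C ‖f‖_{L^{p₁}}` for all `f ∈ C^∞(G/K)`. -/
def IsLpBounded (p₁ p₂ : ℝ≥0∞) (σ : MatFamily G K) : Prop :=
  ∃ C : ℝ≥0, ∀ f ∈ smoothFun E K,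
    eLpNorm (Op σ f) p₂ (haarM G K) ≤ C * eLpNorm f p₁ (haarM G K)

end Smooth

end HomBesov

end

/-! A multiplier acts on Fourier coefficients, so it commutes with the dyadic projections: the m-th
block of Tu is A applied to the m-th block of u. Only finitely many classes satisfy ⟨ξ⟩ < 2^(m+1)
(`finite_weight_lt`). Each block is therefore a trigonometric polynomial, hence smooth, and the
assumed L^{p₁}–L^{p₂} inequality applies to it with one constant for all m
(`distBlock_mem_smoothFun_and_Op_distBlock`). Weighted ℓ^q norms then give the Besov bound with that
same constant, for every r and q (`besovNorm_le_of_eLpNorm_le`).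

Most of the work goes into constructing T on all distributions. Tu is the series ∑ d_ξ Tr[ξ(x) σ(ξ)
û(ξ)] tested term by term against φ, and its convergence rests on four polynomial estimates. (1)
Applying A to a single matrix coefficient bounds the entries of σ(ξ) by a multiple of d_ξ
(`exists_norm_symbol_le`). (2) û(ξ) grows at most polynomially in 1 + λ_ξ, because a distribution
has finite order and each derivative of ξ costs a factor ⟨ξ⟩ (`exists_norm_distFourier_le`). (3) The
coefficients of φ decay faster than any power of 1 + λ_ξ, by integration by parts with the Laplacian
(`pow_mul_norm_integral_mul_le`). (4) The sum of d_ξ² over λ_ξ ≤ l is at most C(1 + l)^n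
(`exists_sum_sq_le`), a weak form of Weyl's law. It follows by comparing the size of the kernel ∑
d_ξ Tr ξ(x) near the identity with its L² norm, which Schur orthogonality computes.

Representations are assumed only continuous; convolution with a bump function makes them smooth
(`TypeOneRep.contMDiff_mat_apply`). The Peter–Weyl theorem is not needed: for smooth f, the pairing
of φ with T f and with Op(σ)f is the sum of one and the same series. -/

noncomputable section

namespace HomBesov

/-! ### Unitary matrix representations and Schur's lemma. -/

section Algebra

variable {G : Type*} [Group G] [TopologicalSpace G] {K : Subgroup G}

namespace TypeOneRep

variable (ξ η : TypeOneRep G K)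

theorem mat_mul (g h : G) : ξ.mat (g * h) = ξ.mat g * ξ.mat h := by
  simp only [mat, map_mul]; rfl

theorem mat_one : ξ.mat 1 = 1 := by
  simp only [mat, map_one]; rfl

theorem conjTranspose_mul_mat (g : G) : (ξ.mat g)ᴴ * ξ.mat g = 1 :=
  Matrix.mem_unitaryGroup_iff'.1 (ξ.hom g).2

theorem mat_mul_conjTranspose (g : G) : ξ.mat g * (ξ.mat g)ᴴ = 1 :=
  Matrix.mem_unitaryGroup_iff.1 (ξ.hom g).2

theorem mat_inv (g : G) : ξ.mat g⁻¹ = (ξ.mat g)ᴴ := by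
  have h : ξ.mat g⁻¹ * ξ.mat g = 1 := by rw [← mat_mul, inv_mul_cancel, mat_one]
  calc ξ.mat g⁻¹ = ξ.mat g⁻¹ * (ξ.mat g * (ξ.mat g)ᴴ) := by
        rw [mat_mul_conjTranspose, Matrix.mul_one]
    _ = (ξ.mat g)ᴴ := by rw [← Matrix.mul_assoc, h, Matrix.one_mul]

theorem norm_mat_apply_le (g : G) (i j : Fin ξ.d) : ‖ξ.mat g i j‖ ≤ 1 :=
  entry_norm_bound_of_unitary (ξ.hom g).2 i j

theorem continuous_mat_apply (i j : Fin ξ.d) : Continuous fun g => ξ.mat g i j :=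
  ξ.continuous_hom.matrix_elem i j

theorem continuous_mat_mul_star (a j : Fin ξ.d) (b l : Fin η.d) :
    Continuous fun x => ξ.mat x a j * star (η.mat x b l) :=
  (ξ.continuous_mat_apply a j).mul (η.continuous_mat_apply b l).star

theorem eventually_norm_mat_sub_one_le {ε : ℝ} (hε : 0 < ε) :
    ∀ᶠ y in nhds (1 : G), ∀ i j, ‖ξ.mat y i j - (1 : Matrix (Fin ξ.d) (Fin ξ.d) ℂ) i j‖ ≤ ε := by
  rw [Filter.eventually_all]
  intro i
  rw [Filter.eventually_all]
  intro j
  have h := (ξ.continuous_mat_apply i j).tendsto 1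
  rw [ξ.mat_one] at h
  filter_upwards [Metric.tendsto_nhds.1 h ε hε] with y hy
  rw [← dist_eq_norm]
  exact hy.le

theorem continuous_trace_mat : Continuous fun x => (ξ.mat x).trace :=
  continuous_finsetSum _ fun i _ => ξ.continuous_mat_apply i i

theorem d_pos : 0 < ξ.d := ξ.k_pos.trans_le ξ.k_le

instance : Nonempty (Fin ξ.d) := ⟨⟨0, ξ.d_pos⟩⟩

/-- Schur's lemma: a matrix that commutes with an irreducible representation is scalar. -/
theorem eq_smul_one_of_commute {A : Matrix (Fin ξ.d) (Fin ξ.d) ℂ}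
    (hA : ∀ g, A * ξ.mat g = ξ.mat g * A) : ∃ c : ℂ, A = c • (1 : Matrix _ _ ℂ) := by
  have := ξ.irreducible
  let f : (toRep ξ.hom).IntertwiningMap (toRep ξ.hom) :=
    (Matrix.toLin' A).intertwiningMap_of_isIntertwiningMap _ _ (fun g v => by
      have := congrArg (fun B => Matrix.toLin' B v) (hA g)
      simpa [Matrix.toLin'_mul, toRep, mat] using this)
  obtain ⟨c, hc⟩ :=
    (Representation.IsIrreducible.algebraMap_intertwiningMap_bijective_of_isAlgClosed
      (ρ := toRep ξ.hom)).2 f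
  refine ⟨c, ?_⟩
  have h2 : ∀ v, Matrix.toLin' A v = c • v := fun v => by
    have : f v = Matrix.toLin' A v := rfl
    rw [← this, ← hc]; rfl
  exact Matrix.toLin'.injective (LinearMap.ext fun v => by rw [h2]; simp)

/-- Schur's lemma: there is no non-zero intertwiner between inequivalent representations. -/
theorem eq_zero_of_intertwining {A : Matrix (Fin η.d) (Fin ξ.d) ℂ}
    (hA : ∀ g, A * ξ.mat g = η.mat g * A) (hne : ¬ Equivalent ξ η) : A = 0 := by
  have hA' : ∀ g, Aᴴ * η.mat g = ξ.mat g * Aᴴ := fun g => by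
    have := congrArg Matrix.conjTranspose (hA g⁻¹)
    simpa [Matrix.conjTranspose_mul, mat_inv] using this.symm
  obtain ⟨c, hc⟩ := ξ.eq_smul_one_of_commute (A := Aᴴ * A) (fun g => by
    rw [Matrix.mul_assoc, hA, ← Matrix.mul_assoc, hA', Matrix.mul_assoc])
  obtain ⟨c', hc'⟩ := η.eq_smul_one_of_commute (A := A * Aᴴ) (fun g => by
    rw [Matrix.mul_assoc, hA', ← Matrix.mul_assoc, hA, Matrix.mul_assoc])
  by_contra hA0
  have hcc : c = c' := by
    have h : c • A = c' • A := by
      calc c • A = A * (Aᴴ * A) := by rw [hc]; simp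
        _ = c' • A := by rw [← Matrix.mul_assoc, hc']; simp
    exact smul_left_injective ℂ hA0 h
  have hc0 : c ≠ 0 := by
    rintro rfl
    rw [zero_smul] at hc
    open scoped ComplexOrder in exact hA0 (Matrix.conjTranspose_mul_self_eq_zero.1 hc)
  obtain ⟨i⟩ : Nonempty (Fin ξ.d) := inferInstance
  have hci : c = ((∑ k, ‖A k i‖ ^ 2 : ℝ) : ℂ) := by
    have h := congrFun (congrFun hc i) i
    simp only [Matrix.mul_apply, Matrix.conjTranspose_apply, Matrix.smul_apply,
      Matrix.one_apply_eq, smul_eq_mul, mul_one] at h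
    rw [← h]
    push_cast
    exact Finset.sum_congr rfl fun k _ => by
      rw [RCLike.star_def, Complex.conj_mul']
  set r : ℝ := ∑ k, ‖A k i‖ ^ 2
  have hr : 0 ≤ r := Finset.sum_nonneg fun _ _ => by positivity
  have hr0 : r ≠ 0 := fun h => hc0 (by rw [hci, h]; simp)
  have hs : ((Real.sqrt r : ℝ) : ℂ)⁻¹ * (((Real.sqrt r : ℝ) : ℂ)⁻¹ * c) = 1 := by
    rw [hci, ← mul_assoc, ← mul_inv, ← Complex.ofReal_mul, Real.mul_self_sqrt hr]
    exact inv_mul_cancel₀ (by exact_mod_cast hr0)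
  -- Both AᴴA and AAᴴ equal the positive scalar c, so A/√c is unitary and would be an equivalence.
  refine hne ⟨((Real.sqrt r : ℝ) : ℂ)⁻¹ • A, ?_, ?_, fun g => ?_⟩
  · simp only [Matrix.conjTranspose_smul, Matrix.smul_mul, Matrix.mul_smul, hc', smul_smul,
      ← hcc, star_inv₀, RCLike.star_def, Complex.conj_ofReal, hs, one_smul]
  · simp only [Matrix.conjTranspose_smul, Matrix.smul_mul, Matrix.mul_smul, hc, smul_smul,
      star_inv₀, RCLike.star_def, Complex.conj_ofReal, hs, one_smul]
  · rw [Matrix.smul_mul, Matrix.mul_smul, hA]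

end TypeOneRep

theorem Dual.not_equivalent_rep {ξ η : Dual G K} (h : ξ ≠ η) :
    ¬ TypeOneRep.Equivalent ξ.rep η.rep := fun he => by
  apply h
  rw [← Quotient.out_eq ξ, ← Quotient.out_eq η]
  exact Quotient.sound he

/-- The reproducing kernel of a finite set of representations. -/
def kernelFun (F : Finset (Dual G K)) (x : G) : ℂ :=
  ∑ ξ ∈ F, (ξ.rep.d : ℂ) * (ξ.rep.mat x).trace

theorem continuous_kernelFun (F : Finset (Dual G K)) : Continuous (kernelFun F) :=
  continuous_finsetSum _ fun ξ _ => continuous_const.mul ξ.rep.continuous_trace_mat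

end Algebra

/-! ### Haar measure and Schur orthogonality. -/

section Orthogonality

variable {G : Type*} [Group G] [TopologicalSpace G] [IsTopologicalGroup G] [CompactSpace G]
  [MeasurableSpace G] [BorelSpace G] {K : Subgroup G}

instance : (haarG G).IsHaarMeasure := by unfold haarG; infer_instance

/-- Compact groups are unimodular: a right translate of Haar measure is again a Haar probability
measure, and there is only one. Integration by parts along left-invariant fields depends on this,
because such fields differentiate along right translations. -/
instance : (haarG G).IsMulRightInvariant where
  map_mul_right_eq_self g := by
    have : IsProbabilityMeasure ((haarG G).map (· * g)) :=
      Measure.isProbabilityMeasure_map (measurable_mul_const g).aemeasurable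
    exact Measure.isHaarMeasure_eq_of_isProbabilityMeasure _ _

theorem integrable_of_continuous {f : G → ℂ} (hf : Continuous f) : Integrable f (haarG G) :=
  hf.integrable_of_hasCompactSupport (HasCompactSupport.of_compactSpace f)

namespace TypeOneRep

variable (ξ η : TypeOneRep G K)

/-- The averaged intertwiner. -/
theorem mul_integral_mat (j : Fin ξ.d) (l : Fin η.d) (g : G) :
    (Matrix.of fun a b => ∫ x, ξ.mat x a j * star (η.mat x b l) ∂(haarG G)) * η.mat g =
    ξ.mat g * (Matrix.of fun a b => ∫ x, ξ.mat x a j * star (η.mat x b l) ∂(haarG G)) := by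
  ext a b
  simp only [Matrix.mul_apply, Matrix.of_apply]
  have h1 : ∑ c, ξ.mat g a c * ∫ x, ξ.mat x c j * star (η.mat x b l) ∂(haarG G) =
      ∫ x, ξ.mat (g * x) a j * star (η.mat x b l) ∂(haarG G) := by
    simp_rw [← integral_const_mul]
    rw [← integral_finsetSum _ fun c _ =>
      (integrable_of_continuous (ξ.continuous_mat_mul_star η c j b l)).const_mul _]
    congr 1 with x
    rw [mat_mul, Matrix.mul_apply, Finset.sum_mul]
    exact Finset.sum_congr rfl fun c _ => by ring
  have h2 : ∑ c, (∫ x, ξ.mat x a j * star (η.mat x c l) ∂(haarG G)) * η.mat g c b =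
      ∫ x, ξ.mat x a j * star (η.mat (g⁻¹ * x) b l) ∂(haarG G) := by
    simp_rw [← integral_mul_const]
    rw [← integral_finsetSum _ fun c _ =>
      (integrable_of_continuous (ξ.continuous_mat_mul_star η a j c l)).mul_const _]
    congr 1 with x
    rw [mat_mul, mat_inv, Matrix.mul_apply, star_sum, Finset.mul_sum]
    exact Finset.sum_congr rfl fun c _ => by
      rw [Matrix.conjTranspose_apply, star_mul', star_star]; ring
  rw [h1, h2, ← integral_mul_left_eq_self _ g]
  simp

/-- Schur orthogonality for inequivalent representations. -/
theorem integral_mat_mul_star_of_not_equivalent (hne : ¬ Equivalent η ξ)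
    (a j : Fin ξ.d) (b l : Fin η.d) :
    ∫ x, ξ.mat x a j * star (η.mat x b l) ∂(haarG G) = 0 :=
  congrFun (congrFun (η.eq_zero_of_intertwining ξ (ξ.mul_integral_mat η j l) hne) a) b

/-- Schur orthogonality within a representation. -/
theorem integral_mat_mul_star (a j b l : Fin ξ.d) :
    ∫ x, ξ.mat x a j * star (ξ.mat x b l) ∂(haarG G) =
      if a = b ∧ j = l then (ξ.d : ℂ)⁻¹ else 0 := by
  obtain ⟨c, hc⟩ := ξ.eq_smul_one_of_commute (ξ.mul_integral_mat ξ j l)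
  have hd : (ξ.d : ℂ) ≠ 0 := by exact_mod_cast ξ.d_pos.ne'
  -- The trace determines the Schur scalar: summing over a = b leaves the entry (l, j) of ξ(x)ᴴξ(x)
  -- = 1, which does not depend on x.
  have htr : (ξ.d : ℂ) * c = if j = l then 1 else 0 := by
    have h := congrArg Matrix.trace hc
    rw [Matrix.trace_smul, Matrix.trace_one, Fintype.card_fin] at h
    rw [mul_comm, ← smul_eq_mul, ← h, Matrix.trace]
    simp only [Matrix.diag_apply, Matrix.of_apply]
    rw [← integral_finsetSum _ fun a _ =>
      integrable_of_continuous (ξ.continuous_mat_mul_star ξ a j a l)]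
    have : ∀ x, ∑ a, ξ.mat x a j * star (ξ.mat x a l) = if j = l then 1 else 0 := fun x => by
      have h := congrFun (congrFun (ξ.conjTranspose_mul_mat x) l) j
      simp only [Matrix.mul_apply, Matrix.conjTranspose_apply, Matrix.one_apply] at h
      simp_rw [mul_comm (ξ.mat x _ j), h, eq_comm]
    simp_rw [this]
    simp
  have h := congrFun (congrFun hc a) b
  simp only [Matrix.of_apply, Matrix.smul_apply, Matrix.one_apply, smul_eq_mul] at h
  rw [h]
  have hc' : c = (ξ.d : ℂ)⁻¹ * if j = l then 1 else 0 := by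
    rw [← htr, ← mul_assoc, inv_mul_cancel₀ hd, one_mul]
  rw [hc']
  by_cases h1 : a = b <;> by_cases h2 : j = l <;> simp [h1, h2]

end TypeOneRep

end Orthogonality

end HomBesov

end

noncomputable section

namespace HomBesov

/-! ### Left-invariant derivatives, computed in the chart at the identity. -/

section ComplexValued

variable {E : Type*} [NormedAddCommGroup E] [NormedSpace ℝ E]
  {G : Type*} [TopologicalSpace G] [ChartedSpace E G]

theorem contMDiff_mul_complex {f h : G → ℂ} (hf : ContMDiff 𝓘(ℝ, E) 𝓘(ℝ, ℂ) ∞ f)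
    (hh : ContMDiff 𝓘(ℝ, E) 𝓘(ℝ, ℂ) ∞ h) :
    ContMDiff 𝓘(ℝ, E) 𝓘(ℝ, ℂ) ∞ fun x => f x * h x :=
  (show ContDiff ℝ ∞ (fun z : ℂ × ℂ => z.1 * z.2) by fun_prop).contMDiff.comp (hf.prodMk_space hh)

theorem contMDiff_sum_const_mul {ι : Type*} (s : Finset ι) (c : ι → ℂ) {f : ι → G → ℂ}
    (hf : ∀ i, ContMDiff 𝓘(ℝ, E) 𝓘(ℝ, ℂ) ∞ (f i)) :
    ContMDiff 𝓘(ℝ, E) 𝓘(ℝ, ℂ) ∞ fun x => ∑ i ∈ s, c i * f i x :=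
  contMDiff_finsetSum fun i _ => contMDiff_mul_complex contMDiff_const (hf i)

theorem contMDiff_star_complex {f : G → ℂ} (hf : ContMDiff 𝓘(ℝ, E) 𝓘(ℝ, ℂ) ∞ f) :
    ContMDiff 𝓘(ℝ, E) 𝓘(ℝ, ℂ) ∞ fun x => star (f x) :=
  Complex.conjCLE.contDiff.contMDiff.comp hf

end ComplexValued

section LieAlgebra

variable {E : Type*} [NormedAddCommGroup E] [NormedSpace ℝ E]
  {G : Type*} [Group G] [TopologicalSpace G] [ChartedSpace E G]

/-- The identification of the Lie algebra with the model space. -/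
def toModel : GroupLieAlgebra 𝓘(ℝ, E) G ≃ₗ[ℝ] E := LinearEquiv.refl ℝ E

theorem mfderiv_one_eq_fderiv {f : G → ℂ} (hf : ContMDiff 𝓘(ℝ, E) 𝓘(ℝ, ℂ) ∞ f)
    (X : GroupLieAlgebra 𝓘(ℝ, E) G) :
    mfderiv 𝓘(ℝ, E) 𝓘(ℝ, ℂ) f 1 X =
      fderiv ℝ (fun e => f ((extChartAt 𝓘(ℝ, E) (1 : G)).symm e))
        (extChartAt 𝓘(ℝ, E) (1 : G) 1) (toModel X) := by
  have h := (hf.mdifferentiableAt (x := 1) (by simp)).hasMFDerivAt.2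
  rw [modelWithCornersSelf_coe, Set.range_id] at h
  let D : E →L[ℝ] ℂ := mfderiv 𝓘(ℝ, E) 𝓘(ℝ, ℂ) f 1
  have h' : HasFDerivWithinAt (fun e => f ((extChartAt 𝓘(ℝ, E) (1 : G)).symm e)) D Set.univ
    (extChartAt 𝓘(ℝ, E) (1 : G) 1) := h
  rw [(hasFDerivWithinAt_univ.1 h').fderiv]
  rfl

theorem iterLieDeriv_append {n : ℕ}
    (Y : Module.Basis (Fin n) ℝ (GroupLieAlgebra 𝓘(ℝ, E) G))
    (v w : List (Fin n)) (f : G → ℂ) :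
    iterLieDeriv Y (v ++ w) f = iterLieDeriv Y v (iterLieDeriv Y w f) := by
  simp [iterLieDeriv, List.foldr_append]

end LieAlgebra

section LieDerivative

variable {E : Type*} [NormedAddCommGroup E] [NormedSpace ℝ E]
  {G : Type*} [Group G] [TopologicalSpace G] [ChartedSpace E G] [LieGroup 𝓘(ℝ, E) ∞ G]

/-- The left-invariant field is the tangent map of multiplication evaluated at the zero vector over
g and X over 1, so it inherits the smoothness of multiplication. -/
theorem contMDiff_mulInvariantVectorField_infty (X : GroupLieAlgebra 𝓘(ℝ, E) G) :
    ContMDiff 𝓘(ℝ, E) 𝓘(ℝ, E).tangent ∞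
      (fun g : G => (mulInvariantVectorField X g : TangentBundle 𝓘(ℝ, E) G)) := by
  let fg : G → TangentBundle 𝓘(ℝ, E) G := fun g ↦ Bundle.TotalSpace.mk' E g 0
  have sfg : ContMDiff 𝓘(ℝ, E) 𝓘(ℝ, E).tangent ∞ fg := Bundle.contMDiff_zeroSection _ _
  let fv : G → TangentBundle 𝓘(ℝ, E) G := fun _ ↦ Bundle.TotalSpace.mk' E 1 X
  have sfv : ContMDiff 𝓘(ℝ, E) 𝓘(ℝ, E).tangent ∞ fv := contMDiff_const
  have S₁ := sfg.prodMk sfv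
  have S₂ : ContMDiff _ _ ∞ (equivTangentBundleProd 𝓘(ℝ, E) G 𝓘(ℝ, E) G).symm :=
    contMDiff_equivTangentBundleProd_symm
  have S₃ : ContMDiff _ _ ∞
      (tangentMap (𝓘(ℝ, E).prod 𝓘(ℝ, E)) 𝓘(ℝ, E) (fun p : G × G ↦ p.1 * p.2)) :=
    ContMDiff.contMDiff_tangentMap (contMDiff_mul 𝓘(ℝ, E) ∞) (m := ∞) le_rfl
  convert! (S₃.comp S₂).comp S₁ with g
  · simp [fg, fv]
  · simp only [Function.comp_apply, tangentMap, fg, fv]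
    rw [mfderiv_prod_eq_add_apply ((contMDiff_mul 𝓘(ℝ, E) ∞).mdifferentiableAt (by simp))]
    exact (zero_add _).symm.trans
      (congrArg₂ (fun a b : E => a + b) (ContinuousLinearMap.map_zero _).symm rfl)

theorem contMDiff_lieDeriv (X : GroupLieAlgebra 𝓘(ℝ, E) G) {f : G → ℂ}
    (hf : ContMDiff 𝓘(ℝ, E) 𝓘(ℝ, ℂ) ∞ f) : ContMDiff 𝓘(ℝ, E) 𝓘(ℝ, ℂ) ∞ (lieDeriv X f) := by
  have h1 : ContMDiff 𝓘(ℝ, E).tangent 𝓘(ℝ, ℂ).tangent ∞ (tangentMap 𝓘(ℝ, E) 𝓘(ℝ, ℂ) f) :=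
    hf.contMDiff_tangentMap (m := ∞) le_rfl
  have h2 := h1.comp (contMDiff_mulInvariantVectorField_infty X)
  exact (contMDiff_snd_tangentBundle_modelSpace ℂ 𝓘(ℝ, ℂ)).comp h2

/-- The function `f` near `g`, in the chart at the identity moved to `g`. -/
def localForm (f : G → ℂ) (g : G) (e : E) : ℂ := f (g * (extChartAt 𝓘(ℝ, E) (1 : G)).symm e)

theorem contMDiffAt_localForm {f : G → ℂ} (hf : ContMDiff 𝓘(ℝ, E) 𝓘(ℝ, ℂ) ∞ f) (g : G) {e : E}
    (he : e ∈ (extChartAt 𝓘(ℝ, E) (1 : G)).target) : ContDiffAt ℝ ∞ (localForm f g) e := by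
  rw [← contMDiffAt_iff_contDiffAt]
  have h1 := (contMDiffOn_extChartAt_symm (I := 𝓘(ℝ, E)) (n := ∞) (1 : G)).contMDiffAt
    ((isOpen_extChartAt_target (1 : G)).mem_nhds he)
  exact (hf.comp (contMDiff_mul_left (a := g))).contMDiffAt.comp e h1

theorem differentiableAt_localForm {f : G → ℂ} (hf : ContMDiff 𝓘(ℝ, E) 𝓘(ℝ, ℂ) ∞ f) (g : G) :
    DifferentiableAt ℝ (localForm f g) (extChartAt 𝓘(ℝ, E) (1 : G) 1) :=
  (contMDiffAt_localForm hf g (mem_extChartAt_target (1 : G))).differentiableAt (by simp)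

theorem lieDeriv_eq_mfderiv {f : G → ℂ} (hf : ContMDiff 𝓘(ℝ, E) 𝓘(ℝ, ℂ) ∞ f)
    (X : GroupLieAlgebra 𝓘(ℝ, E) G) (g : G) :
    lieDeriv X f g = mfderiv 𝓘(ℝ, E) 𝓘(ℝ, ℂ) (fun y => f (g * y)) 1 X := by
  have h := mfderiv_comp_apply (I := 𝓘(ℝ, E)) (I' := 𝓘(ℝ, E)) (I'' := 𝓘(ℝ, ℂ)) (1 : G)
    (g := f) (f := fun y => g * y) (hf.mdifferentiableAt (by simp))
    ((contMDiff_mul_left (a := g) (I := 𝓘(ℝ, E)) (n := ∞)).mdifferentiableAt (by simp)) X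
  rw [Function.comp_def] at h
  have h2 : ∀ (a b : G) (_ : a = b) (v : E),
      (mfderiv 𝓘(ℝ, E) 𝓘(ℝ, ℂ) f a : E →L[ℝ] ℂ) v = (mfderiv 𝓘(ℝ, E) 𝓘(ℝ, ℂ) f b : E →L[ℝ] ℂ) v := by
    rintro a _ rfl v; rfl
  rw [h]
  exact h2 g (g * 1) (mul_one g).symm _

/-- Reduces calculus on G to `fderiv` on E: the derivative at g is the derivative at 1 of a left
translate, always read in the same chart. The product, sum and conjugation rules then follow from
the flat ones. -/
theorem lieDeriv_eq_fderiv {f : G → ℂ} (hf : ContMDiff 𝓘(ℝ, E) 𝓘(ℝ, ℂ) ∞ f)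
    (X : GroupLieAlgebra 𝓘(ℝ, E) G) (g : G) :
    lieDeriv X f g = fderiv ℝ (localForm f g) (extChartAt 𝓘(ℝ, E) (1 : G) 1) (toModel X) := by
  rw [lieDeriv_eq_mfderiv hf, mfderiv_one_eq_fderiv]
  · rfl
  · exact hf.comp (contMDiff_mul_left (a := g))

theorem lieDeriv_mul {f h : G → ℂ} (hf : ContMDiff 𝓘(ℝ, E) 𝓘(ℝ, ℂ) ∞ f)
    (hh : ContMDiff 𝓘(ℝ, E) 𝓘(ℝ, ℂ) ∞ h) (X : GroupLieAlgebra 𝓘(ℝ, E) G) (g : G) :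
    lieDeriv X (fun x => f x * h x) g = f g * lieDeriv X h g + lieDeriv X f g * h g := by
  rw [lieDeriv_eq_fderiv (contMDiff_mul_complex hf hh), lieDeriv_eq_fderiv hf,
    lieDeriv_eq_fderiv hh]
  have h1 := ((differentiableAt_localForm hf g).hasFDerivAt.mul
    (differentiableAt_localForm hh g).hasFDerivAt).fderiv
  have h2 : localForm (E := E) (fun x => f x * h x) g = localForm f g * localForm h g := rfl
  rw [h2, h1]
  simp only [localForm, extChartAt_to_inv, mul_one]
  simp [mul_comm]

theorem lieDeriv_sum_const_mul {ι : Type*} (s : Finset ι) (c : ι → ℂ) {f : ι → G → ℂ}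
    (hf : ∀ i, ContMDiff 𝓘(ℝ, E) 𝓘(ℝ, ℂ) ∞ (f i)) (X : GroupLieAlgebra 𝓘(ℝ, E) G) (g : G) :
    lieDeriv X (fun x => ∑ i ∈ s, c i * f i x) g = ∑ i ∈ s, c i * lieDeriv X (f i) g := by
  rw [lieDeriv_eq_fderiv (contMDiff_sum_const_mul s c hf)]
  simp_rw [lieDeriv_eq_fderiv (hf _)]
  have h1 := (HasFDerivAt.fun_sum (u := s) fun i _ =>
    (differentiableAt_localForm (hf i) g).hasFDerivAt.const_mul (c i)).fderiv
  have h2 : localForm (E := E) (fun x => ∑ i ∈ s, c i * f i x) g =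
    fun e => ∑ i ∈ s, c i * localForm (f i) g e := rfl
  rw [h2, h1]
  simp

theorem lieDeriv_star {f : G → ℂ} (hf : ContMDiff 𝓘(ℝ, E) 𝓘(ℝ, ℂ) ∞ f)
    (X : GroupLieAlgebra 𝓘(ℝ, E) G) (g : G) :
    lieDeriv X (fun x => star (f x)) g = star (lieDeriv X f g) := by
  rw [lieDeriv_eq_fderiv (contMDiff_star_complex hf), lieDeriv_eq_fderiv hf]
  have h1 := (differentiableAt_localForm hf g).hasFDerivAt.star.fderiv
  have h2 : localForm (E := E) (fun x => star (f x)) g = fun e => star (localForm f g e) := rfl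
  rw [h2, h1]
  simp

theorem contMDiff_iterLieDeriv {n : ℕ} (Y : Module.Basis (Fin n) ℝ (GroupLieAlgebra 𝓘(ℝ, E) G))
    {f : G → ℂ} (hf : ContMDiff 𝓘(ℝ, E) 𝓘(ℝ, ℂ) ∞ f) (w : List (Fin n)) :
    ContMDiff 𝓘(ℝ, E) 𝓘(ℝ, ℂ) ∞ (iterLieDeriv Y w f) := by
  induction w with
  | nil => exact hf
  | cons i w ih => exact contMDiff_lieDeriv _ ih

/-- A straight line in the chart at 1 stands in for the one-parameter subgroup of X. Only its
velocity at t = 0 matters, so no exponential map is needed. -/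
theorem hasDerivAt_localForm_line {f : G → ℂ} (hf : ContMDiff 𝓘(ℝ, E) 𝓘(ℝ, ℂ) ∞ f)
    (X : GroupLieAlgebra 𝓘(ℝ, E) G) (g : G) :
    HasDerivAt (fun t : ℝ => localForm f g (extChartAt 𝓘(ℝ, E) (1 : G) 1 + t • toModel X))
      (lieDeriv X f g) 0 := by
  rw [lieDeriv_eq_fderiv hf]
  have h1 : HasDerivAt (fun t : ℝ => extChartAt 𝓘(ℝ, E) (1 : G) 1 + t • toModel X) (toModel X) 0 := by
    simpa using ((hasDerivAt_id (0 : ℝ)).smul_const (toModel X)).const_add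
      (extChartAt 𝓘(ℝ, E) (1 : G) 1)
  exact (differentiableAt_localForm hf g).hasFDerivAt.comp_hasDerivAt_of_eq (0 : ℝ) h1 (by simp)

/-- Supplies the domination for differentiating under the integral sign. A point x near x₀ is
written as x₀ times the chart inverse of e, and the function is then C¹ jointly in (t, e), hence
Lipschitz in t uniformly in e. -/
theorem exists_lipschitzOnWith_localForm_line {f : G → ℂ}
    (hf : ContMDiff 𝓘(ℝ, E) 𝓘(ℝ, ℂ) ∞ f) (X : GroupLieAlgebra 𝓘(ℝ, E) G) (x₀ : G) :
    ∃ (C : ℝ≥0) (ε : ℝ), 0 < ε ∧ ∀ᶠ x in nhds x₀, LipschitzOnWith C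
      (fun t : ℝ => localForm f x (extChartAt 𝓘(ℝ, E) (1 : G) 1 + t • toModel X)) (Metric.ball 0 ε) := by
  set c := extChartAt 𝓘(ℝ, E) (1 : G) with hc
  let F : ℝ × E → ℂ := fun p => f (x₀ * c.symm p.2 * c.symm (c 1 + p.1 • toModel X))
  have hF : ContDiffAt ℝ ∞ F (0, c 1) := by
    rw [← contMDiffAt_iff_contDiffAt]
    have hsymm : ContMDiffAt 𝓘(ℝ, E) 𝓘(ℝ, E) ∞ c.symm (c 1) :=
      (contMDiffOn_extChartAt_symm (I := 𝓘(ℝ, E)) (n := ∞) (1 : G)).contMDiffAt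
        ((isOpen_extChartAt_target (1 : G)).mem_nhds (mem_extChartAt_target (1 : G)))
    have h1 : ContMDiffAt 𝓘(ℝ, ℝ × E) 𝓘(ℝ, E) ∞ (fun p : ℝ × E => c.symm p.2) (0, c 1) :=
      ContMDiffAt.comp (I' := 𝓘(ℝ, E)) ((0 : ℝ), c 1) (f := fun p : ℝ × E => p.2) hsymm
        contDiff_snd.contMDiff.contMDiffAt
    have h2 : ContMDiffAt 𝓘(ℝ, ℝ × E) 𝓘(ℝ, E) ∞
        (fun p : ℝ × E => c.symm (c 1 + p.1 • toModel X)) (0, c 1) := by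
      refine ContMDiffAt.comp (I' := 𝓘(ℝ, E)) ((0 : ℝ), c 1)
        (f := fun p : ℝ × E => c 1 + p.1 • toModel X) (by simpa using hsymm) ?_
      exact (show ContDiff ℝ ∞ (fun p : ℝ × E => c 1 + p.1 • toModel X) by fun_prop).contMDiff.contMDiffAt
    have h3 := (contMDiffAt_const (c := x₀)).mul h1 |>.mul h2
    exact ContMDiffAt.comp (I' := 𝓘(ℝ, E)) ((0 : ℝ), c 1) hf.contMDiffAt h3
  obtain ⟨C, t, ht, hC⟩ := (hF.of_le (m := 1) (by simp)).exists_lipschitzOnWith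
  obtain ⟨U, hU, V, hV, hUV⟩ := mem_nhds_prod_iff.1 ht
  obtain ⟨ε, hε, hεU⟩ := Metric.mem_nhds_iff.1 hU
  refine ⟨C, ε, hε, ?_⟩
  have hx : Filter.Tendsto (fun x => x₀⁻¹ * x) (nhds x₀) (nhds 1) := by
    have : Continuous (fun x : G => x₀⁻¹ * x) :=
      (contMDiff_mul_left (a := x₀⁻¹) (I := 𝓘(ℝ, E)) (n := ∞)).continuous
    simpa using this.tendsto x₀
  filter_upwards [hx (extChartAt_source_mem_nhds (I := 𝓘(ℝ, E)) (1 : G)),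
    ((continuousAt_extChartAt (I := 𝓘(ℝ, E)) (1 : G)).tendsto.comp hx) hV] with x hxs hxV
  have hFx : ∀ t : ℝ, localForm f x (c 1 + t • toModel X) = F (t, c (x₀⁻¹ * x)) := fun t => by
    simp only [F, localForm, ← hc]
    rw [c.left_inv hxs, mul_inv_cancel_left]
  intro a ha b hb
  simp only [hFx]
  have hxV' : c (x₀⁻¹ * x) ∈ V := hxV
  refine (hC (hUV (Set.mk_mem_prod (hεU ha) hxV'))
    (hUV (Set.mk_mem_prod (hεU hb) hxV'))).trans_eq ?_
  simp [Prod.edist_eq]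

end LieDerivative

/-! ### Integration by parts on the group. -/

section IntegrationByParts

variable {E : Type*} [NormedAddCommGroup E] [NormedSpace ℝ E]
  {G : Type*} [Group G] [TopologicalSpace G] [ChartedSpace E G] [LieGroup 𝓘(ℝ, E) ∞ G]
  [IsTopologicalGroup G] [CompactSpace G] [MeasurableSpace G] [BorelSpace G]

/-- The derivative at t = 0 of ∫ f(xγ(t)) dx for a curve γ through 1 with velocity X; by right
invariance this integral does not depend on t. -/
theorem integral_lieDeriv_eq_zero {f : G → ℂ} (hf : ContMDiff 𝓘(ℝ, E) 𝓘(ℝ, ℂ) ∞ f)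
    (X : GroupLieAlgebra 𝓘(ℝ, E) G) : ∫ x, lieDeriv X f x ∂(haarG G) = 0 := by
  set F : ℝ → G → ℂ := fun t x => localForm f x (extChartAt 𝓘(ℝ, E) (1 : G) 1 + t • toModel X)
  obtain ⟨C, ε, hε, hC⟩ : ∃ (C : ℝ≥0) (ε : ℝ), 0 < ε ∧
      ∀ x ∈ (Set.univ : Set G), LipschitzOnWith C (fun t => F t x) (Metric.ball 0 ε) := by
    -- Compactness of G turns the local constants C and ε into uniform ones.
    refine isCompact_univ.induction_on ⟨0, 1, one_pos, by simp⟩ ?_ ?_ ?_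
    · rintro s t hst ⟨C, ε, hε, h⟩
      exact ⟨C, ε, hε, fun x hx => h x (hst hx)⟩
    · rintro s t ⟨C, ε, hε, h⟩ ⟨C', ε', hε', h'⟩
      refine ⟨max C C', min ε ε', lt_min hε hε', fun x hx => ?_⟩
      rcases hx with hx | hx
      · exact ((h x hx).mono (Metric.ball_subset_ball (min_le_left _ _))).weaken (le_max_left _ _)
      · exact ((h' x hx).mono (Metric.ball_subset_ball (min_le_right _ _))).weaken
          (le_max_right _ _)
    · intro x _
      obtain ⟨C, ε, hε, h⟩ := exists_lipschitzOnWith_localForm_line hf X x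
      exact ⟨_, mem_nhdsWithin_of_mem_nhds h, C, ε, hε, fun x hx => hx⟩
  have hcont : ∀ t, Continuous (F t) := fun t => hf.continuous.comp (continuous_mul_const _)
  have h := hasDerivAt_integral_of_dominated_loc_of_lip (μ := haarG G) (F := F) (x₀ := (0 : ℝ))
    (F' := lieDeriv X f) (bound := fun _ => (C : ℝ)) (Metric.ball_mem_nhds 0 hε)
    (Filter.Eventually.of_forall fun t => (integrable_of_continuous (hcont t)).1)
    (integrable_of_continuous (hcont 0))
    (integrable_of_continuous (contMDiff_lieDeriv X hf).continuous).1
    (Filter.Eventually.of_forall fun x => by simpa using hC x (Set.mem_univ x))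
    (integrable_const _) (Filter.Eventually.of_forall fun x => hasDerivAt_localForm_line hf X x)
  have hconst : (fun t => ∫ x, F t x ∂(haarG G)) = fun _ => ∫ x, f x ∂(haarG G) := by
    ext t
    exact integral_mul_right_eq_self f _
  rw [hconst] at h
  exact h.2.unique (hasDerivAt_const _ _)

theorem integral_mul_lieDeriv {f h : G → ℂ} (hf : ContMDiff 𝓘(ℝ, E) 𝓘(ℝ, ℂ) ∞ f)
    (hh : ContMDiff 𝓘(ℝ, E) 𝓘(ℝ, ℂ) ∞ h) (X : GroupLieAlgebra 𝓘(ℝ, E) G) :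
    ∫ x, f x * lieDeriv X h x ∂(haarG G) = -∫ x, lieDeriv X f x * h x ∂(haarG G) := by
  have h0 := integral_lieDeriv_eq_zero (contMDiff_mul_complex hf hh) X
  simp_rw [lieDeriv_mul hf hh X] at h0
  rw [integral_add (f := fun x => f x * lieDeriv X h x) (g := fun x => lieDeriv X f x * h x)
    (integrable_of_continuous (hf.continuous.mul (contMDiff_lieDeriv X hh).continuous))
    (integrable_of_continuous ((contMDiff_lieDeriv X hf).continuous.mul hh.continuous))] at h0
  exact eq_neg_of_add_eq_zero_left h0

variable {n : ℕ} (Y : Module.Basis (Fin n) ℝ (GroupLieAlgebra 𝓘(ℝ, E) G))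

/-- Decay of the integrals of a smooth function against eigenfunctions of the Laplacian. -/
theorem pow_mul_norm_integral_mul_le {h : G → ℂ} (hh : ContMDiff 𝓘(ℝ, E) 𝓘(ℝ, ℂ) ∞ h)
    (hb : ∀ x, ‖h x‖ ≤ 1) {l : ℝ} (hl : 0 ≤ l) (hlap : ∀ x, -laplacian Y h x = (l : ℂ) * h x)
    (M : ℕ) {f : G → ℂ} (hf : ContMDiff 𝓘(ℝ, E) 𝓘(ℝ, ℂ) ∞ f) {A : ℝ}
    (hA : ∀ w : List (Fin n), w.length ≤ 2 * M → ∀ x, ‖iterLieDeriv Y w f x‖ ≤ A) :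
    (1 + l) ^ M * ‖∫ x, f x * h x ∂(haarG G)‖ ≤ (1 + n) ^ M * A := by
  induction M generalizing f with
  | zero =>
    have hA' : ∀ x, ‖f x‖ ≤ A := hA [] (by simp)
    have := norm_integral_le_of_norm_le_const (μ := haarG G) (f := fun x => f x * h x) (C := A)
      (Filter.Eventually.of_forall fun x => by
        rw [norm_mul]
        exact (mul_le_mul (hA' x) (hb x) (norm_nonneg _) ((norm_nonneg _).trans (hA' x))).trans_eq
          (mul_one A))
    simpa using this
  | succ M ih =>
    have hs : ∀ i, ContMDiff 𝓘(ℝ, E) 𝓘(ℝ, ℂ) ∞ (lieDeriv (Y i) (lieDeriv (Y i) f)) := fun i =>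
      contMDiff_lieDeriv _ (contMDiff_lieDeriv _ hf)
    -- Two integrations by parts move each Y_i² from the eigenfunction h to f.
    have hibp : (l : ℂ) * ∫ x, f x * h x ∂(haarG G) =
        -∑ i, ∫ x, lieDeriv (Y i) (lieDeriv (Y i) f) x * h x ∂(haarG G) := by
      have h1 : ∀ i, ∫ x, lieDeriv (Y i) (lieDeriv (Y i) f) x * h x ∂(haarG G) =
          ∫ x, f x * lieDeriv (Y i) (lieDeriv (Y i) h) x ∂(haarG G) := fun i => by
        rw [integral_mul_lieDeriv hf (contMDiff_lieDeriv _ hh),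
          integral_mul_lieDeriv (contMDiff_lieDeriv _ hf) hh, neg_neg]
      simp_rw [h1]
      rw [← integral_finsetSum (f := fun i x => f x * lieDeriv (Y i) (lieDeriv (Y i) h) x) _
        fun i _ => integrable_of_continuous (hf.continuous.mul
        (contMDiff_lieDeriv _ (contMDiff_lieDeriv _ hh)).continuous), ← integral_neg,
        ← integral_const_mul]
      congr 1 with x
      rw [← Finset.mul_sum, ← mul_neg, ← laplacian, hlap]
      ring
    have h2 : ∀ i, (1 + l) ^ M * ‖∫ x, lieDeriv (Y i) (lieDeriv (Y i) f) x * h x ∂(haarG G)‖ ≤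
        (1 + n) ^ M * A := fun i => ih (hs i) fun w hw x => by
      have := hA (w ++ [i, i]) (by simp; omega) x
      rwa [iterLieDeriv_append] at this
    have h3 := ih hf fun w hw => hA w (by omega)
    -- One factor 1 + l is paid for by f and its n second derivatives Y_i²f. This explains the
    -- factor 1 + n and the two additional derivatives per induction step.
    have hnorm : (1 + l) * ‖∫ x, f x * h x ∂(haarG G)‖ ≤ ‖∫ x, f x * h x ∂(haarG G)‖ +
        ∑ i, ‖∫ x, lieDeriv (Y i) (lieDeriv (Y i) f) x * h x ∂(haarG G)‖ := by
      rw [add_mul, one_mul]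
      gcongr
      calc l * ‖∫ x, f x * h x ∂(haarG G)‖ = ‖(l : ℂ) * ∫ x, f x * h x ∂(haarG G)‖ := by
            rw [norm_mul, Complex.norm_real, Real.norm_of_nonneg hl]
        _ ≤ _ := by rw [hibp, norm_neg]; exact norm_sum_le _ _
    calc (1 + l) ^ (M + 1) * ‖∫ x, f x * h x ∂(haarG G)‖
        = (1 + l) ^ M * ((1 + l) * ‖∫ x, f x * h x ∂(haarG G)‖) := by ring
      _ ≤ (1 + l) ^ M * (‖∫ x, f x * h x ∂(haarG G)‖ +
          ∑ i, ‖∫ x, lieDeriv (Y i) (lieDeriv (Y i) f) x * h x ∂(haarG G)‖) := by gcongr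
      _ ≤ (1 + n) ^ M * A + ∑ _i : Fin n, (1 + n) ^ M * A := by
          rw [mul_add, Finset.mul_sum]
          exact add_le_add h3 (Finset.sum_le_sum fun i _ => h2 i)
      _ = (1 + n) ^ (M + 1) * A := by simp; ring

end IntegrationByParts

end HomBesov

end

noncomputable section

namespace HomBesov

/-! ### Continuous representations are smooth. -/

section Convolution

variable {E : Type*} [NormedAddCommGroup E] [NormedSpace ℝ E]
  {G : Type*} [Group G] [TopologicalSpace G] [IsTopologicalGroup G] [CompactSpace G]
  [ChartedSpace E G] [LieGroup 𝓘(ℝ, E) ∞ G] [MeasurableSpace G] [BorelSpace G]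

/-- Smoothness near the identity of the convolution of a continuous function with a smooth function
of small support. -/
theorem contMDiffAt_integral_inv_mul {φ : G → ℂ} (hφ : ContMDiff 𝓘(ℝ, E) 𝓘(ℝ, ℂ) ∞ φ)
    {V N : Set G} (hV : IsOpen V) (h1V : 1 ∈ V) (hN : IsCompact N)
    (hNs : N ⊆ (extChartAt 𝓘(ℝ, E) (1 : G)).source)
    (hφV : ∀ x ∈ V, ∀ y, φ (x⁻¹ * y) ≠ 0 → y ∈ N) {f : G → ℂ} (hf : Continuous f) :
    ContMDiffAt 𝓘(ℝ, E) 𝓘(ℝ, ℂ) ∞ (fun x => ∫ y, f y * φ (x⁻¹ * y) ∂(haarG G)) 1 := by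
  classical
  borelize E
  set c := extChartAt 𝓘(ℝ, E) (1 : G) with hc
  have hopen : IsOpen c.source := isOpen_extChartAt_source (1 : G)
  have htopen : IsOpen c.target := isOpen_extChartAt_target (1 : G)
  have hcc : ContinuousOn c c.source := continuousOn_extChartAt (1 : G)
  have hcs : ContinuousOn c.symm c.target := continuousOn_extChartAt_symm (1 : G)
  have hsm : ContMDiffOn 𝓘(ℝ, E) 𝓘(ℝ, E) ∞ c.symm c.target := contMDiffOn_extChartAt_symm (1 : G)
  have hcm : AEMeasurable c ((haarG G).restrict c.source) := hcc.aemeasurable hopen.measurableSet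
  -- Haar measure on the chart domain is transported to E as it is. No density with respect to
  -- Lebesgue measure is needed, since all smoothness in x comes from the kernel g.
  set μ : Measure E := ((haarG G).restrict c.source).map c with hμ
  set k : Set E := c '' N
  have hk : IsCompact k := hN.image_of_continuousOn (hcc.mono hNs)
  set s : Set E := c.target ∩ c.symm ⁻¹' V
  have hs : IsOpen s := hcs.isOpen_inter_preimage htopen hV
  -- Outside the chart target `c.symm` carries no information, so g is cut off there. It remains
  -- smooth because, for p in s, it vanishes off the compact set k inside the target.
  let g : E → E → ℂ := fun p t => if t ∈ c.target then φ ((c.symm p)⁻¹ * c.symm t) else 0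
  let F : E → ℂ := c.target.indicator (f ∘ c.symm)
  have hgk : ∀ p t, p ∈ s → t ∉ k → g p t = 0 := by
    intro p t hp ht
    by_contra h
    by_cases htt : t ∈ c.target
    · have := hφV _ hp.2 (c.symm t) (by simpa [g, htt] using h)
      exact ht ⟨_, this, c.right_inv htt⟩
    · simp [g, htt] at h
  have hgs : ContDiffOn ℝ ∞ (fun q : E × E => g q.1 q.2) (s ×ˢ Set.univ) := by
    rintro ⟨p, t⟩ ⟨hp, -⟩
    apply ContDiffAt.contDiffWithinAt
    by_cases htt : t ∈ c.target
    · have h1 : ContMDiffAt 𝓘(ℝ, E × E) 𝓘(ℝ, E) ∞ (fun q : E × E => c.symm q.1) (p, t) :=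
        ContMDiffAt.comp (I' := 𝓘(ℝ, E)) (p, t) (f := fun q : E × E => q.1)
          (hsm.contMDiffAt (htopen.mem_nhds hp.1)) contDiff_fst.contMDiff.contMDiffAt
      have h2 : ContMDiffAt 𝓘(ℝ, E × E) 𝓘(ℝ, E) ∞ (fun q : E × E => c.symm q.2) (p, t) :=
        ContMDiffAt.comp (I' := 𝓘(ℝ, E)) (p, t) (f := fun q : E × E => q.2)
          (hsm.contMDiffAt (htopen.mem_nhds htt)) contDiff_snd.contMDiff.contMDiffAt
      have h3 : ContMDiffAt 𝓘(ℝ, E × E) 𝓘(ℝ, ℂ) ∞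
          (fun q : E × E => φ ((c.symm q.1)⁻¹ * c.symm q.2)) (p, t) :=
        ContMDiffAt.comp (I' := 𝓘(ℝ, E)) (p, t) hφ.contMDiffAt (h1.inv.mul h2)
      refine (contMDiffAt_iff_contDiffAt.1 h3).congr_of_eventuallyEq ?_
      filter_upwards [continuous_snd.continuousAt.preimage_mem_nhds (htopen.mem_nhds htt)] with q hq
      simp only [g]
      exact if_pos hq
    · have htk : t ∉ k := fun ⟨y, hy, hyt⟩ => htt (hyt ▸ c.map_source (hNs hy))
      refine (contDiffAt_const (c := (0 : ℂ))).congr_of_eventuallyEq ?_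
      filter_upwards [prod_mem_nhds (hs.mem_nhds hp) (hk.isClosed.isOpen_compl.mem_nhds htk)]
        with q hq
      exact hgk _ _ hq.1 hq.2
  have hFm : AEStronglyMeasurable F μ :=
    (aestronglyMeasurable_indicator_iff htopen.measurableSet).2
      ((hf.comp_continuousOn hcs).aestronglyMeasurable htopen.measurableSet)
  obtain ⟨C, hC⟩ := isCompact_univ.exists_bound_of_continuousOn hf.continuousOn
  have hFi : Integrable F μ := Integrable.of_bound hFm C (Filter.Eventually.of_forall fun t => by
    simp only [F, Set.indicator]
    split_ifs
    · exact hC _ (Set.mem_univ _)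
    · simpa using (norm_nonneg _).trans (hC 1 (Set.mem_univ _)))
  -- The integral is a convolution depending on the parameter p and evaluated at the fixed point 0,
  -- which accounts for the sign in `g p (-t)`.
  have hconv := contDiffOn_convolution_right_with_param_comp (𝕜 := ℝ) (μ := μ) (n := ⊤)
    (ContinuousLinearMap.mul ℝ ℂ) (v := fun _ : E => (0 : E)) contDiffOn_const (f := F)
    (g := fun p t => g p (-t)) (k := -k) hs hk.neg
    (fun p t hp ht => hgk p (-t) hp (by simpa using ht)) hFi.locallyIntegrable
    (hgs.comp (f := fun q : E × E => (q.1, -q.2)) (by fun_prop) (fun q hq => ⟨hq.1, trivial⟩))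
  have heq : ∀ x ∈ c.source ∩ V, ∫ y, f y * φ (x⁻¹ * y) ∂(haarG G) =
      convolution F (fun t => g (c x) (-t)) (ContinuousLinearMap.mul ℝ ℂ) μ 0 := by
    rintro x ⟨hxs, hxV⟩
    have hxs' : c x ∈ s := ⟨c.map_source hxs, by simpa [c.left_inv hxs] using hxV⟩
    have hgm : Continuous (g (c x)) := by
      have h := hgs.continuousOn.comp (f := fun t : E => (c x, t)) (s := Set.univ)
        (by fun_prop) (fun t _ => ⟨hxs', trivial⟩)
      exact continuousOn_univ.1 h
    simp only [convolution, zero_sub, neg_neg, ContinuousLinearMap.mul_apply']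
    rw [hμ, integral_map (f := fun t => F t * g (c x) t) hcm (hFm.mul hgm.aestronglyMeasurable)]
    rw [← setIntegral_eq_integral_of_forall_compl_eq_zero (s := c.source)]
    · refine setIntegral_congr_fun hopen.measurableSet fun y hy => ?_
      simp only [F, g, Set.indicator, if_pos (c.map_source hy), Function.comp_apply,
        c.left_inv hy, c.left_inv hxs]
    · intro y hy
      by_contra h
      exact hy (hNs (hφV x hxV y (right_ne_zero_of_mul h)))
  have hcx : ContMDiffAt 𝓘(ℝ, E) 𝓘(ℝ, E) ∞ c (1 : G) := contMDiffAt_extChartAt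
  have h1s : c 1 ∈ s := ⟨mem_extChartAt_target (1 : G), by
    simpa [hc, extChartAt_to_inv] using h1V⟩
  have h2 := ContMDiffAt.comp (1 : G)
    (contMDiffAt_iff_contDiffAt.2 (hconv.contDiffAt (hs.mem_nhds h1s))) hcx
  refine h2.congr_of_eventuallyEq ?_
  filter_upwards [hopen.mem_nhds (mem_extChartAt_source (1 : G)), hV.mem_nhds h1V] with x hx hxV
  exact heq x ⟨hx, hxV⟩

variable [FiniteDimensional ℝ E] [T2Space G]

variable {K : Subgroup G} (ξ : TypeOneRep G K)

/-- A continuous representation of a Lie group is smooth. -/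
theorem TypeOneRep.contMDiff_mat_apply (i j : Fin ξ.d) :
    ContMDiff 𝓘(ℝ, E) 𝓘(ℝ, ℂ) ∞ fun x => ξ.mat x i j := by
  set d : ℝ := (ξ.d : ℝ) with hd
  have hd1 : (1 : ℝ) ≤ d := by
    rw [hd]; exact_mod_cast Nat.one_le_of_lt ξ.d_pos
  -- With dε < 1 the matrix B below is strictly diagonally dominant, hence invertible.
  set ε : ℝ := 1 / (2 * d) with hε
  have hεpos : 0 < ε := by positivity
  obtain ⟨N, hN1, hNs, hN⟩ := local_compact_nhds
    (extChartAt_source_mem_nhds (I := 𝓘(ℝ, E)) (1 : G))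
  -- V₀·V₀ ⊆ N keeps y = x(x⁻¹y) inside the compact set N whenever x and x⁻¹y both lie in V.
  obtain ⟨V₀, hV₀, h1V₀, hVN⟩ := exists_open_nhds_one_mul_subset hN1
  obtain ⟨V₁, hV₁s, hV₁, h1V₁⟩ := mem_nhds_iff.1 (ξ.eventually_norm_mat_sub_one_le hεpos)
  set V := V₀ ∩ V₁
  have hV : IsOpen V := hV₀.inter hV₁
  have h1V : (1 : G) ∈ V := ⟨h1V₀, h1V₁⟩
  obtain ⟨φ, hφV⟩ : ∃ φ : SmoothBumpFunction 𝓘(ℝ, E) (1 : G), Function.support φ ⊆ V := by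
    obtain ⟨φ, -, h⟩ := (SmoothBumpFunction.nhds_basis_support (I := 𝓘(ℝ, E))
      (hV.mem_nhds h1V)).mem_iff.1 (hV.mem_nhds h1V)
    exact ⟨φ, h⟩
  have hφc : ContMDiff 𝓘(ℝ, E) 𝓘(ℝ, ℂ) ∞ fun x => (φ x : ℂ) :=
    Complex.ofRealCLM.contDiff.contMDiff.comp φ.contMDiff
  have hφVN : ∀ x ∈ V, ∀ y, (φ (x⁻¹ * y) : ℂ) ≠ 0 → y ∈ N := fun x hx y hy => by
    have h1 : x⁻¹ * y ∈ V := hφV (by simpa using hy)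
    have := hVN (Set.mul_mem_mul hx.1 h1.1)
    simpa using this
  set m : ℝ := ∫ y, φ y ∂(haarG G) with hm
  have hφi : Integrable φ (haarG G) :=
    φ.continuous.integrable_of_hasCompactSupport (HasCompactSupport.of_compactSpace _)
  have hmpos : 0 < m := by
    rw [hm, integral_pos_iff_support_of_nonneg (fun x => φ.nonneg) hφi]
    exact φ.isOpen_support.measure_pos _ ⟨1, φ.c_mem_support⟩
  -- B = ∫ ξφ is close to m·1. Moreover ξ(x)B = ∫ ξ(y) φ(x⁻¹y) dy is smooth in x near 1, the
  -- variable x having moved into φ; multiplying by B⁻¹ gives smoothness of ξ near 1.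
  let B : Matrix (Fin ξ.d) (Fin ξ.d) ℂ := Matrix.of fun a b => ∫ y, ξ.mat y a b * φ y ∂(haarG G)
  have hφint : ∀ a b x, Integrable (fun y => ξ.mat (x * y) a b * (φ y : ℂ)) (haarG G) := fun a b x =>
    integrable_of_continuous (((ξ.continuous_mat_apply a b).comp (continuous_const_mul x)).mul
      hφc.continuous)
  have hB : ∀ a b, ‖B a b - (1 : Matrix (Fin ξ.d) (Fin ξ.d) ℂ) a b * m‖ ≤ ε * m := fun a b => by
    have h1 : B a b - (1 : Matrix (Fin ξ.d) (Fin ξ.d) ℂ) a b * m =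
        ∫ y, (ξ.mat y a b - (1 : Matrix (Fin ξ.d) (Fin ξ.d) ℂ) a b) * φ y ∂(haarG G) := by
      simp_rw [sub_mul]
      rw [integral_sub (f := fun y => ξ.mat y a b * (φ y : ℂ))
        (g := fun y => (1 : Matrix (Fin ξ.d) (Fin ξ.d) ℂ) a b * (φ y : ℂ))
        (by simpa using hφint a b 1)
        (integrable_of_continuous (continuous_const.mul hφc.continuous)), integral_const_mul,
        integral_complex_ofReal]
      rfl
    rw [h1]
    refine (norm_integral_le_of_norm_le (hφi.const_mul ε)
      (Filter.Eventually.of_forall fun y => ?_)).trans_eq (by rw [integral_const_mul])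
    rw [norm_mul, Complex.norm_real, Real.norm_of_nonneg φ.nonneg]
    by_cases hy : φ y = 0
    · simp [hy]
    · exact mul_le_mul_of_nonneg_right (hV₁s (hφV hy).2 a b) φ.nonneg
  have hdet : B.det ≠ 0 := by
    refine det_ne_zero_of_sum_row_lt_diag fun a => ?_
    have h1 : ∑ b ∈ Finset.univ.erase a, ‖B a b‖ ≤ (d - 1) * (ε * m) := by
      refine (Finset.sum_le_sum (g := fun _ => ε * m) fun b hb => ?_).trans_eq ?_
      · have := hB a b
        rwa [Matrix.one_apply_ne (Finset.ne_of_mem_erase hb).symm, zero_mul, sub_zero] at this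
      · rw [Finset.sum_const, Finset.card_erase_of_mem (Finset.mem_univ _), Finset.card_univ,
          Fintype.card_fin, nsmul_eq_mul, Nat.cast_sub ξ.d_pos, hd]
        simp
    have h2 : m - ε * m ≤ ‖B a a‖ := by
      have h := hB a a
      rw [Matrix.one_apply_eq, one_mul] at h
      have h3 := norm_sub_norm_le (m : ℂ) ((m : ℂ) - B a a)
      rw [sub_sub_cancel, Complex.norm_real, Real.norm_of_nonneg hmpos.le, norm_sub_rev] at h3
      linarith
    have h3 : (d - 1) * (ε * m) < m - ε * m := by
      have h4 : d * ε = 1 / 2 := by rw [hε]; field_simp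
      nlinarith
    linarith
  have hconv : ∀ a b x, (ξ.mat x * B) a b = ∫ y, ξ.mat y a b * φ (x⁻¹ * y) ∂(haarG G) := by
    intro a b x
    have h1 : (ξ.mat x * B) a b = ∫ y, ξ.mat (x * y) a b * φ y ∂(haarG G) := by
      simp only [Matrix.mul_apply, B, Matrix.of_apply, ← integral_const_mul]
      rw [← integral_finsetSum _ fun e _ => (by simpa using (hφint e b 1).const_mul (ξ.mat x a e))]
      congr 1 with y
      rw [ξ.mat_mul, Matrix.mul_apply, Finset.sum_mul]
      exact Finset.sum_congr rfl fun e _ => by ring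
    rw [h1, ← integral_mul_left_eq_self (fun y => ξ.mat y a b * (φ (x⁻¹ * y) : ℂ)) x]
    simp_rw [inv_mul_cancel_left]
  have hsm1 : ∀ a b, ContMDiffAt 𝓘(ℝ, E) 𝓘(ℝ, ℂ) ∞ (fun x => (ξ.mat x * B) a b) (1 : G) := by
    intro a b
    simp_rw [hconv]
    exact contMDiffAt_integral_inv_mul hφc hV h1V hN hNs hφVN (ξ.continuous_mat_apply a b)
  have hsm2 : ∀ a b, ContMDiffAt 𝓘(ℝ, E) 𝓘(ℝ, ℂ) ∞ (fun x => ξ.mat x a b) (1 : G) := by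
    intro a b
    have h1 : (fun x => ξ.mat x a b) = fun x => ∑ e, (ξ.mat x * B) a e * B⁻¹ e b := by
      ext x
      rw [← Matrix.mul_apply, Matrix.mul_assoc, Matrix.mul_nonsing_inv _ hdet.isUnit,
        Matrix.mul_one]
    rw [h1]
    refine contMDiffAt_finsetSum fun e _ => ?_
    exact (show ContDiff ℝ ∞ (fun z : ℂ => z * B⁻¹ e b) by fun_prop).contMDiff.contMDiffAt.comp
      (1 : G) (hsm1 a e)
  intro x₀
  have h1 : (fun x => ξ.mat x i j) = fun x => ∑ e, ξ.mat x₀ i e * ξ.mat (x₀⁻¹ * x) e j := by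
    ext x
    rw [← Matrix.mul_apply, ← ξ.mat_mul, mul_inv_cancel_left]
  rw [h1]
  refine contMDiffAt_finsetSum fun e _ => ?_
  have h2 : ContMDiffAt 𝓘(ℝ, E) 𝓘(ℝ, ℂ) ∞ (fun x => ξ.mat (x₀⁻¹ * x) e j) x₀ :=
    ContMDiffAt.comp (I' := 𝓘(ℝ, E)) x₀ (g := fun x => ξ.mat x e j) (f := fun x => x₀⁻¹ * x)
      (by simpa using hsm2 e j) (contMDiff_mul_left (a := x₀⁻¹)).contMDiffAt
  exact (show ContDiff ℝ ∞ (fun z : ℂ => ξ.mat x₀ i e * z) by fun_prop).contMDiff.contMDiffAt.comp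
      x₀ h2

end Convolution

end HomBesov

end

noncomputable section

namespace HomBesov

/-! ### Operator norms of matrices. -/

section MatrixNorms

open scoped Matrix.Norms.L2Operator

theorem norm_apply_le_l2_opNorm {d : ℕ} (A : Matrix (Fin d) (Fin d) ℂ) (i j : Fin d) :
    ‖A i j‖ ≤ ‖A‖ := by
  have h := Matrix.l2_opNorm_mulVec A (EuclideanSpace.single j (1 : ℂ))
  rw [PiLp.norm_single, norm_one, mul_one] at h
  refine le_trans ?_ h
  have h2 := PiLp.norm_apply_le (WithLp.toLp 2 (A *ᵥ (EuclideanSpace.single j (1 : ℂ)).ofLp)) i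
  simpa using h2

theorem l2_opNorm_of_mul_conjTranspose_eq_one {d : ℕ} [Nonempty (Fin d)]
    {U : Matrix (Fin d) (Fin d) ℂ} (hU : Uᴴ * U = 1) : ‖U‖ = 1 := by
  have h := Matrix.l2_opNorm_conjTranspose_mul_self U
  rw [hU, norm_one] at h
  nlinarith [norm_nonneg U]

theorem sum_norm_sq_mulVec {d : ℕ} (A : Matrix (Fin d) (Fin d) ℂ) (v : Fin d → ℂ) :
    ((∑ a, ‖(A *ᵥ v) a‖ ^ 2 : ℝ) : ℂ) = star v ⬝ᵥ ((Aᴴ * A) *ᵥ v) := by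
  rw [← Matrix.mulVec_mulVec, Matrix.dotProduct_mulVec, ← Matrix.star_mulVec]
  push_cast
  exact Finset.sum_congr rfl fun a _ => by
    rw [Pi.star_apply, RCLike.star_def, Complex.conj_mul']

/-- ‖D_i v‖² is one term of ∑_j ‖D_j v‖² = l‖v‖². -/
theorem l2_opNorm_le_sqrt_of_sum_conjTranspose_mul {d : ℕ} {ι : Type*} [Fintype ι]
    (D : ι → Matrix (Fin d) (Fin d) ℂ) {l : ℝ} (h : ∑ i, (D i)ᴴ * D i = (l : ℂ) • 1) (i : ι) :
    ‖D i‖ ≤ Real.sqrt l := by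
  rw [Matrix.l2_opNorm_def]
  refine ContinuousLinearMap.opNorm_le_bound _ (Real.sqrt_nonneg _) fun v => ?_
  have hsum : ∑ j, ∑ a, ‖(D j *ᵥ v.ofLp) a‖ ^ 2 = l * ∑ a, ‖v.ofLp a‖ ^ 2 := by
    have h1 : ((∑ j, ∑ a, ‖(D j *ᵥ v.ofLp) a‖ ^ 2 : ℝ) : ℂ) =
        ((l * ∑ a, ‖v.ofLp a‖ ^ 2 : ℝ) : ℂ) := by
      rw [Complex.ofReal_sum, Complex.ofReal_mul]
      simp_rw [sum_norm_sq_mulVec]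
      rw [← dotProduct_sum, ← Matrix.sum_mulVec, h, Matrix.smul_mulVec, Matrix.one_mulVec,
        dotProduct_smul, smul_eq_mul]
      congr 1
      have := sum_norm_sq_mulVec (1 : Matrix (Fin d) (Fin d) ℂ) v.ofLp
      simpa using this.symm
    exact_mod_cast h1
  have hle : ∑ a, ‖(D i *ᵥ v.ofLp) a‖ ^ 2 ≤ l * ∑ a, ‖v.ofLp a‖ ^ 2 := by
    rw [← hsum]
    exact Finset.single_le_sum (f := fun j => ∑ a, ‖(D j *ᵥ v.ofLp) a‖ ^ 2)
      (fun j _ => Finset.sum_nonneg fun _ _ => by positivity) (Finset.mem_univ i)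
  have hv := EuclideanSpace.norm_sq_eq v
  have hD := EuclideanSpace.norm_sq_eq (WithLp.toLp 2 (D i *ᵥ v.ofLp))
  rw [← hv] at hle
  have hle' : ‖WithLp.toLp 2 (D i *ᵥ v.ofLp)‖ ^ 2 ≤ l * ‖v‖ ^ 2 := by rw [hD]; exact hle
  have h3 : ‖WithLp.toLp 2 (D i *ᵥ v.ofLp)‖ ≤ Real.sqrt (l * ‖v‖ ^ 2) := Real.le_sqrt_of_sq_le hle'
  rw [Real.sqrt_mul' _ (by positivity), Real.sqrt_sq (norm_nonneg v)] at h3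
  exact h3

theorem TypeOneRep.l2_opNorm_mat {G : Type*} [Group G] [TopologicalSpace G] {K : Subgroup G}
    (ξ : TypeOneRep G K) (x : G) : ‖ξ.mat x‖ = 1 :=
  l2_opNorm_of_mul_conjTranspose_eq_one (ξ.conjTranspose_mul_mat x)

theorem TypeOneRep.norm_mat_mul_apply_le {G : Type*} [Group G] [TopologicalSpace G] {K : Subgroup G}
    (ξ : TypeOneRep G K) {A : Matrix (Fin ξ.d) (Fin ξ.d) ℂ} (hA : ‖A‖ ≤ 1) (i j : Fin ξ.d) (x : G) :
    ‖(ξ.mat x * A) i j‖ ≤ 1 := by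
  refine (norm_apply_le_l2_opNorm _ i j).trans ((norm_mul_le _ _).trans ?_)
  rwa [ξ.l2_opNorm_mat, one_mul]

theorem TypeOneRep.l2_opNorm_proj_le {G : Type*} [Group G] [TopologicalSpace G] {K : Subgroup G}
    (ξ : TypeOneRep G K) : ‖ξ.proj‖ ≤ 1 := by
  rw [proj, Matrix.l2_opNorm_diagonal]
  refine (pi_norm_le_iff_of_nonneg zero_le_one).2 fun i => ?_
  split_ifs <;> simp

end MatrixNorms

/-! ### The differential of a representation and its Casimir eigenvalue. -/

section LieDerivativeRules

variable {E : Type*} [NormedAddCommGroup E] [NormedSpace ℝ E]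
  {G : Type*} [Group G] [TopologicalSpace G] [ChartedSpace E G] [LieGroup 𝓘(ℝ, E) ∞ G]

theorem lieDeriv_translate {f : G → ℂ} (hf : ContMDiff 𝓘(ℝ, E) 𝓘(ℝ, ℂ) ∞ f)
    (X : GroupLieAlgebra 𝓘(ℝ, E) G) (g : G) :
    lieDeriv X f g = lieDeriv X (fun x => f (g * x)) 1 := by
  have hfg : ContMDiff 𝓘(ℝ, E) 𝓘(ℝ, ℂ) ∞ fun x => f (g * x) :=
    hf.comp (contMDiff_mul_left (a := g))
  rw [lieDeriv_eq_fderiv hf, lieDeriv_eq_fderiv hfg]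
  congr 2
  ext e
  simp [localForm]

theorem lieDeriv_sum_smul {ι : Type*} (s : Finset ι) (a : ι → ℝ)
    (X : ι → GroupLieAlgebra 𝓘(ℝ, E) G) {f : G → ℂ} (hf : ContMDiff 𝓘(ℝ, E) 𝓘(ℝ, ℂ) ∞ f) (g : G) :
    lieDeriv (∑ i ∈ s, a i • X i) f g = ∑ i ∈ s, (a i : ℂ) * lieDeriv (X i) f g := by
  simp_rw [lieDeriv_eq_fderiv hf]
  rw [map_sum, map_sum]
  simp [map_smul]

theorem lieDeriv_Ad {f : G → ℂ} (hf : ContMDiff 𝓘(ℝ, E) 𝓘(ℝ, ℂ) ∞ f)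
    (X : GroupLieAlgebra 𝓘(ℝ, E) G) (g : G) :
    lieDeriv (Ad g X) f 1 = lieDeriv X (fun x => f (g * x * g⁻¹)) 1 := by
  have hc : ContMDiff 𝓘(ℝ, E) 𝓘(ℝ, E) ∞ fun x : G => g * x * g⁻¹ :=
    (contMDiff_mul_right (a := g⁻¹)).comp (contMDiff_mul_left (a := g))
  have hfc : ContMDiff 𝓘(ℝ, E) 𝓘(ℝ, ℂ) ∞ fun x => f (g * x * g⁻¹) := hf.comp hc
  have h1 : ∀ {u : G → ℂ} (Z : GroupLieAlgebra 𝓘(ℝ, E) G), ContMDiff 𝓘(ℝ, E) 𝓘(ℝ, ℂ) ∞ u →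
      lieDeriv Z u 1 = mfderiv 𝓘(ℝ, E) 𝓘(ℝ, ℂ) u 1 Z := fun {u} Z hu => by
    rw [lieDeriv_eq_fderiv hu, mfderiv_one_eq_fderiv hu]
    congr 2
    ext e
    simp [localForm]
  rw [h1 _ hf, h1 _ hfc]
  have h := mfderiv_comp_apply (I := 𝓘(ℝ, E)) (I' := 𝓘(ℝ, E)) (I'' := 𝓘(ℝ, ℂ)) (1 : G)
    (g := f) (f := fun x => g * x * g⁻¹) (hf.mdifferentiableAt (by simp))
    (hc.mdifferentiableAt (by simp)) X
  rw [Function.comp_def] at h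
  have h2 : ∀ (a b : G) (_ : a = b) (v : E),
      (mfderiv 𝓘(ℝ, E) 𝓘(ℝ, ℂ) f a : E →L[ℝ] ℂ) v = (mfderiv 𝓘(ℝ, E) 𝓘(ℝ, ℂ) f b : E →L[ℝ] ℂ) v := by
    rintro a _ rfl v; rfl
  rw [h]
  exact h2 1 (g * 1 * g⁻¹) (by simp) _

theorem iterLieDeriv_star {n : ℕ} (Y : Module.Basis (Fin n) ℝ (GroupLieAlgebra 𝓘(ℝ, E) G))
    (w : List (Fin n)) {f : G → ℂ} (hf : ContMDiff 𝓘(ℝ, E) 𝓘(ℝ, ℂ) ∞ f) :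
    iterLieDeriv Y w (fun x => star (f x)) = fun x => star (iterLieDeriv Y w f x) := by
  induction w with
  | nil => rfl
  | cons a w ih =>
    change lieDeriv (Y a) (iterLieDeriv Y w _) = _
    rw [ih]
    ext x
    rw [lieDeriv_star (contMDiff_iterLieDeriv Y hf w)]
    rfl

end LieDerivativeRules

section Differential

variable {E : Type*} [NormedAddCommGroup E] [NormedSpace ℝ E] [FiniteDimensional ℝ E]
  {G : Type*} [Group G] [TopologicalSpace G] [IsTopologicalGroup G] [CompactSpace G] [T2Space G]
  [ChartedSpace E G] [LieGroup 𝓘(ℝ, E) ∞ G] [MeasurableSpace G] [BorelSpace G]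

variable {K : Subgroup G} (ξ : TypeOneRep G K)

namespace TypeOneRep

/-- The differential of a representation. -/
def diff (X : GroupLieAlgebra 𝓘(ℝ, E) G) : Matrix (Fin ξ.d) (Fin ξ.d) ℂ :=
  Matrix.of fun i j => lieDeriv X (fun x => ξ.mat x i j) 1

theorem contMDiff_mat_mul_apply (A : Matrix (Fin ξ.d) (Fin ξ.d) ℂ) (i j : Fin ξ.d) :
    ContMDiff 𝓘(ℝ, E) 𝓘(ℝ, ℂ) ∞ fun x => (ξ.mat x * A) i j := by
  simp_rw [Matrix.mul_apply, mul_comm _ (A _ _)]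
  exact contMDiff_sum_const_mul _ _ fun a => ξ.contMDiff_mat_apply i a

theorem contMDiff_mul_mat_apply (A : Matrix (Fin ξ.d) (Fin ξ.d) ℂ) (i j : Fin ξ.d) :
    ContMDiff 𝓘(ℝ, E) 𝓘(ℝ, ℂ) ∞ fun x => (A * ξ.mat x) i j := by
  simp_rw [Matrix.mul_apply]
  exact contMDiff_sum_const_mul _ _ fun a => ξ.contMDiff_mat_apply a j

theorem lieDeriv_mul_mat_apply (A : Matrix (Fin ξ.d) (Fin ξ.d) ℂ)
    (X : GroupLieAlgebra 𝓘(ℝ, E) G) (i j : Fin ξ.d) :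
    lieDeriv X (fun x => (A * ξ.mat x) i j) 1 = (A * ξ.diff X) i j := by
  simp_rw [Matrix.mul_apply]
  rw [lieDeriv_sum_const_mul _ _ fun a => ξ.contMDiff_mat_apply a j]
  rfl

theorem lieDeriv_mat_apply (X : GroupLieAlgebra 𝓘(ℝ, E) G) (g : G) (i j : Fin ξ.d) :
    lieDeriv X (fun x => ξ.mat x i j) g = (ξ.mat g * ξ.diff X) i j := by
  rw [lieDeriv_translate (ξ.contMDiff_mat_apply i j), ← lieDeriv_mul_mat_apply]
  simp_rw [mat_mul]

theorem lieDeriv_mat_mul_apply (A : Matrix (Fin ξ.d) (Fin ξ.d) ℂ)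
    (X : GroupLieAlgebra 𝓘(ℝ, E) G) (g : G) (i j : Fin ξ.d) :
    lieDeriv X (fun x => (ξ.mat x * A) i j) g = (ξ.mat g * (ξ.diff X * A)) i j := by
  rw [← Matrix.mul_assoc, Matrix.mul_apply]
  simp_rw [Matrix.mul_apply (M := ξ.mat _) (N := A), mul_comm _ (A _ _)]
  rw [lieDeriv_sum_const_mul _ _ fun a => ξ.contMDiff_mat_apply i a]
  simp_rw [lieDeriv_mat_apply]

theorem iterLieDeriv_mat_mul_apply {n : ℕ}
    (Y : Module.Basis (Fin n) ℝ (GroupLieAlgebra 𝓘(ℝ, E) G)) (w : List (Fin n))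
    (A : Matrix (Fin ξ.d) (Fin ξ.d) ℂ) (i j : Fin ξ.d) :
    iterLieDeriv Y w (fun x => (ξ.mat x * A) i j) =
      fun x => (ξ.mat x * ((w.map fun a => ξ.diff (Y a)).prod * A)) i j := by
  induction w with
  | nil => simp [iterLieDeriv]
  | cons a w ih =>
    change lieDeriv (Y a) (iterLieDeriv Y w _) = _
    rw [ih]
    ext x
    rw [lieDeriv_mat_mul_apply, List.map_cons, List.prod_cons, Matrix.mul_assoc (ξ.diff (Y a))]

/-- Differentiate ξ(x)ξ(x)ᴴ = 1 at the identity. -/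
theorem conjTranspose_diff (X : GroupLieAlgebra 𝓘(ℝ, E) G) : (ξ.diff X)ᴴ = -ξ.diff X := by
  rw [eq_neg_iff_add_eq_zero]
  ext i j
  have hs : ∀ a, ContMDiff 𝓘(ℝ, E) 𝓘(ℝ, ℂ) ∞ fun x => ξ.mat x i a * star (ξ.mat x j a) := fun a =>
    contMDiff_mul_complex (ξ.contMDiff_mat_apply i a)
      (contMDiff_star_complex (ξ.contMDiff_mat_apply j a))
  have h1 := lieDeriv_sum_const_mul Finset.univ (fun _ => (1 : ℂ)) hs X 1
  have h2 : (fun x => ∑ a, (1 : ℂ) * (ξ.mat x i a * star (ξ.mat x j a))) =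
      fun _ : G => (1 : Matrix (Fin ξ.d) (Fin ξ.d) ℂ) i j := by
    ext x
    rw [← ξ.mat_mul_conjTranspose x, Matrix.mul_apply]
    simp
  have h3 : lieDeriv X (fun _ : G => (1 : Matrix (Fin ξ.d) (Fin ξ.d) ℂ) i j) 1 = 0 := by
    rw [lieDeriv_eq_fderiv contMDiff_const]
    have : localForm (E := E) (fun _ : G => (1 : Matrix (Fin ξ.d) (Fin ξ.d) ℂ) i j) 1 =
        fun _ => (1 : Matrix (Fin ξ.d) (Fin ξ.d) ℂ) i j := rfl
    rw [this]
    simp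
  rw [h2, h3] at h1
  simp_rw [lieDeriv_mul (ξ.contMDiff_mat_apply i _)
    (contMDiff_star_complex (ξ.contMDiff_mat_apply j _)),
    lieDeriv_star (ξ.contMDiff_mat_apply j _), mat_one, Matrix.one_apply] at h1
  simpa [Finset.sum_add_distrib, diff, eq_comm] using h1.symm

theorem diff_sum_smul {ι : Type*} (s : Finset ι) (a : ι → ℝ)
    (X : ι → GroupLieAlgebra 𝓘(ℝ, E) G) :
    ξ.diff (∑ i ∈ s, a i • X i) = ∑ i ∈ s, (a i : ℂ) • ξ.diff (X i) := by
  ext i j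
  rw [Matrix.sum_apply]
  exact lieDeriv_sum_smul s a X (ξ.contMDiff_mat_apply i j) 1

theorem diff_Ad (g : G) (X : GroupLieAlgebra 𝓘(ℝ, E) G) :
    ξ.diff (Ad g X) = ξ.mat g * ξ.diff X * (ξ.mat g)ᴴ := by
  ext i j
  have h1 : (fun x => ξ.mat (g * x * g⁻¹) i j) =
      fun x => ∑ b, star (ξ.mat g j b) * (ξ.mat g * ξ.mat x) i b := by
    ext x
    rw [mat_mul, mat_mul, mat_inv, Matrix.mul_apply]
    exact Finset.sum_congr rfl fun b _ => by rw [Matrix.conjTranspose_apply, mul_comm]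
  rw [diff, Matrix.of_apply, lieDeriv_Ad (ξ.contMDiff_mat_apply i j), h1,
    lieDeriv_sum_const_mul _ _ fun b => ξ.contMDiff_mul_mat_apply _ i b, Matrix.mul_apply]
  exact Finset.sum_congr rfl fun b _ => by
    rw [Matrix.conjTranspose_apply, mul_comm, lieDeriv_mul_mat_apply]

end TypeOneRep

variable {n : ℕ} (Y : Module.Basis (Fin n) ℝ (GroupLieAlgebra 𝓘(ℝ, E) G))

namespace TypeOneRep

theorem laplacian_mat_apply (i j : Fin ξ.d) (x : G) :
    laplacian Y (fun y => ξ.mat y i j) x =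
      (ξ.mat x * ∑ a, ξ.diff (Y a) * ξ.diff (Y a)) i j := by
  rw [laplacian, Matrix.mul_sum, Matrix.sum_apply]
  refine Finset.sum_congr rfl fun a _ => ?_
  have h : lieDeriv (Y a) (fun y => ξ.mat y i j) = fun y => (ξ.mat y * ξ.diff (Y a)) i j := by
    ext y; rw [lieDeriv_mat_apply]
  rw [h, lieDeriv_mat_mul_apply]

variable {B : LinearMap.BilinForm ℝ (GroupLieAlgebra 𝓘(ℝ, E) G)}

/-- The Casimir element commutes with the representation. -/
theorem casimir_commute
    (hB : ∀ (g : G) (X Z : GroupLieAlgebra 𝓘(ℝ, E) G), B (Ad g X) (Ad g Z) = B X Z)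
    (hY : ∀ i j, B (Y i) (Y j) = if i = j then 1 else 0)
    (g : G) :
    (∑ a, ξ.diff (Y a) * ξ.diff (Y a)) * ξ.mat g =
      ξ.mat g * ∑ a, ξ.diff (Y a) * ξ.diff (Y a) := by
  -- M holds the coordinates of Ad(g)Y_i in the basis Y; invariance of B makes it orthogonal. Only
  -- the values of Ad(g) on the basis enter, so its linearity plays no role.
  let M : Matrix (Fin n) (Fin n) ℝ := Matrix.of fun j i => Y.repr (Ad g (Y i)) j
  have hAd : ∀ i, Ad g (Y i) = ∑ j, M j i • Y j := fun i => (Y.sum_repr _).symm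
  have hM : Mᵀ * M = 1 := by
    ext i k
    have h := hB g (Y i) (Y k)
    rw [hY, hAd i, hAd k] at h
    simp only [map_sum, LinearMap.sum_apply, map_smul, LinearMap.smul_apply, hY] at h
    rw [Matrix.one_apply, ← h, Matrix.mul_apply]
    simp [mul_comm]
  -- Invariance gives MᵀM = 1, while the summation over a produces MMᵀ.
  have hM' : M * Mᵀ = 1 := mul_eq_one_comm.1 hM
  have h1 : ∑ a, ξ.diff (Ad g (Y a)) * ξ.diff (Ad g (Y a)) = ∑ a, ξ.diff (Y a) * ξ.diff (Y a) := by
    calc ∑ a, ξ.diff (Ad g (Y a)) * ξ.diff (Ad g (Y a))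
        = ∑ a, ∑ j, ∑ k, ((M j a * M k a : ℝ) : ℂ) • (ξ.diff (Y j) * ξ.diff (Y k)) := by
          refine Finset.sum_congr rfl fun a _ => ?_
          rw [hAd, diff_sum_smul, Finset.sum_mul_sum]
          refine Finset.sum_congr rfl fun j _ => Finset.sum_congr rfl fun k _ => ?_
          rw [Matrix.smul_mul, Matrix.mul_smul, smul_smul, Complex.ofReal_mul]
      _ = ∑ j, ∑ k, (((M * Mᵀ) j k : ℝ) : ℂ) • (ξ.diff (Y j) * ξ.diff (Y k)) := by
          rw [Finset.sum_comm]
          refine Finset.sum_congr rfl fun j _ => ?_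
          rw [Finset.sum_comm]
          refine Finset.sum_congr rfl fun k _ => ?_
          rw [← Finset.sum_smul, Matrix.mul_apply, Complex.ofReal_sum]
          rfl
      _ = _ := by
          rw [hM']
          refine Finset.sum_congr rfl fun j _ => ?_
          rw [Finset.sum_eq_single j (fun k _ hk => by simp [Matrix.one_apply_ne hk.symm])
            (by simp)]
          simp
  have h2 : ∀ a, ξ.diff (Ad g (Y a)) * ξ.diff (Ad g (Y a)) =
      ξ.mat g * (ξ.diff (Y a) * ξ.diff (Y a)) * (ξ.mat g)ᴴ := fun a => by
    rw [diff_Ad]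
    calc ξ.mat g * ξ.diff (Y a) * (ξ.mat g)ᴴ * (ξ.mat g * ξ.diff (Y a) * (ξ.mat g)ᴴ)
        = ξ.mat g * ξ.diff (Y a) * ((ξ.mat g)ᴴ * ξ.mat g) * ξ.diff (Y a) * (ξ.mat g)ᴴ := by
          simp only [Matrix.mul_assoc]
      _ = _ := by rw [conjTranspose_mul_mat]; simp only [Matrix.mul_assoc, Matrix.one_mul]
  simp_rw [h2] at h1
  rw [← Matrix.sum_mul, ← Matrix.mul_sum] at h1
  calc (∑ a, ξ.diff (Y a) * ξ.diff (Y a)) * ξ.mat g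
      = ξ.mat g * (∑ a, ξ.diff (Y a) * ξ.diff (Y a)) * ((ξ.mat g)ᴴ * ξ.mat g) := by
        rw [← Matrix.mul_assoc, h1]
    _ = _ := by rw [conjTranspose_mul_mat, Matrix.mul_one]

/-- By Schur's lemma the Casimir matrix is a scalar. Its trace is minus the sum of the squared
Hilbert–Schmidt norms of the skew-Hermitian matrices ξ.diff(Y_a), so the scalar is real and
non-positive. -/
theorem exists_casimir_eq
    (hB : ∀ (g : G) (X Z : GroupLieAlgebra 𝓘(ℝ, E) G), B (Ad g X) (Ad g Z) = B X Z)
    (hY : ∀ i j, B (Y i) (Y j) = if i = j then 1 else 0) : ∃ l : ℝ, 0 ≤ l ∧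
    ∑ a, ξ.diff (Y a) * ξ.diff (Y a) = -((l : ℂ) • (1 : Matrix (Fin ξ.d) (Fin ξ.d) ℂ)) := by
  obtain ⟨c, hc⟩ := ξ.eq_smul_one_of_commute (ξ.casimir_commute Y hB hY)
  have hd : (0 : ℝ) < ξ.d := by exact_mod_cast ξ.d_pos
  set t : ℝ := ∑ a, ∑ j, ∑ i, ‖ξ.diff (Y a) i j‖ ^ 2 with ht
  have ht0 : 0 ≤ t := Finset.sum_nonneg fun _ _ => Finset.sum_nonneg fun _ _ =>
    Finset.sum_nonneg fun _ _ => by positivity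
  have htr : c * ξ.d = -(t : ℂ) := by
    have h := congrArg Matrix.trace hc
    rw [Matrix.trace_smul, Matrix.trace_one, Fintype.card_fin, smul_eq_mul] at h
    rw [← h, Matrix.trace_sum, ht, Complex.ofReal_sum, ← Finset.sum_neg_distrib]
    refine Finset.sum_congr rfl fun a _ => ?_
    have h1 : ξ.diff (Y a) * ξ.diff (Y a) = -((ξ.diff (Y a))ᴴ * ξ.diff (Y a)) := by
      rw [conjTranspose_diff]; simp
    rw [h1, Matrix.trace_neg, Matrix.trace, Complex.ofReal_sum]
    congr 1
    refine Finset.sum_congr rfl fun j _ => ?_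
    rw [Matrix.diag_apply, Matrix.mul_apply, Complex.ofReal_sum]
    refine Finset.sum_congr rfl fun i _ => ?_
    rw [Matrix.conjTranspose_apply, RCLike.star_def, Complex.conj_mul', Complex.ofReal_pow]
  refine ⟨t / ξ.d, by positivity, ?_⟩
  rw [hc, ← neg_smul]
  congr 1
  have hd' : (ξ.d : ℂ) ≠ 0 := by exact_mod_cast hd.ne'
  push_cast
  field_simp
  exact htr

/-- The `epsilon` in the definition of `eigenvalue` picks the true value: a suitable number exists,
and a diagonal entry at x = 1, where ξ is the identity matrix, determines it uniquely. -/
theorem eigenvalue_spec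
    (hB : ∀ (g : G) (X Z : GroupLieAlgebra 𝓘(ℝ, E) G), B (Ad g X) (Ad g Z) = B X Z)
    (hY : ∀ i j, B (Y i) (Y j) = if i = j then 1 else 0) : 0 ≤ eigenvalue Y ξ ∧
    (∑ a, ξ.diff (Y a) * ξ.diff (Y a) =
      -((eigenvalue Y ξ : ℂ) • (1 : Matrix (Fin ξ.d) (Fin ξ.d) ℂ))) := by
  obtain ⟨l, hl, hC⟩ := ξ.exists_casimir_eq Y hB hY
  have hlap : ∀ (i j : Fin ξ.d) (x : G),
      -laplacian Y (fun y => ξ.mat y i j) x = (l : ℂ) * ξ.mat x i j := fun i j x => by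
    rw [laplacian_mat_apply, hC]
    simp
  have hspec : ∀ (i j : Fin ξ.d) (x : G),
      -laplacian Y (fun y => ξ.mat y i j) x = (eigenvalue Y ξ : ℂ) * ξ.mat x i j :=
    Classical.epsilon_spec (p := fun l : ℝ => ∀ (i j : Fin ξ.d) (x : G),
      -laplacian Y (fun y => ξ.mat y i j) x = (l : ℂ) * ξ.mat x i j) ⟨l, hlap⟩
  obtain ⟨i⟩ : Nonempty (Fin ξ.d) := inferInstance
  have heq : eigenvalue Y ξ = l := by
    have h := (hspec i i 1).symm.trans (hlap i i 1)
    rw [mat_one, Matrix.one_apply_eq, mul_one, mul_one] at h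
    exact_mod_cast h
  exact ⟨heq ▸ hl, heq ▸ hC⟩

open scoped Matrix.Norms.L2Operator

/-- By skew-Hermitian symmetry the Casimir identity reads ∑ DᴴD = λ·1, which bounds each D by √λ.
Thus a derivative of ξ costs at most one factor ⟨ξ⟩. -/
theorem l2_opNorm_diff_le
    (hB : ∀ (g : G) (X Z : GroupLieAlgebra 𝓘(ℝ, E) G), B (Ad g X) (Ad g Z) = B X Z)
    (hY : ∀ i j, B (Y i) (Y j) = if i = j then 1 else 0)
    (a : Fin n) : ‖ξ.diff (Y a)‖ ≤ Real.sqrt (eigenvalue Y ξ) := by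
  refine l2_opNorm_le_sqrt_of_sum_conjTranspose_mul (fun a => ξ.diff (Y a)) ?_ a
  have h := (ξ.eigenvalue_spec Y hB hY).2
  simp_rw [conjTranspose_diff, Matrix.neg_mul, Finset.sum_neg_distrib, h, neg_neg]

/-- Iterated derivatives of the matrix coefficients. -/
theorem norm_iterLieDeriv_mat_mul_apply_le
    (hB : ∀ (g : G) (X Z : GroupLieAlgebra 𝓘(ℝ, E) G), B (Ad g X) (Ad g Z) = B X Z)
    (hY : ∀ i j, B (Y i) (Y j) = if i = j then 1 else 0)
    (w : List (Fin n)) {A : Matrix (Fin ξ.d) (Fin ξ.d) ℂ}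
    (hA : ‖A‖ ≤ 1) (i j : Fin ξ.d) (x : G) :
    ‖iterLieDeriv Y w (fun x => (ξ.mat x * A) i j) x‖ ≤
      Real.sqrt (1 + eigenvalue Y ξ) ^ w.length := by
  rw [iterLieDeriv_mat_mul_apply]
  refine (norm_apply_le_l2_opNorm _ i j).trans ((norm_mul_le _ _).trans ?_)
  rw [l2_opNorm_mat, one_mul]
  refine (norm_mul_le _ _).trans ((mul_le_of_le_one_right (norm_nonneg _) hA).trans ?_)
  induction w with
  | nil => simp
  | cons a w ih =>
    rw [List.map_cons, List.prod_cons, List.length_cons, pow_succ']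
    refine (norm_mul_le _ _).trans (mul_le_mul ?_ ih (norm_nonneg _) (Real.sqrt_nonneg _))
    exact (ξ.l2_opNorm_diff_le Y hB hY a).trans (Real.sqrt_le_sqrt (by linarith))

theorem laplacian_mat_mul_apply
    (hB : ∀ (g : G) (X Z : GroupLieAlgebra 𝓘(ℝ, E) G), B (Ad g X) (Ad g Z) = B X Z)
    (hY : ∀ i j, B (Y i) (Y j) = if i = j then 1 else 0)
    (A : Matrix (Fin ξ.d) (Fin ξ.d) ℂ) (i j : Fin ξ.d) (x : G) :
    -laplacian Y (fun y => (ξ.mat y * A) i j) x = (eigenvalue Y ξ : ℂ) * (ξ.mat x * A) i j := by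
  have h : ∀ a, lieDeriv (Y a) (lieDeriv (Y a) fun y => (ξ.mat y * A) i j) x =
      (ξ.mat x * (ξ.diff (Y a) * ξ.diff (Y a) * A)) i j := fun a => by
    have h1 : lieDeriv (Y a) (fun y => (ξ.mat y * A) i j) =
        fun y => (ξ.mat y * (ξ.diff (Y a) * A)) i j := by
      ext y; rw [lieDeriv_mat_mul_apply]
    rw [h1, lieDeriv_mat_mul_apply, Matrix.mul_assoc (ξ.diff (Y a))]
  simp_rw [laplacian, h]
  rw [← Matrix.sum_apply, ← Matrix.mul_sum, ← Matrix.sum_mul, (ξ.eigenvalue_spec Y hB hY).2]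
  simp

end TypeOneRep

end Differential

end HomBesov

end

noncomputable section

namespace HomBesov

/-! ### Matrix coefficients of small eigenvalue vary slowly near the identity. -/

section Chart

variable {E : Type*} [NormedAddCommGroup E] [NormedSpace ℝ E]
  {G : Type*} [Group G] [TopologicalSpace G] [ChartedSpace E G] [LieGroup 𝓘(ℝ, E) ∞ G]

variable (E G) in
/-- Near the identity, `x⁻¹ y` depends in a Lipschitz way on `x` and `y`. -/
theorem exists_norm_chart_inv_mul_le : ∃ (C ρ : ℝ), 0 < C ∧ 0 < ρ ∧
    Metric.ball (extChartAt 𝓘(ℝ, E) (1 : G) 1) ρ ⊆ (extChartAt 𝓘(ℝ, E) (1 : G)).target ∧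
    ∀ e ∈ Metric.ball (extChartAt 𝓘(ℝ, E) (1 : G) 1) ρ,
    ∀ e' ∈ Metric.ball (extChartAt 𝓘(ℝ, E) (1 : G) 1) ρ,
      ((extChartAt 𝓘(ℝ, E) (1 : G)).symm e)⁻¹ * (extChartAt 𝓘(ℝ, E) (1 : G)).symm e' ∈
        (extChartAt 𝓘(ℝ, E) (1 : G)).source ∧
      ‖extChartAt 𝓘(ℝ, E) (1 : G)
        (((extChartAt 𝓘(ℝ, E) (1 : G)).symm e)⁻¹ * (extChartAt 𝓘(ℝ, E) (1 : G)).symm e') -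
        extChartAt 𝓘(ℝ, E) (1 : G) 1‖ ≤ C * ‖e' - e‖ := by
  set c := extChartAt 𝓘(ℝ, E) (1 : G) with hc
  have hsm : ContMDiffAt 𝓘(ℝ, E) 𝓘(ℝ, E) ∞ c.symm (c 1) :=
    (contMDiffOn_extChartAt_symm (I := 𝓘(ℝ, E)) (n := ∞) (1 : G)).contMDiffAt
      ((isOpen_extChartAt_target (1 : G)).mem_nhds (mem_extChartAt_target (1 : G)))
  have hc1 : c.symm (c 1) = 1 := extChartAt_to_inv (1 : G)
  have h1 : ContMDiffAt 𝓘(ℝ, E × E) 𝓘(ℝ, E) ∞ (fun q : E × E => c.symm q.1) (c 1, c 1) :=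
    ContMDiffAt.comp (I' := 𝓘(ℝ, E)) (c 1, c 1) (f := fun q : E × E => q.1)
      hsm contDiff_fst.contMDiff.contMDiffAt
  have h2 : ContMDiffAt 𝓘(ℝ, E × E) 𝓘(ℝ, E) ∞ (fun q : E × E => c.symm q.2) (c 1, c 1) :=
    ContMDiffAt.comp (I' := 𝓘(ℝ, E)) (c 1, c 1) (f := fun q : E × E => q.2)
      hsm contDiff_snd.contMDiff.contMDiffAt
  have h3 : ContMDiffAt 𝓘(ℝ, E × E) 𝓘(ℝ, E) ∞
      (fun q : E × E => (c.symm q.1)⁻¹ * c.symm q.2) (c 1, c 1) := h1.inv.mul h2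
  have h31 : (c.symm (c 1))⁻¹ * c.symm (c 1) = 1 := by simp
  have h4 : ContMDiffAt 𝓘(ℝ, E × E) 𝓘(ℝ, E) ∞
      (fun q : E × E => c ((c.symm q.1)⁻¹ * c.symm q.2)) (c 1, c 1) := by
    refine ContMDiffAt.comp (I' := 𝓘(ℝ, E)) (c 1, c 1) (g := c) ?_ h3
    simp only [h31]
    exact contMDiffAt_extChartAt
  obtain ⟨C, t, ht, hC⟩ :=
    ((contMDiffAt_iff_contDiffAt.1 h4).of_le (m := 1) (by simp)).exists_lipschitzOnWith
  have hs : ∀ᶠ q in nhds (c 1, c 1), (c.symm q.1)⁻¹ * c.symm q.2 ∈ c.source := by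
    refine h3.continuousAt.preimage_mem_nhds ?_
    simp only [h31]
    exact extChartAt_source_mem_nhds (1 : G)
  obtain ⟨ρ₁, hρ₁, hb₁⟩ := Metric.mem_nhds_iff.1 (Filter.inter_mem ht hs)
  obtain ⟨ρ₂, hρ₂, hb₂⟩ := Metric.mem_nhds_iff.1
    ((isOpen_extChartAt_target (I := 𝓘(ℝ, E)) (1 : G)).mem_nhds (mem_extChartAt_target (1 : G)))
  refine ⟨C + 1, min ρ₁ ρ₂, by positivity, lt_min hρ₁ hρ₂,
    (Metric.ball_subset_ball (min_le_right _ _)).trans hb₂, fun e he e' he' => ?_⟩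
  have hmem : ∀ {a b}, a ∈ Metric.ball (c 1) (min ρ₁ ρ₂) → b ∈ Metric.ball (c 1) (min ρ₁ ρ₂) →
      (a, b) ∈ Metric.ball (c 1, c 1) ρ₁ := fun {a b} ha hb => by
    rw [← ball_prod_same]
    exact ⟨Metric.ball_subset_ball (min_le_left _ _) ha,
      Metric.ball_subset_ball (min_le_left _ _) hb⟩
  refine ⟨(hb₁ (hmem he he')).2, ?_⟩
  -- The comparison point is (e, e), where the map takes the value c(1).
  have h5 := hC.dist_le_mul _ (hb₁ (hmem he he')).1 _ (hb₁ (hmem he he)).1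
  simp only [inv_mul_cancel, dist_eq_norm] at h5
  have h6 : ‖((e, e') : E × E) - (e, e)‖ = ‖e' - e‖ := by
    simp [Prod.norm_def]
  rw [h6] at h5
  refine h5.trans ?_
  gcongr
  simp

end Chart

section Counting

variable {E : Type*} [NormedAddCommGroup E] [NormedSpace ℝ E] [FiniteDimensional ℝ E]
  {G : Type*} [Group G] [TopologicalSpace G] [IsTopologicalGroup G] [CompactSpace G] [T2Space G]
  [ChartedSpace E G] [LieGroup 𝓘(ℝ, E) ∞ G] [MeasurableSpace G] [BorelSpace G]
  {n : ℕ} (Y : Module.Basis (Fin n) ℝ (GroupLieAlgebra 𝓘(ℝ, E) G))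
  {B : LinearMap.BilinForm ℝ (GroupLieAlgebra 𝓘(ℝ, E) G)}

/-- The coordinates of a vector of the model space with respect to a basis of the Lie algebra. -/
def coordEquiv : E ≃L[ℝ] (Fin n → ℝ) :=
  ((toModel (E := E) (G := G)).symm.trans Y.equivFun).toContinuousLinearEquiv

open scoped Matrix.Norms.L2Operator

theorem TypeOneRep.l2_opNorm_diff_le_norm
    (hB : ∀ (g : G) (X Z : GroupLieAlgebra 𝓘(ℝ, E) G), B (Ad g X) (Ad g Z) = B X Z)
    (hY : ∀ i j, B (Y i) (Y j) = if i = j then 1 else 0)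
    {K : Subgroup G} (ξ : TypeOneRep G K)
    (X : GroupLieAlgebra 𝓘(ℝ, E) G) :
    ‖ξ.diff X‖ ≤ n * ‖(coordEquiv Y : E →L[ℝ] (Fin n → ℝ))‖ * Real.sqrt (eigenvalue Y ξ) *
      ‖toModel X‖ := by
  have hX : X = ∑ j, coordEquiv Y (toModel X) j • Y j := (Y.sum_equivFun X).symm
  conv_lhs => rw [hX, diff_sum_smul]
  calc ‖∑ j, ((coordEquiv Y (toModel X) j : ℝ) : ℂ) • ξ.diff (Y j)‖
      ≤ ∑ j, ‖((coordEquiv Y (toModel X) j : ℝ) : ℂ) • ξ.diff (Y j)‖ := norm_sum_le _ _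
    _ ≤ ∑ _j : Fin n, ‖(coordEquiv Y : E →L[ℝ] (Fin n → ℝ))‖ * ‖toModel X‖ *
        Real.sqrt (eigenvalue Y ξ) := by
        refine Finset.sum_le_sum fun j _ => ?_
        rw [norm_smul, Complex.norm_real]
        refine mul_le_mul ?_ (ξ.l2_opNorm_diff_le Y hB hY j) (norm_nonneg _) (by positivity)
        exact (norm_le_pi_norm _ j).trans
          ((coordEquiv Y : E →L[ℝ] (Fin n → ℝ)).le_opNorm (toModel X))
    _ = _ := by simp; ring

/-- The diagonal matrix coefficients vary slowly when the eigenvalue is small. -/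
theorem exists_norm_mat_inv_mul_sub_one_le
    (hB : ∀ (g : G) (X Z : GroupLieAlgebra 𝓘(ℝ, E) G), B (Ad g X) (Ad g Z) = B X Z)
    (hY : ∀ i j, B (Y i) (Y j) = if i = j then 1 else 0) : ∃ (C ρ : ℝ), 0 < C ∧ 0 < ρ ∧
    Metric.ball (extChartAt 𝓘(ℝ, E) (1 : G) 1) ρ ⊆ (extChartAt 𝓘(ℝ, E) (1 : G)).target ∧
    ∀ {K : Subgroup G} (ξ : TypeOneRep G K) (i : Fin ξ.d),
    ∀ e ∈ Metric.ball (extChartAt 𝓘(ℝ, E) (1 : G) 1) ρ,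
    ∀ e' ∈ Metric.ball (extChartAt 𝓘(ℝ, E) (1 : G) 1) ρ,
      ‖ξ.mat (((extChartAt 𝓘(ℝ, E) (1 : G)).symm e)⁻¹ *
        (extChartAt 𝓘(ℝ, E) (1 : G)).symm e') i i - 1‖ ≤
        C * (Real.sqrt (eigenvalue Y ξ) + 1) * ‖e' - e‖ := by
  obtain ⟨C, ρ, hC, hρ, hball, hlip⟩ := exists_norm_chart_inv_mul_le E G
  set c := extChartAt 𝓘(ℝ, E) (1 : G) with hc
  have hc1 : c.symm (c 1) = 1 := extChartAt_to_inv (1 : G)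
  set A : ℝ := n * ‖(coordEquiv Y : E →L[ℝ] (Fin n → ℝ))‖
  have hA : 0 ≤ A := by positivity
  refine ⟨C * (A + 1), ρ, by positivity, hρ, hball, fun {K} ξ i e₀ he₀ e₁ he₁ => ?_⟩
  set s := Real.sqrt (eigenvalue Y ξ)
  have hs : 0 ≤ s := Real.sqrt_nonneg _
  set f : G → ℂ := fun x => ξ.mat x i i
  have hf : ContMDiff 𝓘(ℝ, E) 𝓘(ℝ, ℂ) ∞ f := ξ.contMDiff_mat_apply i i
  set x := c.symm e₀
  -- h takes the value 1 at e₀, so the claim is a mean value estimate for h on the convex ball.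
  set h : E → ℂ := localForm f x⁻¹ with hh
  have hdiff : ∀ e ∈ Metric.ball (c 1) ρ, DifferentiableAt ℝ h e := fun e he =>
    (contMDiffAt_localForm hf x⁻¹ (hball he)).differentiableAt (by simp)
  -- Near e, h is the composite of z ↦ c((c⁻¹e)⁻¹c⁻¹z), whose displacement from c(1) is at most C‖z
  -- − e‖, with the function q(y) = (Uξ(y))_ii in the chart. As U is unitary, the derivative of q at
  -- 1 is at most A·s, independently of e.
  have hbound : ∀ e ∈ Metric.ball (c 1) ρ, ‖fderiv ℝ h e‖ ≤ (A * s + 1) * C := by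
    intro e he
    refine (hdiff e he).hasFDerivAt.le_of_lip' (by positivity) ?_
    set U := ξ.mat (x⁻¹ * c.symm e) with hU
    set q : G → ℂ := fun y => (U * ξ.mat y) i i with hq
    have hqs : ContMDiff 𝓘(ℝ, E) 𝓘(ℝ, ℂ) ∞ q := ξ.contMDiff_mul_mat_apply U i i
    have hqd : ‖fderiv ℝ (localForm q 1) (c 1)‖ ≤ A * s := by
      refine ContinuousLinearMap.opNorm_le_bound _ (by positivity) fun v => ?_
      have h1 := lieDeriv_eq_fderiv hqs ((toModel (G := G)).symm v) 1
      rw [LinearEquiv.apply_symm_apply] at h1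
      rw [hc, ← h1, hq, ξ.lieDeriv_mul_mat_apply]
      refine (norm_apply_le_l2_opNorm _ i i).trans ((norm_mul_le _ _).trans ?_)
      rw [hU, ξ.l2_opNorm_mat, one_mul]
      simpa using ξ.l2_opNorm_diff_le_norm Y hB hY ((toModel (G := G)).symm v)
    -- The extra 1 gives the strict inequality needed to pass from the norm of the derivative to a
    -- local Lipschitz constant.
    obtain ⟨κ, hκ⟩ : ∃ κ : ℝ≥0, (κ : ℝ) = A * s + 1 :=
      ⟨(A * s + 1).toNNReal, Real.coe_toNNReal _ (by positivity)⟩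
    obtain ⟨t, ht, hLip⟩ := ((contMDiffAt_localForm hqs 1
      (mem_extChartAt_target (1 : G))).of_le (m := 1)
      (by simp)).exists_lipschitzOnWith_of_nnnorm_lt κ (by
        rw [← NNReal.coe_lt_coe, hκ]
        exact hqd.trans_lt (lt_add_one _))
    have htend : Filter.Tendsto (fun e' => c ((c.symm e)⁻¹ * c.symm e')) (nhds e) (nhds (c 1)) := by
      rw [tendsto_iff_norm_sub_tendsto_zero]
      have h0 : Filter.Tendsto (fun e' => C * ‖e' - e‖) (nhds e) (nhds 0) := by
        have : Continuous fun e' => C * ‖e' - e‖ := by fun_prop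
        simpa using this.tendsto e
      refine squeeze_zero' (Filter.Eventually.of_forall fun _ => norm_nonneg _) ?_ h0
      filter_upwards [Metric.isOpen_ball.mem_nhds he] with e' he'
      exact (hlip e he e' he').2
    filter_upwards [Metric.isOpen_ball.mem_nhds he, htend ht] with e' he' hte'
    have hqe : ∀ z ∈ Metric.ball (c 1) ρ, h z = localForm q 1 (c ((c.symm e)⁻¹ * c.symm z)) := by
      intro z hz
      simp only [hh, localForm, hq, f, one_mul, ← hc]
      rw [c.left_inv (hlip e he z hz).1, hU, ← ξ.mat_mul, mul_assoc, mul_inv_cancel_left]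
    rw [hqe e' he', hqe e he, inv_mul_cancel, ← dist_eq_norm]
    have h1t : c 1 ∈ t := mem_of_mem_nhds ht
    refine (hLip.dist_le_mul _ hte' _ h1t).trans ?_
    rw [hκ]
    have hd : dist (c ((c.symm e)⁻¹ * c.symm e')) (c 1) ≤ C * ‖e' - e‖ := by
      rw [dist_eq_norm]
      exact (hlip e he e' he').2
    exact (mul_le_mul_of_nonneg_left hd (show 0 ≤ A * s + 1 by positivity)).trans_eq
      (mul_assoc _ _ _).symm
  have hmv := (convex_ball (c 1) ρ).norm_image_sub_le_of_norm_fderiv_le hdiff hbound he₀ he₁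
  have hx0 : h e₀ = 1 := by
    simp only [hh, localForm, f, ← hc]
    rw [inv_mul_cancel, ξ.mat_one, Matrix.one_apply_eq]
  rw [hx0] at hmv
  refine hmv.trans ?_
  refine mul_le_mul_of_nonneg_right ?_ (norm_nonneg _)
  nlinarith

end Counting

end HomBesov

end

noncomputable section

namespace HomBesov

/-! ### A polynomial count of the representations. -/

section Orthonormality

variable {G : Type*} [Group G] [TopologicalSpace G] [IsTopologicalGroup G] [CompactSpace G]
  [MeasurableSpace G] [BorelSpace G] {K : Subgroup G}

open Classical in
theorem integral_trace_mul_star_trace (ξ η : Dual G K) :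
    ∫ x, (ξ.rep.mat x).trace * star (η.rep.mat x).trace ∂(haarG G) = if ξ = η then 1 else 0 := by
  have h1 : ∫ x, (ξ.rep.mat x).trace * star (η.rep.mat x).trace ∂(haarG G) =
      ∑ a, ∑ b, ∫ x, ξ.rep.mat x a a * star (η.rep.mat x b b) ∂(haarG G) := by
    simp_rw [← integral_finsetSum _ fun b _ =>
      integrable_of_continuous (ξ.rep.continuous_mat_mul_star η.rep _ _ b b)]
    rw [← integral_finsetSum _ fun a _ => integrable_of_continuous (continuous_finsetSum _
      fun b _ => ξ.rep.continuous_mat_mul_star η.rep a a b b)]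
    congr 1 with x
    simp only [Matrix.trace, Matrix.diag_apply, star_sum, Finset.sum_mul_sum]
  rw [h1]
  by_cases h : ξ = η
  · subst h
    have hd : (ξ.rep.d : ℂ) ≠ 0 := by exact_mod_cast ξ.rep.d_pos.ne'
    simp_rw [ξ.rep.integral_mat_mul_star]
    simp [hd]
  · rw [if_neg h]
    exact Finset.sum_eq_zero fun a _ => Finset.sum_eq_zero fun b _ =>
      ξ.rep.integral_mat_mul_star_of_not_equivalent η.rep
        (Dual.not_equivalent_rep (Ne.symm h)) a a b b

/-- Parseval: the characters are orthonormal and the kernel has coefficients d_ξ. -/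
theorem integral_norm_sq_kernelFun (F : Finset (Dual G K)) :
    ∫ x, ‖kernelFun F x‖ ^ 2 ∂(haarG G) = ∑ ξ ∈ F, (ξ.rep.d : ℝ) ^ 2 := by
  classical
  have hc : ∀ ξ η : Dual G K, Continuous fun x => (ξ.rep.d : ℂ) * (η.rep.d : ℂ) *
      ((ξ.rep.mat x).trace * star (η.rep.mat x).trace) := fun ξ η =>
    continuous_const.mul (ξ.rep.continuous_trace_mat.mul η.rep.continuous_trace_mat.star)
  have h1 : ∫ x, kernelFun F x * star (kernelFun F x) ∂(haarG G) =
      ∑ ξ ∈ F, (ξ.rep.d : ℂ) ^ 2 := by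
    have h2 : ∀ x, kernelFun F x * star (kernelFun F x) = ∑ ξ ∈ F, ∑ η ∈ F,
        (ξ.rep.d : ℂ) * (η.rep.d : ℂ) * ((ξ.rep.mat x).trace * star (η.rep.mat x).trace) := by
      intro x
      simp only [kernelFun, star_sum, Finset.sum_mul_sum, star_mul', star_natCast]
      exact Finset.sum_congr rfl fun ξ _ => Finset.sum_congr rfl fun η _ => by ring
    simp_rw [h2]
    rw [integral_finsetSum _ fun ξ _ => integrable_of_continuous
      (continuous_finsetSum _ fun η _ => hc ξ η)]
    refine Finset.sum_congr rfl fun ξ hξ => ?_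
    rw [integral_finsetSum _ fun η _ => integrable_of_continuous (hc ξ η)]
    simp_rw [integral_const_mul, integral_trace_mul_star_trace]
    simp [hξ, sq]
  have h3 : ∀ x, kernelFun F x * star (kernelFun F x) = ((‖kernelFun F x‖ ^ 2 : ℝ) : ℂ) := fun x => by
    rw [RCLike.star_def, Complex.mul_conj']
    simp
  simp_rw [h3] at h1
  rw [integral_complex_ofReal] at h1
  exact_mod_cast h1

end Orthonormality

section Counting

variable {E : Type*} [NormedAddCommGroup E] [NormedSpace ℝ E] [FiniteDimensional ℝ E]
  {G : Type*} [Group G] [TopologicalSpace G] [IsTopologicalGroup G] [CompactSpace G] [T2Space G]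
  [ChartedSpace E G] [LieGroup 𝓘(ℝ, E) ∞ G] [MeasurableSpace G] [BorelSpace G]
  {n : ℕ} (Y : Module.Basis (Fin n) ℝ (GroupLieAlgebra 𝓘(ℝ, E) G))
  {B : LinearMap.BilinForm ℝ (GroupLieAlgebra 𝓘(ℝ, E) G)}

/-- The group can be divided into polynomially many parts on which all representations with
eigenvalue at most `l` vary little. -/
theorem exists_label
    (hB : ∀ (g : G) (X Z : GroupLieAlgebra 𝓘(ℝ, E) G), B (Ad g X) (Ad g Z) = B X Z)
    (hY : ∀ i j, B (Y i) (Y j) = if i = j then 1 else 0) : ∃ C : ℝ, 0 < C ∧ ∀ l : ℝ, 0 ≤ l →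
    ∃ (T : Finset (G × (Fin n → ℤ))) (label : G → G × (Fin n → ℤ)), (∀ x, label x ∈ T) ∧
      (T.card : ℝ) ≤ C * (1 + l) ^ n ∧
      ∀ x y, label x = label y → ∀ {K : Subgroup G} (ξ : TypeOneRep G K), eigenvalue Y ξ ≤ l →
        ∀ i, ‖ξ.mat (x⁻¹ * y) i i - 1‖ ≤ 1 / 2 := by
  obtain ⟨C, ρ, hC, hρ, hball, hmat⟩ := exists_norm_mat_inv_mul_sub_one_le Y hB hY
  set c := extChartAt 𝓘(ℝ, E) (1 : G) with hc
  set V : Set G := c.source ∩ c ⁻¹' Metric.ball (c 1) ρ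
  have hV : V ∈ nhds (1 : G) := Filter.inter_mem (extChartAt_source_mem_nhds (1 : G))
    ((continuousAt_extChartAt (1 : G)).preimage_mem_nhds (Metric.ball_mem_nhds _ hρ))
  obtain ⟨t, -, ht⟩ := isCompact_univ.elim_nhds_subcover (fun g : G => (fun x => g⁻¹ * x) ⁻¹' V)
    (fun g _ => (continuous_const_mul g⁻¹).continuousAt.preimage_mem_nhds (by simpa using hV))
  have ht' : ∀ x, ∃ g ∈ t, g⁻¹ * x ∈ V := fun x => by
    have := ht (Set.mem_univ x)
    simpa using this
  choose a hat haV using ht'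
  set A := (coordEquiv Y : E ≃L[ℝ] (Fin n → ℝ)) with hA
  set R : ℝ := ‖(A : E →L[ℝ] (Fin n → ℝ))‖ * (‖c 1‖ + ρ) with hR
  set D : ℝ := 2 * C * (‖(A.symm : (Fin n → ℝ) →L[ℝ] E)‖ + 1) with hD
  have hDpos : 0 < D := by positivity
  have hR0 : 0 ≤ R := by positivity
  have hcoord : ∀ e ∈ Metric.ball (c 1) ρ, ∀ j, |A e j| ≤ R := fun e he j => by
    have h1 : ‖e‖ ≤ ‖c 1‖ + ρ := by
      have := norm_le_norm_add_norm_sub (c 1) e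
      have h2 : ‖e - c 1‖ < ρ := by simpa [dist_eq_norm] using he
      rw [norm_sub_rev] at this
      linarith
    calc |A e j| = ‖A e j‖ := rfl
      _ ≤ ‖A e‖ := norm_le_pi_norm _ j
      _ ≤ ‖(A : E →L[ℝ] (Fin n → ℝ))‖ * ‖e‖ := (A : E →L[ℝ] (Fin n → ℝ)).le_opNorm e
      _ ≤ R := by rw [hR]; gcongr
  -- The number of translates of V covering G, times the number of cubes of side δ. Here δ⁻¹ is of
  -- order √l + 1, replaced crudely by 1 + l.
  refine ⟨(t.card + 1) * (2 * (2 * (R * D) + 3)) ^ n, by positivity, fun l hl => ?_⟩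
  set s := Real.sqrt l with hs
  have hs0 : 0 ≤ s := Real.sqrt_nonneg l
  have hs1 : s + 1 ≤ 2 * (1 + l) := by
    have : s ≤ 1 + l := by rw [hs, Real.sqrt_le_left (by positivity)]; nlinarith
    linarith
  -- The mesh for which C(s + 1)(‖A⁻¹‖ + 1)δ = 1/2.
  set δ : ℝ := 1 / (D * (s + 1)) with hδ
  have hδ0 : 0 < δ := by positivity
  set M : ℕ := ⌈R / δ⌉₊ with hM
  have hM1 : R / δ ≤ M := Nat.le_ceil _
  have hM2 : (M : ℝ) ≤ R / δ + 1 := (Nat.ceil_lt_add_one (by positivity)).le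
  -- A cell consists of the points that choose the same translate of V and fall into the same cube
  -- of side δ in its coordinates.
  let label : G → G × (Fin n → ℤ) := fun x => (a x, fun j => ⌊A (c ((a x)⁻¹ * x)) j / δ⌋)
  let T : Finset (G × (Fin n → ℤ)) :=
    t ×ˢ Fintype.piFinset fun _ => Finset.Icc (-(M : ℤ)) (M : ℤ)
  refine ⟨T, label, fun x => ?_, ?_, fun x y hxy K ξ hξ i => ?_⟩
  · simp only [T, label, Finset.mem_product, Fintype.mem_piFinset, Finset.mem_Icc]
    refine ⟨hat x, fun j => ?_⟩
    have h1 := abs_le.1 (hcoord _ (haV x).2 j)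
    constructor
    · rw [Int.le_floor]
      push_cast
      have : -R / δ ≤ A (c ((a x)⁻¹ * x)) j / δ := by gcongr; exact h1.1
      rw [neg_div] at this
      linarith
    · have h2 : A (c ((a x)⁻¹ * x)) j / δ ≤ R / δ := by gcongr; exact h1.2
      have h3 := Int.floor_le (A (c ((a x)⁻¹ * x)) j / δ)
      have : ((⌊A (c ((a x)⁻¹ * x)) j / δ⌋ : ℤ) : ℝ) ≤ ((M : ℤ) : ℝ) := by push_cast; linarith
      exact_mod_cast this
  · have hcard : (T.card : ℝ) = t.card * (2 * M + 1) ^ n := by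
      simp only [T, Finset.card_product, Fintype.card_piFinset, Finset.prod_const, Int.card_Icc,
        Finset.card_univ, Fintype.card_fin]
      have : ((M : ℤ) + 1 - -(M : ℤ)).toNat = 2 * M + 1 := by omega
      rw [this]
      push_cast
      ring
    rw [hcard, mul_assoc, ← mul_pow]
    have hRδ : R / δ = R * D * (s + 1) := by rw [hδ]; field_simp
    have hRD : 0 ≤ R * D := by positivity
    have h1 : 2 * (M : ℝ) + 1 ≤ 2 * (2 * (R * D) + 3) * (1 + l) := by
      calc 2 * (M : ℝ) + 1 ≤ (2 * (R * D) + 3) * (s + 1) := by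
            rw [hRδ] at hM2; nlinarith
        _ ≤ (2 * (R * D) + 3) * (2 * (1 + l)) := by gcongr
        _ = _ := by ring
    have h2 : (t.card : ℝ) ≤ t.card + 1 := by linarith
    gcongr
  · have h1 : a x = a y := congrArg Prod.fst hxy
    have h2 : ∀ j, ⌊A (c ((a x)⁻¹ * x)) j / δ⌋ = ⌊A (c ((a x)⁻¹ * y)) j / δ⌋ := fun j => by
      have := congrFun (congrArg Prod.snd hxy) j
      simp only [label] at this
      rw [this, h1]
    have hxV := haV x
    have hyV := haV y
    rw [← h1] at hyV
    set e := c ((a x)⁻¹ * x)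
    set e' := c ((a x)⁻¹ * y)
    have h3 : ‖A e' - A e‖ ≤ δ := by
      refine (pi_norm_le_iff_of_nonneg hδ0.le).2 fun j => ?_
      have h4 := Int.abs_sub_lt_one_of_floor_eq_floor (h2 j).symm
      rw [← sub_div, abs_div, abs_of_pos hδ0, div_lt_one hδ0] at h4
      exact h4.le
    have h5 : ‖e' - e‖ ≤ ‖(A.symm : (Fin n → ℝ) →L[ℝ] E)‖ * δ := by
      have h6 : e' - e = (A.symm : (Fin n → ℝ) →L[ℝ] E) (A e' - A e) := by
        rw [← map_sub]; simp
      rw [h6]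
      exact ((A.symm : (Fin n → ℝ) →L[ℝ] E).le_opNorm _).trans (by gcongr)
    have h7 := hmat ξ i e hxV.2 e' hyV.2
    have hxe : c.symm e = (a x)⁻¹ * x := c.left_inv hxV.1
    have hye : c.symm e' = (a x)⁻¹ * y := c.left_inv hyV.1
    rw [hxe, hye] at h7
    have h8 : ((a x)⁻¹ * x)⁻¹ * ((a x)⁻¹ * y) = x⁻¹ * y := by group
    rw [h8] at h7
    refine h7.trans ?_
    have h9 : Real.sqrt (eigenvalue Y ξ) ≤ s := Real.sqrt_le_sqrt hξ
    calc C * (Real.sqrt (eigenvalue Y ξ) + 1) * ‖e' - e‖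
        ≤ C * (s + 1) * ((‖(A.symm : (Fin n → ℝ) →L[ℝ] E)‖ + 1) * δ) := by
          gcongr
          refine h5.trans ?_
          gcongr
          linarith
      _ = 1 / 2 := by rw [hδ, hD]; field_simp

/-- A polynomial bound for the number of representations, counted with the square of the
dimension, with bounded eigenvalue. -/
theorem exists_sum_sq_le
    (hB : ∀ (g : G) (X Z : GroupLieAlgebra 𝓘(ℝ, E) G), B (Ad g X) (Ad g Z) = B X Z)
    (hY : ∀ i j, B (Y i) (Y j) = if i = j then 1 else 0)
    (K : Subgroup G) : ∃ C : ℝ, 0 < C ∧ ∀ l : ℝ, 0 ≤ l →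
    ∀ F : Finset (Dual G K), (∀ ξ ∈ F, eigenvalue Y ξ.rep ≤ l) →
      ∑ ξ ∈ F, (ξ.rep.d : ℝ) ^ 2 ≤ C * (1 + l) ^ n := by
  obtain ⟨C, hC, hlabel⟩ := exists_label Y hB hY
  refine ⟨4 * C, by positivity, fun l hl F hF => ?_⟩
  obtain ⟨T, label, hT, hcard, hlab⟩ := hlabel l hl
  set μ := haarG G
  set N : ℝ := ∑ ξ ∈ F, (ξ.rep.d : ℝ) ^ 2 with hN
  have hN0 : 0 ≤ N := Finset.sum_nonneg fun _ _ => by positivity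
  set U : Set G := {y | ∀ ξ ∈ F, ∀ i, ‖ξ.rep.mat y i i - 1‖ ≤ 1 / 2}
  have hUc : IsClosed U := by
    have : U = ⋂ ξ ∈ F, ⋂ i, {y | ‖ξ.rep.mat y i i - 1‖ ≤ 1 / 2} := by ext y; simp [U]
    rw [this]
    exact isClosed_biInter fun ξ _ => isClosed_iInter fun i =>
      isClosed_le ((ξ.rep.continuous_mat_apply i i).sub continuous_const).norm continuous_const
  -- Every non-empty cell lies in a left translate of U, so invariance forces U to have measure at
  -- least 1/|T|.
  have hU1 : 1 ≤ T.card * μ.real U := by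
    have h1 : ∀ τ, μ.real (label ⁻¹' {τ}) ≤ μ.real U := fun τ => by
      rcases (label ⁻¹' {τ}).eq_empty_or_nonempty with h | ⟨x, hx⟩
      · rw [h]; simp
      · have hsub : label ⁻¹' {τ} ⊆ (fun y => x⁻¹ * y) ⁻¹' U := fun y hy ξ hξ i =>
          hlab x y (hx.trans hy.symm) ξ.rep (hF ξ hξ) i
        refine (measureReal_mono hsub (measure_ne_top (haarG G) _)).trans_eq ?_
        rw [measureReal_def, measure_preimage_mul, measureReal_def]
    have h2 : (Set.univ : Set G) ⊆ ⋃ τ ∈ T, label ⁻¹' {τ} := fun x _ => by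
      simpa using hT x
    calc (1 : ℝ) = μ.real Set.univ := by simp [μ]
      _ ≤ μ.real (⋃ τ ∈ T, label ⁻¹' {τ}) := measureReal_mono h2 (measure_ne_top (haarG G) _)
      _ ≤ ∑ τ ∈ T, μ.real (label ⁻¹' {τ}) := measureReal_biUnion_finset_le _ _
      _ ≤ ∑ _τ ∈ T, μ.real U := Finset.sum_le_sum fun τ _ => h1 τ
      _ = T.card * μ.real U := by simp
  -- On U each diagonal entry has real part at least 1/2, so Re(d_ξ Tr ξ(x)) ≥ d_ξ²/2, and these
  -- lower bounds add up to N/2.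
  have hlow : ∀ x ∈ U, (N / 2) ^ 2 ≤ ‖kernelFun F x‖ ^ 2 := fun x hx => by
    have hre : N / 2 ≤ (kernelFun F x).re := by
      rw [kernelFun, Complex.re_sum, hN, Finset.sum_div]
      refine Finset.sum_le_sum fun ξ hξ => ?_
      have h1 : (ξ.rep.d : ℝ) / 2 ≤ ((ξ.rep.mat x).trace).re := by
        rw [Matrix.trace, Complex.re_sum]
        have h2 : ∑ _i : Fin ξ.rep.d, (1 / 2 : ℝ) = (ξ.rep.d : ℝ) / 2 := by simp; ring
        rw [← h2]
        refine Finset.sum_le_sum fun i _ => ?_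
        have h3 := (Complex.abs_re_le_norm _).trans (hx ξ hξ i)
        rw [Complex.sub_re, Complex.one_re] at h3
        have := (abs_le.1 h3).1
        rw [Matrix.diag_apply]
        linarith
      have h4 : ((ξ.rep.d : ℂ) * (ξ.rep.mat x).trace).re =
          (ξ.rep.d : ℝ) * ((ξ.rep.mat x).trace).re := by
        rw [← Complex.ofReal_natCast, Complex.re_ofReal_mul]
      rw [h4]
      have h5 : (0 : ℝ) ≤ ξ.rep.d := Nat.cast_nonneg _
      nlinarith
    have := hre.trans (Complex.re_le_norm _)
    gcongr
  have hφint : Integrable (fun x => ‖kernelFun F x‖ ^ 2) μ :=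
    ((continuous_kernelFun F).norm.pow 2).integrable_of_hasCompactSupport
      (HasCompactSupport.of_compactSpace _)
  -- The kernel has squared L² norm N, yet its square is at least N²/4 on U. Dividing by N gives
  -- N·μ(U) ≤ 4, hence N ≤ 4|T|.
  have hmain : (N / 2) ^ 2 * μ.real U ≤ N := by
    calc (N / 2) ^ 2 * μ.real U = ∫ _x in U, (N / 2) ^ 2 ∂μ := by simp [mul_comm]
      _ ≤ ∫ x in U, ‖kernelFun F x‖ ^ 2 ∂μ :=
          setIntegral_mono_on (integrable_const _).integrableOn hφint.integrableOn
            hUc.measurableSet hlow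
      _ ≤ ∫ x, ‖kernelFun F x‖ ^ 2 ∂μ :=
          setIntegral_le_integral hφint (Filter.Eventually.of_forall fun x => by positivity)
      _ = N := integral_norm_sq_kernelFun F
  have hNle : N ≤ 4 * T.card := by
    rcases hN0.eq_or_lt with h | h
    · rw [← h]; positivity
    · have h1 : N * μ.real U ≤ 4 := by
        have h2 : N * (N * μ.real U) ≤ N * 4 := by nlinarith
        exact le_of_mul_le_mul_left h2 h
      calc N = N * 1 := (mul_one N).symm
        _ ≤ N * (T.card * μ.real U) := by gcongr
        _ = T.card * (N * μ.real U) := by ring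
        _ ≤ T.card * 4 := by gcongr
        _ = 4 * T.card := mul_comm _ _
  calc N ≤ 4 * T.card := hNle
    _ ≤ 4 * (C * (1 + l) ^ n) := by gcongr
    _ = _ := by ring

end Counting

end HomBesov

end

/-! ### Summability, and growth and decay of Fourier coefficients. -/

noncomputable section

namespace HomBesov

theorem exists_norm_iterLieDeriv_le {E : Type*} [NormedAddCommGroup E] [NormedSpace ℝ E]
    {G : Type*} [Group G] [TopologicalSpace G] [CompactSpace G] [ChartedSpace E G]
    [LieGroup 𝓘(ℝ, E) ∞ G] {n : ℕ} (Y : Module.Basis (Fin n) ℝ (GroupLieAlgebra 𝓘(ℝ, E) G))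
    {f : G → ℂ} (hf : ContMDiff 𝓘(ℝ, E) 𝓘(ℝ, ℂ) ∞ f) (N : ℕ) :
    ∃ A : ℝ, 0 ≤ A ∧ ∀ w : List (Fin n), w.length ≤ N → ∀ x, ‖iterLieDeriv Y w f x‖ ≤ A := by
  have h1 : ∀ w : List (Fin n), ∃ A : ℝ, ∀ x, ‖iterLieDeriv Y w f x‖ ≤ A := fun w => by
    obtain ⟨A, hA⟩ := isCompact_univ.exists_bound_of_continuousOn
      (contMDiff_iterLieDeriv Y hf w).continuous.continuousOn
    exact ⟨A, fun x => hA x (Set.mem_univ x)⟩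
  choose A hA using h1
  have hfin : {w : List (Fin n) | w.length ≤ N}.Finite := List.finite_length_le (Fin n) N
  refine ⟨∑ w ∈ hfin.toFinset, |A w|, Finset.sum_nonneg fun _ _ => abs_nonneg _,
    fun w hw x => ((hA w x).trans (le_abs_self _)).trans ?_⟩
  exact Finset.single_le_sum (f := fun w => |A w|) (fun _ _ => abs_nonneg _)
    (hfin.mem_toFinset.2 hw)

theorem conjTranspose_onM_mem_smoothFun {E : Type*} [NormedAddCommGroup E] [NormedSpace ℝ E]
    [FiniteDimensional ℝ E] {G : Type*} [Group G] [TopologicalSpace G] [CompactSpace G]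
    [T2Space G] [IsTopologicalGroup G] [ChartedSpace E G] [LieGroup 𝓘(ℝ, E) ∞ G]
    [MeasurableSpace G] [BorelSpace G] {K : Subgroup G} (ξ : TypeOneRep G K) (i j : Fin ξ.d) :
    (fun x => (ξ.onM x)ᴴ i j) ∈ smoothFun E K :=
  contMDiff_star_complex (ξ.contMDiff_mat_mul_apply ξ.proj j i)

section Estimates

variable {E : Type*} [NormedAddCommGroup E] [NormedSpace ℝ E] [FiniteDimensional ℝ E]
  {G : Type*} [Group G] [TopologicalSpace G] [IsTopologicalGroup G] [CompactSpace G] [T2Space G]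
  [ChartedSpace E G] [LieGroup 𝓘(ℝ, E) ∞ G] [MeasurableSpace G] [BorelSpace G]
  {n : ℕ} (Y : Module.Basis (Fin n) ℝ (GroupLieAlgebra 𝓘(ℝ, E) G))
  {B : LinearMap.BilinForm ℝ (GroupLieAlgebra 𝓘(ℝ, E) G)}
  {K : Subgroup G}

-- Split the dual into shells k ≤ λ < k + 1. Since d ≥ 1, the counting bound leaves at most C(k +
-- 2)^n classes in a shell, and the exponent n + 2 makes its total contribution O((k + 1)⁻²).
variable (K) in
theorem summable_inv_one_add_eigenvalue_pow
    (hB : ∀ (g : G) (X Z : GroupLieAlgebra 𝓘(ℝ, E) G), B (Ad g X) (Ad g Z) = B X Z)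
    (hY : ∀ i j, B (Y i) (Y j) = if i = j then 1 else 0) :
    Summable fun ξ : Dual G K => ((1 + eigenvalue Y ξ.rep) ^ (n + 2))⁻¹ := by
  classical
  obtain ⟨C, hC, hsum⟩ := exists_sum_sq_le Y hB hY K
  have h0 : ∀ ξ : Dual G K, 0 ≤ eigenvalue Y ξ.rep := fun ξ => (ξ.rep.eigenvalue_spec Y hB hY).1
  have hS : Summable fun k : ℕ => ((k + 1 : ℝ) ^ 2)⁻¹ := by
    have := (summable_nat_add_iff 1).2 (Real.summable_nat_pow_inv.2 (one_lt_two))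
    simpa using this
  refine summable_of_sum_le (c := C * 2 ^ n * ∑' k : ℕ, ((k + 1 : ℝ) ^ 2)⁻¹)
    (fun ξ => by have := h0 ξ; positivity) fun F => ?_
  set N := F.sup fun ξ => ⌊eigenvalue Y ξ.rep⌋₊
  have hmaps : ∀ ξ ∈ F, ⌊eigenvalue Y ξ.rep⌋₊ ∈ Finset.range (N + 1) := fun ξ hξ =>
    Finset.mem_range_succ_iff.2 (Finset.le_sup (f := fun ξ => ⌊eigenvalue Y ξ.rep⌋₊) hξ)
  rw [← Finset.sum_fiberwise_of_maps_to hmaps]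
  calc ∑ k ∈ Finset.range (N + 1), ∑ ξ ∈ F with ⌊eigenvalue Y ξ.rep⌋₊ = k,
        ((1 + eigenvalue Y ξ.rep) ^ (n + 2))⁻¹
      ≤ ∑ k ∈ Finset.range (N + 1), C * 2 ^ n * ((k + 1 : ℝ) ^ 2)⁻¹ := by
        refine Finset.sum_le_sum fun k _ => ?_
        set Fk := F.filter fun ξ => ⌊eigenvalue Y ξ.rep⌋₊ = k
        have hk : ∀ ξ ∈ Fk, (k : ℝ) ≤ eigenvalue Y ξ.rep ∧ eigenvalue Y ξ.rep ≤ k + 1 := by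
          intro ξ hξ
          have h1 : ⌊eigenvalue Y ξ.rep⌋₊ = k := (Finset.mem_filter.1 hξ).2
          rw [← h1]
          exact ⟨Nat.floor_le (h0 ξ), (Nat.lt_floor_add_one _).le⟩
        have hcard : (Fk.card : ℝ) ≤ C * (1 + (k + 1 : ℝ)) ^ n := by
          refine le_trans ?_ (hsum (k + 1) (by positivity) Fk fun ξ hξ => (hk ξ hξ).2)
          rw [Finset.card_eq_sum_ones, Nat.cast_sum]
          refine Finset.sum_le_sum fun ξ _ => ?_
          have : (1 : ℝ) ≤ ξ.rep.d := by exact_mod_cast Nat.one_le_of_lt ξ.rep.d_pos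
          rw [Nat.cast_one]
          exact one_le_pow₀ this
        calc ∑ ξ ∈ Fk, ((1 + eigenvalue Y ξ.rep) ^ (n + 2))⁻¹
            ≤ ∑ _ξ ∈ Fk, ((k + 1 : ℝ) ^ (n + 2))⁻¹ := by
              refine Finset.sum_le_sum fun ξ hξ => ?_
              have := (hk ξ hξ).1
              exact inv_anti₀ (by positivity)
                (pow_le_pow_left₀ (by positivity) (by linarith) _)
          _ = Fk.card * ((k + 1 : ℝ) ^ (n + 2))⁻¹ := by simp
          _ ≤ C * (1 + (k + 1 : ℝ)) ^ n * ((k + 1 : ℝ) ^ (n + 2))⁻¹ := by gcongr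
          _ ≤ C * (2 * (k + 1 : ℝ)) ^ n * ((k + 1 : ℝ) ^ (n + 2))⁻¹ := by
              gcongr
              have : (0 : ℝ) ≤ k := Nat.cast_nonneg k
              linarith
          _ = C * 2 ^ n * ((k + 1 : ℝ) ^ 2)⁻¹ := by
              rw [mul_pow, pow_add]
              field_simp
    _ = C * 2 ^ n * ∑ k ∈ Finset.range (N + 1), ((k + 1 : ℝ) ^ 2)⁻¹ := by rw [Finset.mul_sum]
    _ ≤ _ := by
        gcongr
        exact hS.sum_le_tsum _ fun k _ => by positivity

variable (K) in
/-- Products of powers of the dimension and the eigenvalue become summable after division by a high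
power of the eigenvalue. -/
theorem exists_summable_majorant
    (hB : ∀ (g : G) (X Z : GroupLieAlgebra 𝓘(ℝ, E) G), B (Ad g X) (Ad g Z) = B X Z)
    (hY : ∀ i j, B (Y i) (Y j) = if i = j then 1 else 0)
    (p q : ℕ) : ∃ (M : ℕ) (g : Dual G K → ℝ), Summable g ∧
    (∀ ξ, 0 ≤ g ξ) ∧ ∀ ξ : Dual G K,
      (ξ.rep.d : ℝ) ^ p * (1 + eigenvalue Y ξ.rep) ^ q ≤ g ξ * (1 + eigenvalue Y ξ.rep) ^ M := by
  obtain ⟨C, hC, hsum⟩ := exists_sum_sq_le Y hB hY K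
  refine ⟨n * p + q + (n + 2), fun ξ => C ^ p * ((1 + eigenvalue Y ξ.rep) ^ (n + 2))⁻¹,
    (summable_inv_one_add_eigenvalue_pow Y K hB hY).mul_left _, fun ξ => ?_, fun ξ => ?_⟩
  · have := (ξ.rep.eigenvalue_spec Y hB hY).1
    positivity
  · have h0 := (ξ.rep.eigenvalue_spec Y hB hY).1
    -- The counting bound for a single class, together with d ≤ d².
    have hd : (ξ.rep.d : ℝ) ≤ C * (1 + eigenvalue Y ξ.rep) ^ n := by
      have h1 := hsum _ h0 {ξ} (by simp)
      rw [Finset.sum_singleton] at h1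
      have : (1 : ℝ) ≤ ξ.rep.d := by exact_mod_cast Nat.one_le_of_lt ξ.rep.d_pos
      nlinarith
    calc (ξ.rep.d : ℝ) ^ p * (1 + eigenvalue Y ξ.rep) ^ q
        ≤ (C * (1 + eigenvalue Y ξ.rep) ^ n) ^ p * (1 + eigenvalue Y ξ.rep) ^ q := by gcongr
      _ = _ := by
        rw [mul_pow, ← pow_mul, pow_add, pow_add]
        field_simp

-- The summable family has no zero term, and the support of a summable family is countable.
variable (K) in
theorem countable_dual
    (hB : ∀ (g : G) (X Z : GroupLieAlgebra 𝓘(ℝ, E) G), B (Ad g X) (Ad g Z) = B X Z)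
    (hY : ∀ i j, B (Y i) (Y j) = if i = j then 1 else 0) : Countable (Dual G K) := by
  have h := (summable_inv_one_add_eigenvalue_pow Y K hB hY).countable_support
  have : Function.support (fun ξ : Dual G K => ((1 + eigenvalue Y ξ.rep) ^ (n + 2))⁻¹) =
      Set.univ := by
    ext ξ
    have h0 := (ξ.rep.eigenvalue_spec Y hB hY).1
    simp only [Function.mem_support, Set.mem_univ, iff_true]
    positivity
  rw [this] at h
  exact Set.countable_univ_iff.1 h

-- A summable family tends to zero cofinitely, while ⟨ξ⟩ < R bounds its term at ξ below by a
-- positive constant.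
variable (K) in
theorem finite_weight_lt
    (hB : ∀ (g : G) (X Z : GroupLieAlgebra 𝓘(ℝ, E) G), B (Ad g X) (Ad g Z) = B X Z)
    (hY : ∀ i j, B (Y i) (Y j) = if i = j then 1 else 0)
    (R : ℝ) : {ξ : Dual G K | weight Y ξ < R}.Finite := by
  have h := (summable_inv_one_add_eigenvalue_pow Y K hB hY).tendsto_cofinite_zero
  have h2 := h.eventually (gt_mem_nhds (show (0 : ℝ) < ((1 + R ^ 2) ^ (n + 2))⁻¹ by positivity))
  refine (Filter.eventually_cofinite.1 h2).subset fun ξ hξ => ?_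
  have h0 := (ξ.rep.eigenvalue_spec Y hB hY).1
  have hξ' : Real.sqrt (1 + eigenvalue Y ξ.rep) < R := hξ
  have hR : 0 < R := (Real.sqrt_nonneg _).trans_lt hξ'
  rw [Real.sqrt_lt' hR] at hξ'
  rw [Set.mem_ofPred_eq, not_lt]
  gcongr
  linarith

/-- Decay of the Fourier coefficients of smooth functions. -/
theorem pow_mul_norm_integral_mul_mat_le
    (hB : ∀ (g : G) (X Z : GroupLieAlgebra 𝓘(ℝ, E) G), B (Ad g X) (Ad g Z) = B X Z)
    (hY : ∀ i j, B (Y i) (Y j) = if i = j then 1 else 0)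
    (ξ : TypeOneRep G K) (M : ℕ) {f : G → ℂ}
    (hf : ContMDiff 𝓘(ℝ, E) 𝓘(ℝ, ℂ) ∞ f) {A : ℝ}
    (hA : ∀ w : List (Fin n), w.length ≤ 2 * M → ∀ x, ‖iterLieDeriv Y w f x‖ ≤ A)
    (i j : Fin ξ.d) :
    (1 + eigenvalue Y ξ) ^ M * ‖∫ x, f x * (ξ.mat x * ξ.proj) i j ∂(haarG G)‖ ≤ (1 + n) ^ M * A :=
  pow_mul_norm_integral_mul_le Y (ξ.contMDiff_mat_mul_apply _ i j)
    (ξ.norm_mat_mul_apply_le ξ.l2_opNorm_proj_le i j) (ξ.eigenvalue_spec Y hB hY).1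
    (ξ.laplacian_mat_mul_apply Y hB hY _ i j) M hf hA

/-- The Laplacian is real, so conjugated matrix coefficients are eigenfunctions with the same real
eigenvalue. These are the coefficients that occur in `fourier`. -/
theorem pow_mul_norm_integral_mul_conjTranspose_mat_le
    (hB : ∀ (g : G) (X Z : GroupLieAlgebra 𝓘(ℝ, E) G), B (Ad g X) (Ad g Z) = B X Z)
    (hY : ∀ i j, B (Y i) (Y j) = if i = j then 1 else 0)
    (ξ : TypeOneRep G K) (M : ℕ) {f : G → ℂ}
    (hf : ContMDiff 𝓘(ℝ, E) 𝓘(ℝ, ℂ) ∞ f) {A : ℝ}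
    (hA : ∀ w : List (Fin n), w.length ≤ 2 * M → ∀ x, ‖iterLieDeriv Y w f x‖ ≤ A)
    (i j : Fin ξ.d) :
    (1 + eigenvalue Y ξ) ^ M * ‖∫ x, f x * (ξ.mat x)ᴴ i j ∂(haarG G)‖ ≤ (1 + n) ^ M * A := by
  have hs := ξ.contMDiff_mat_apply (E := E) j i
  refine pow_mul_norm_integral_mul_le Y (h := fun x => (ξ.mat x)ᴴ i j) (contMDiff_star_complex hs)
    (fun x => ?_) (ξ.eigenvalue_spec Y hB hY).1 (fun x => ?_) M hf hA
  · rw [Matrix.conjTranspose_apply, norm_star]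
    exact ξ.norm_mat_apply_le x j i
  · have h := ξ.laplacian_mat_mul_apply Y hB hY 1 j i x
    simp only [Matrix.mul_one] at h
    have h2 : laplacian Y (fun x => star (ξ.mat x j i)) x =
        star (laplacian Y (fun x => ξ.mat x j i) x) := by
      simp only [laplacian, star_sum]
      refine Finset.sum_congr rfl fun a _ => ?_
      exact congrFun (iterLieDeriv_star Y [a, a] hs) x
    simp only [Matrix.conjTranspose_apply]
    rw [h2, ← star_neg, h]
    simp

/-- Growth of the Fourier coefficients of distributions. -/
theorem exists_norm_distFourier_le
    (hB : ∀ (g : G) (X Z : GroupLieAlgebra 𝓘(ℝ, E) G), B (Ad g X) (Ad g Z) = B X Z)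
    (hY : ∀ i j, B (Y i) (Y j) = if i = j then 1 else 0)
    (u : Distribution Y K) : ∃ (N : ℕ) (C : ℝ), 0 ≤ C ∧
    ∀ (ξ : Dual G K) (i j : Fin ξ.rep.d),
      ‖distFourier u ξ i j‖ ≤ C * (1 + eigenvalue Y ξ.rep) ^ N := by
  obtain ⟨N, C, hu⟩ := u.2
  refine ⟨N, |C|, abs_nonneg C, fun ξ i j => ?_⟩
  have h0 := (ξ.rep.eigenvalue_spec Y hB hY).1
  have hmem := conjTranspose_onM_mem_smoothFun (E := E) ξ.rep i j
  rw [distFourier, Matrix.of_apply, distPair, dif_pos hmem]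
  have h1 : 1 ≤ Real.sqrt (1 + eigenvalue Y ξ.rep) := by
    rw [Real.one_le_sqrt]; linarith
  have h2 : Real.sqrt (1 + eigenvalue Y ξ.rep) ≤ 1 + eigenvalue Y ξ.rep := by
    rw [Real.sqrt_le_left (by positivity)]; nlinarith
  -- Up to N derivatives cost at most ⟨ξ⟩^N, estimated crudely by (1 + λ)^N.
  refine (hu ⟨_, hmem⟩ ((1 + eigenvalue Y ξ.rep) ^ N) fun w hw x => ?_).trans
    (mul_le_mul_of_nonneg_right (le_abs_self C) (by positivity))
  change ‖iterLieDeriv Y w (fun x => star ((ξ.rep.mat x * ξ.rep.proj) j i)) x‖ ≤ _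
  rw [iterLieDeriv_star Y w (ξ.rep.contMDiff_mat_mul_apply _ j i), norm_star]
  refine (ξ.rep.norm_iterLieDeriv_mat_mul_apply_le Y hB hY w ξ.rep.l2_opNorm_proj_le j i x).trans ?_
  calc Real.sqrt (1 + eigenvalue Y ξ.rep) ^ w.length
      ≤ Real.sqrt (1 + eigenvalue Y ξ.rep) ^ N := pow_le_pow_right₀ h1 hw
    _ ≤ (1 + eigenvalue Y ξ.rep) ^ N := by gcongr

end Estimates

theorem norm_mul_apply_le {d : ℕ} {A C : Matrix (Fin d) (Fin d) ℂ} {α β : ℝ}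
    (hA : ∀ i j, ‖A i j‖ ≤ α) (hC : ∀ i j, ‖C i j‖ ≤ β) (i j : Fin d) :
    ‖(A * C) i j‖ ≤ d * (α * β) := by
  rw [Matrix.mul_apply]
  refine (norm_sum_le _ _).trans ?_
  refine (Finset.sum_le_sum (g := fun _ => α * β) fun k _ => ?_).trans_eq (by simp)
  rw [norm_mul]
  exact mul_le_mul (hA i k) (hC k j) (norm_nonneg _) ((norm_nonneg _).trans (hA i k))

theorem norm_trace_mul_le {d : ℕ} {A C : Matrix (Fin d) (Fin d) ℂ} {α β : ℝ}
    (hA : ∀ i j, ‖A i j‖ ≤ α) (hC : ∀ i j, ‖C i j‖ ≤ β) :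
    ‖(A * C).trace‖ ≤ d ^ 2 * (α * β) := by
  rw [Matrix.trace]
  refine (norm_sum_le _ _).trans
    ((Finset.sum_le_sum fun i _ => norm_mul_apply_le hA hC i i).trans_eq ?_)
  simp
  ring

end HomBesov

end

noncomputable section

namespace HomBesov

/-! ### Trigonometric polynomials and the size of the symbol. -/

section Algebra

variable {G : Type*} [Group G] [TopologicalSpace G] {K : Subgroup G}

namespace TypeOneRep

variable (ξ : TypeOneRep G K)

theorem onM_mk (x : G) : ξ.onM (x : G ⧸ K) = ξ.mat x * ξ.proj := rfl

theorem mat_mul_proj_apply (x : G) (i j : Fin ξ.d) :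
    (ξ.mat x * ξ.proj) i j = ξ.mat x i j * ξ.proj j j := by
  simp [proj, Matrix.mul_diagonal]

theorem star_proj_apply (j : Fin ξ.d) : star (ξ.proj j j) = ξ.proj j j := by
  simp only [proj, Matrix.diagonal_apply_eq]
  split_ifs <;> simp

theorem proj_mul_proj_apply (j : Fin ξ.d) : ξ.proj j j * ξ.proj j j = ξ.proj j j := by
  simp only [proj, Matrix.diagonal_apply_eq]
  split_ifs <;> simp

theorem proj_mul_apply (A : Matrix (Fin ξ.d) (Fin ξ.d) ℂ) (i j : Fin ξ.d) :
    (ξ.proj * A) i j = ξ.proj i i * A i j := by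
  simp [proj, Matrix.diagonal_mul]

end TypeOneRep

theorem IsMultiplierSymbol.mul_proj {σ : MatFamily G K} (hσ : IsMultiplierSymbol σ)
    (ξ : Dual G K) : σ ξ * ξ.rep.proj = σ ξ := by
  ext i j
  rw [TypeOneRep.proj, Matrix.mul_diagonal]
  split_ifs with h
  · simp
  · simp [hσ ξ i j (Or.inr (not_lt.1 h))]

theorem IsMultiplierSymbol.proj_mul {σ : MatFamily G K} (hσ : IsMultiplierSymbol σ)
    (ξ : Dual G K) : ξ.rep.proj * σ ξ = σ ξ := by
  ext i j
  rw [TypeOneRep.proj, Matrix.diagonal_mul]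
  split_ifs with h
  · simp
  · simp [hσ ξ i j (Or.inl (not_lt.1 h))]

open Classical in
/-- The Fourier series with coefficients restricted to a finite set. -/
theorem fourierSeries_eq_sum {a : MatFamily G K} {F : Finset (Dual G K)}
    (ha : ∀ ξ ∉ F, a ξ = 0) (x : G ⧸ K) :
    fourierSeries a x = ∑ ξ ∈ F, (ξ.rep.d : ℂ) * (ξ.rep.onM x * a ξ).trace :=
  tsum_eq_sum fun ξ hξ => by simp [ha ξ hξ]

theorem continuous_trace_onM_mul (ξ : TypeOneRep G K) (A : Matrix (Fin ξ.d) (Fin ξ.d) ℂ) :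
    Continuous fun x : G => (ξ.onM x * A).trace := by
  simp_rw [TypeOneRep.onM_mk, Matrix.mul_assoc, Matrix.trace, Matrix.diag_apply, Matrix.mul_apply]
  exact continuous_finsetSum _ fun i _ => continuous_finsetSum _ fun j _ =>
    (ξ.continuous_mat_apply i j).mul continuous_const

theorem measurable_of_continuous_lift [MeasurableSpace G] [BorelSpace G] {f : G ⧸ K → ℂ}
    (hf : Continuous fun x : G => f x) :
    Measurable f :=
  QuotientGroup.measurable_from_quotient.2 hf.measurable

theorem continuous_fourierSeries_of_finite {a : MatFamily G K} {F : Finset (Dual G K)}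
    (ha : ∀ ξ ∉ F, a ξ = 0) : Continuous fun x : G => fourierSeries a (x : G ⧸ K) := by
  simp_rw [fourierSeries_eq_sum ha]
  exact continuous_finsetSum _ fun ξ _ =>
    continuous_const.mul (continuous_trace_onM_mul ξ.rep (a ξ))

end Algebra

section TrigPolynomials

variable {G : Type*} [Group G] [TopologicalSpace G] [IsTopologicalGroup G] [CompactSpace G]
  [MeasurableSpace G] [BorelSpace G] {K : Subgroup G}

theorem integral_trace_onM_mul_conjTranspose_self (ξ : TypeOneRep G K)
    (A : Matrix (Fin ξ.d) (Fin ξ.d) ℂ) (i j : Fin ξ.d) :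
    ∫ x, (ξ.onM (x : G ⧸ K) * A).trace * (ξ.mat x)ᴴ i j ∂(haarG G) =
      (ξ.d : ℂ)⁻¹ * (ξ.proj * A) i j := by
  have h : ∀ x : G, (ξ.onM (x : G ⧸ K) * A).trace * (ξ.mat x)ᴴ i j =
      ∑ a, ∑ b, (ξ.proj * A) b a * (ξ.mat x a b * star (ξ.mat x j i)) := fun x => by
    simp_rw [TypeOneRep.onM_mk, Matrix.mul_assoc, Matrix.trace, Matrix.diag_apply,
      Matrix.mul_apply (M := ξ.mat x), Finset.sum_mul, Matrix.conjTranspose_apply]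
    exact Finset.sum_congr rfl fun a _ => Finset.sum_congr rfl fun b _ => by ring
  simp_rw [h]
  have hc : ∀ a b, Continuous fun x => (ξ.proj * A) b a * (ξ.mat x a b * star (ξ.mat x j i)) :=
    fun a b => continuous_const.mul (ξ.continuous_mat_mul_star ξ a b j i)
  rw [integral_finsetSum _ fun a _ => integrable_of_continuous
    (continuous_finsetSum _ fun b _ => hc a b)]
  simp_rw [integral_finsetSum _ fun b _ => integrable_of_continuous (hc _ b), integral_const_mul,
    ξ.integral_mat_mul_star]
  rw [Finset.sum_eq_single j (fun a _ ha => by simp [ha]) (by simp),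
    Finset.sum_eq_single i (fun b _ hb => by simp [hb]) (by simp)]
  simp [mul_comm]

theorem integral_trace_onM_mul_conjTranspose_of_ne {ξ η : Dual G K} (hne : ξ ≠ η)
    (A : Matrix (Fin ξ.rep.d) (Fin ξ.rep.d) ℂ) (i j : Fin η.rep.d) :
    ∫ x, (ξ.rep.onM (x : G ⧸ K) * A).trace * (η.rep.mat x)ᴴ i j ∂(haarG G) = 0 := by
  have h : ∀ x : G, (ξ.rep.onM (x : G ⧸ K) * A).trace * (η.rep.mat x)ᴴ i j =
      ∑ a, ∑ b, (ξ.rep.proj * A) b a * (ξ.rep.mat x a b * star (η.rep.mat x j i)) := fun x => by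
    simp_rw [TypeOneRep.onM_mk, Matrix.mul_assoc, Matrix.trace, Matrix.diag_apply,
      Matrix.mul_apply (M := ξ.rep.mat x), Finset.sum_mul, Matrix.conjTranspose_apply]
    exact Finset.sum_congr rfl fun a _ => Finset.sum_congr rfl fun b _ => by ring
  simp_rw [h]
  have hc : ∀ a b, Continuous fun x => (ξ.rep.proj * A) b a *
      (ξ.rep.mat x a b * star (η.rep.mat x j i)) :=
    fun a b => continuous_const.mul (ξ.rep.continuous_mat_mul_star η.rep a b j i)
  rw [integral_finsetSum _ fun a _ => integrable_of_continuous
    (continuous_finsetSum _ fun b _ => hc a b)]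
  simp_rw [integral_finsetSum _ fun b _ => integrable_of_continuous (hc _ b), integral_const_mul,
    ξ.rep.integral_mat_mul_star_of_not_equivalent η.rep (Dual.not_equivalent_rep hne.symm)]
  simp

/-- The Fourier coefficients of a trigonometric polynomial. -/
theorem fourier_fourierSeries {a : MatFamily G K} {F : Finset (Dual G K)}
    (ha : ∀ ξ ∉ F, a ξ = 0) (η : Dual G K) :
    fourier (fourierSeries a) η = η.rep.proj * a η := by
  classical
  ext i j
  rw [fourier, Matrix.of_apply]
  simp_rw [fourierSeries_eq_sum ha, Finset.sum_mul]
  have hc : ∀ ξ : Dual G K, Continuous fun x : G =>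
      (ξ.rep.d : ℂ) * (ξ.rep.onM (x : G ⧸ K) * a ξ).trace * (η.rep.mat x)ᴴ i j := fun ξ =>
    (continuous_const.mul (continuous_trace_onM_mul ξ.rep (a ξ))).mul
      (η.rep.continuous_mat_apply j i).star
  rw [integral_finsetSum _ fun ξ _ => integrable_of_continuous (hc ξ)]
  simp_rw [mul_assoc, integral_const_mul]
  by_cases hη : η ∈ F
  · rw [Finset.sum_eq_single η (fun ξ _ hξ => by
      rw [integral_trace_onM_mul_conjTranspose_of_ne hξ, mul_zero]) (fun h => absurd hη h),
      integral_trace_onM_mul_conjTranspose_self, ← mul_assoc, mul_inv_cancel₀, one_mul]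
    exact_mod_cast η.rep.d_pos.ne'
  · rw [ha η hη, Matrix.mul_zero]
    refine Finset.sum_eq_zero fun ξ hξ => ?_
    rw [integral_trace_onM_mul_conjTranspose_of_ne (show ξ ≠ η from fun h => hη (h ▸ hξ)),
      mul_zero]

theorem integral_haarM {f : G ⧸ K → ℂ} (hf : Measurable f) :
    ∫ x, f x ∂(haarM G K) = ∫ x : G, f x ∂(haarG G) :=
  integral_map QuotientGroup.measurable_coe.aemeasurable hf.aestronglyMeasurable

/-- The Fourier coefficients are bounded by the `L^p` norm. -/
theorem enorm_fourier_apply_le {f : G ⧸ K → ℂ} (hf : Measurable f) {p : ℝ≥0∞} (hp : 1 ≤ p)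
    (ξ : Dual G K) (i j : Fin ξ.rep.d) : ‖fourier f ξ i j‖ₑ ≤ eLpNorm f p (haarM G K) := by
  rw [fourier, Matrix.of_apply]
  calc ‖∫ x, f (x : G ⧸ K) * (ξ.rep.mat x)ᴴ i j ∂(haarG G)‖ₑ
      ≤ ∫⁻ x, ‖f (x : G ⧸ K) * (ξ.rep.mat x)ᴴ i j‖ₑ ∂(haarG G) :=
        enorm_integral_le_lintegral_enorm _
    _ ≤ ∫⁻ x : G, ‖f (x : G ⧸ K)‖ₑ ∂(haarG G) := by
        refine lintegral_mono fun x => ?_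
        rw [enorm_mul]
        refine mul_le_of_le_one_right zero_le ?_
        rw [← ofReal_norm, Matrix.conjTranspose_apply, norm_star]
        exact ENNReal.ofReal_le_one.2 (ξ.rep.norm_mat_apply_le x j i)
    _ = ∫⁻ x, ‖f x‖ₑ ∂(haarM G K) :=
        (lintegral_map hf.enorm QuotientGroup.measurable_coe).symm
    _ = eLpNorm f 1 (haarM G K) := eLpNorm_one_eq_lintegral_enorm.symm
    _ ≤ eLpNorm f p (haarM G K) :=
        eLpNorm_le_eLpNorm_of_exponent_le hp hf.aestronglyMeasurable

/-- The operator with symbol `σ` multiplies the coefficients of a trigonometric polynomial. -/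
theorem Op_fourierSeries {σ : MatFamily G K} (hσ : IsMultiplierSymbol σ) {a : MatFamily G K}
    {F : Finset (Dual G K)} (ha : ∀ ξ ∉ F, a ξ = 0) :
    Op σ (fourierSeries a) = fourierSeries fun ξ => σ ξ * a ξ := by
  unfold Op
  congr 1
  ext1 ξ
  rw [fourier_fourierSeries ha, ← Matrix.mul_assoc, hσ.mul_proj]

end TrigPolynomials

section Symbol

variable {E : Type*} [NormedAddCommGroup E] [NormedSpace ℝ E] [FiniteDimensional ℝ E]
  {G : Type*} [Group G] [TopologicalSpace G] [IsTopologicalGroup G] [CompactSpace G] [T2Space G]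
  [ChartedSpace E G] [LieGroup 𝓘(ℝ, E) ∞ G] [MeasurableSpace G] [BorelSpace G] {K : Subgroup G}

theorem fourierSeries_mem_smoothFun {a : MatFamily G K} {F : Finset (Dual G K)}
    (ha : ∀ ξ ∉ F, a ξ = 0) : fourierSeries a ∈ smoothFun E K := by
  change ContMDiff 𝓘(ℝ, E) 𝓘(ℝ, ℂ) ∞ fun x : G => fourierSeries a (x : G ⧸ K)
  simp_rw [fourierSeries_eq_sum ha]
  refine contMDiff_sum_const_mul _ _ fun ξ => ?_
  simp_rw [TypeOneRep.onM_mk, Matrix.mul_assoc, Matrix.trace, Matrix.diag_apply]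
  exact contMDiff_finsetSum fun i _ => ξ.rep.contMDiff_mat_mul_apply _ i i

/-- The symbol of an operator that is bounded between Lebesgue spaces grows at most like the
dimension. -/
theorem exists_norm_symbol_le {σ : MatFamily G K} (hσ : IsMultiplierSymbol σ) {p₁ p₂ : ℝ≥0∞}
    (hp₂ : 1 ≤ p₂) (hA : IsLpBounded E p₁ p₂ σ) :
    ∃ C : ℝ, 0 ≤ C ∧ ∀ (ξ : Dual G K) (i j : Fin ξ.rep.d), ‖σ ξ i j‖ ≤ C * ξ.rep.d := by
  classical
  obtain ⟨C, hC⟩ := hA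
  refine ⟨C, C.coe_nonneg, fun ξ j l => ?_⟩
  -- The test function has the matrix unit E_ll as its coefficient at ξ and none elsewhere. It is
  -- bounded by d_ξ, and the (j, l) Fourier coefficient of its image is σ(ξ)_{jl}. Indices are
  -- compared as natural numbers because the type of `a η` varies with η.
  let a : MatFamily G K := fun η => if η = ξ then
    Matrix.of fun i j => if (i : ℕ) = l ∧ (j : ℕ) = l then 1 else 0 else 0
  have haξ : a ξ = Matrix.single l l 1 := by
    ext i j
    simp only [a, if_true, Matrix.of_apply, Matrix.single_apply, Fin.ext_iff]
    congr 1
    simp only [eq_iff_iff]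
    omega
  have ha : ∀ η ∉ ({ξ} : Finset (Dual G K)), a η = 0 := fun η hη => by
    simp only [a]
    rw [if_neg (by simpa using hη)]
  have hσa : ∀ η ∉ ({ξ} : Finset (Dual G K)), σ η * a η = 0 := fun η hη => by
    rw [ha η hη, Matrix.mul_zero]
  set t := fourierSeries a
  have ht : ∀ x, ‖t x‖ ≤ ξ.rep.d := fun x => by
    induction x using QuotientGroup.induction_on with
    | H x =>
      simp only [t]
      rw [fourierSeries_eq_sum ha, Finset.sum_singleton, haξ, norm_mul, TypeOneRep.onM_mk,
        Matrix.trace_mul_single, Complex.norm_natCast, MulOpposite.op_one, one_smul]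
      exact mul_le_of_le_one_right (Nat.cast_nonneg _)
        (ξ.rep.norm_mat_mul_apply_le ξ.rep.l2_opNorm_proj_le l l x)
  have h1 : eLpNorm t p₁ (haarM G K) ≤ ENNReal.ofReal ξ.rep.d := by
    refine (eLpNorm_le_of_ae_bound (C := (ξ.rep.d : ℝ)) (Filter.Eventually.of_forall ht)).trans ?_
    simp
  have h2 := hC t (fourierSeries_mem_smoothFun ha)
  have hOp : Op σ t = fourierSeries fun η => σ η * a η := Op_fourierSeries hσ ha
  have hm : Measurable (Op σ t) := by
    rw [hOp]
    exact measurable_of_continuous_lift (continuous_fourierSeries_of_finite hσa)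
  have h3 := enorm_fourier_apply_le hm hp₂ ξ j l
  have h4 : fourier (Op σ t) ξ j l = σ ξ j l := by
    rw [hOp, fourier_fourierSeries hσa, ← Matrix.mul_assoc, hσ.proj_mul, haξ]
    simp
  rw [h4] at h3
  have h5 : ‖σ ξ j l‖ₑ ≤ ENNReal.ofReal (C * ξ.rep.d) := by
    rw [ENNReal.ofReal_mul C.coe_nonneg, ENNReal.ofReal_coe_nnreal]
    exact h3.trans (h2.trans (by gcongr))
  rw [← ofReal_norm] at h5
  exact (ENNReal.ofReal_le_ofReal_iff (by positivity)).1 h5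

end Symbol

end HomBesov

end

noncomputable section

namespace HomBesov

/-! ### Multipliers acting on distributions. -/

section Pairing

variable {G : Type*} [Group G] [TopologicalSpace G] [IsTopologicalGroup G] [CompactSpace G]
  [MeasurableSpace G] [BorelSpace G] {K : Subgroup G}

/-- The integral of `φ` against the summand of index `ξ` of the Fourier series with
coefficients `a`. -/
def termPairing (a : MatFamily G K) (φ : G ⧸ K → ℂ) (ξ : Dual G K) : ℂ :=
  ∫ x : G, φ x * ((ξ.rep.d : ℂ) * (ξ.rep.onM (x : G ⧸ K) * a ξ).trace) ∂(haarG G)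

theorem integrable_mul_trace {φ : G ⧸ K → ℂ} (hφ : Continuous fun x : G => φ x)
    (ξ : TypeOneRep G K) (A : Matrix (Fin ξ.d) (Fin ξ.d) ℂ) :
    Integrable (fun x : G => φ x * ((ξ.d : ℂ) * (ξ.onM (x : G ⧸ K) * A).trace)) (haarG G) :=
  integrable_of_continuous
    (hφ.mul (continuous_const.mul (continuous_trace_onM_mul ξ A)))

theorem termPairing_add_right (a : MatFamily G K) {φ ψ : G ⧸ K → ℂ}
    (hφ : Continuous fun x : G => φ x) (hψ : Continuous fun x : G => ψ x) (ξ : Dual G K) :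
    termPairing a (φ + ψ) ξ = termPairing a φ ξ + termPairing a ψ ξ := by
  simp only [termPairing, Pi.add_apply, add_mul]
  exact integral_add (integrable_mul_trace hφ ξ.rep (a ξ)) (integrable_mul_trace hψ ξ.rep (a ξ))

theorem termPairing_smul_right (a : MatFamily G K) (c : ℂ) (φ : G ⧸ K → ℂ) (ξ : Dual G K) :
    termPairing a (c • φ) ξ = c * termPairing a φ ξ := by
  simp only [termPairing, Pi.smul_apply, smul_eq_mul, mul_assoc]
  exact integral_const_mul _ _

theorem termPairing_add_left (a b : MatFamily G K) {φ : G ⧸ K → ℂ}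
    (hφ : Continuous fun x : G => φ x) (ξ : Dual G K) :
    termPairing (a + b) φ ξ = termPairing a φ ξ + termPairing b φ ξ := by
  simp only [termPairing, Pi.add_apply, Matrix.trace_add, mul_add]
  exact integral_add (integrable_mul_trace hφ ξ.rep (a ξ)) (integrable_mul_trace hφ ξ.rep (b ξ))

theorem termPairing_smul_left (a : MatFamily G K) (c : ℂ) (φ : G ⧸ K → ℂ) (ξ : Dual G K) :
    termPairing (c • a) φ ξ = c * termPairing a φ ξ := by
  simp only [termPairing, Pi.smul_apply, Matrix.mul_smul, Matrix.trace_smul, smul_eq_mul,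
    mul_left_comm _ c]
  exact integral_const_mul _ _

/-- Integrate entry by entry: the prefactor contributes one power of d, the d² entries in the trace
of a product the other two. -/
theorem norm_termPairing_le (a : MatFamily G K) {φ : G ⧸ K → ℂ}
    (hφ : Continuous fun x : G => φ x) (ξ : Dual G K) {α β : ℝ}
    (hα : ∀ i j, ‖∫ x : G, φ x * (ξ.rep.mat x * ξ.rep.proj) i j ∂(haarG G)‖ ≤ α)
    (hβ : ∀ i j, ‖a ξ i j‖ ≤ β) : ‖termPairing a φ ξ‖ ≤ ξ.rep.d ^ 3 * (α * β) := by
  have h : termPairing a φ ξ = (ξ.rep.d : ℂ) * (Matrix.of (fun i j =>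
      ∫ x : G, φ x * (ξ.rep.mat x * ξ.rep.proj) i j ∂(haarG G)) * a ξ).trace := by
    have hc : ∀ i j, Continuous fun x : G => φ x * (ξ.rep.mat x * ξ.rep.proj) i j * a ξ j i :=
      fun i j => by
        simp_rw [TypeOneRep.mat_mul_proj_apply]
        exact (hφ.mul ((ξ.rep.continuous_mat_apply i j).mul continuous_const)).mul continuous_const
    simp only [termPairing, mul_left_comm _ (ξ.rep.d : ℂ)]
    rw [integral_const_mul]
    congr 1
    simp_rw [TypeOneRep.onM_mk, Matrix.trace, Matrix.diag_apply, Matrix.mul_apply (N := a ξ),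
      Matrix.of_apply, Finset.mul_sum, ← mul_assoc, ← integral_mul_const]
    rw [integral_finsetSum _ fun i _ => integrable_of_continuous
      (continuous_finsetSum _ fun j _ => hc i j)]
    simp_rw [integral_finsetSum _ fun j _ => integrable_of_continuous (hc _ j)]
  rw [h, norm_mul, Complex.norm_natCast, pow_succ' _ 2, mul_assoc]
  exact mul_le_mul_of_nonneg_left (norm_trace_mul_le hα hβ) (Nat.cast_nonneg _)

/-- Pairing with a conjugated matrix coefficient of `η` recovers the coefficient at `η`. -/
theorem termPairing_conjTranspose_onM_self (a : MatFamily G K) (η : Dual G K)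
    (i j : Fin η.rep.d) :
    termPairing a (fun x => (η.rep.onM x)ᴴ i j) η = (η.rep.proj * a η) i j := by
  have h : ∀ x : G, (η.rep.onM (x : G ⧸ K))ᴴ i j *
      ((η.rep.d : ℂ) * (η.rep.onM (x : G ⧸ K) * a η).trace) =
      (η.rep.d : ℂ) * η.rep.proj i i *
        ((η.rep.onM (x : G ⧸ K) * a η).trace * (η.rep.mat x)ᴴ i j) := fun x => by
    rw [Matrix.conjTranspose_apply, TypeOneRep.onM_mk, TypeOneRep.mat_mul_proj_apply, star_mul,
      TypeOneRep.star_proj_apply, Matrix.conjTranspose_apply]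
    ring
  simp only [termPairing, h]
  rw [integral_const_mul, integral_trace_onM_mul_conjTranspose_self, TypeOneRep.proj_mul_apply]
  have hd : (η.rep.d : ℂ) ≠ 0 := by exact_mod_cast η.rep.d_pos.ne'
  calc (η.rep.d : ℂ) * η.rep.proj i i * ((η.rep.d : ℂ)⁻¹ * (η.rep.proj i i * a η i j))
      = η.rep.proj i i * η.rep.proj i i * a η i j := by field_simp
    _ = η.rep.proj i i * a η i j := by rw [TypeOneRep.proj_mul_proj_apply]

theorem termPairing_conjTranspose_onM_of_ne (a : MatFamily G K) {ξ η : Dual G K} (hne : ξ ≠ η)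
    (i j : Fin η.rep.d) : termPairing a (fun x => (η.rep.onM x)ᴴ i j) ξ = 0 := by
  have h : ∀ x : G, (η.rep.onM (x : G ⧸ K))ᴴ i j *
      ((ξ.rep.d : ℂ) * (ξ.rep.onM (x : G ⧸ K) * a ξ).trace) =
      (ξ.rep.d : ℂ) * η.rep.proj i i *
        ((ξ.rep.onM (x : G ⧸ K) * a ξ).trace * (η.rep.mat x)ᴴ i j) := fun x => by
    rw [Matrix.conjTranspose_apply, TypeOneRep.onM_mk, TypeOneRep.mat_mul_proj_apply, star_mul,
      TypeOneRep.star_proj_apply, Matrix.conjTranspose_apply]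
    ring
  simp only [termPairing, h]
  rw [integral_const_mul, integral_trace_onM_mul_conjTranspose_of_ne hne, mul_zero]

end Pairing

section Multiplier

variable {E : Type*} [NormedAddCommGroup E] [NormedSpace ℝ E] [FiniteDimensional ℝ E]
  {G : Type*} [Group G] [TopologicalSpace G] [IsTopologicalGroup G] [CompactSpace G] [T2Space G]
  [ChartedSpace E G] [LieGroup 𝓘(ℝ, E) ∞ G] [MeasurableSpace G] [BorelSpace G] {n : ℕ}
  {Y : Module.Basis (Fin n) ℝ (GroupLieAlgebra 𝓘(ℝ, E) G)} {K : Subgroup G}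
  {B : LinearMap.BilinForm ℝ (GroupLieAlgebra 𝓘(ℝ, E) G)}

theorem distFourier_apply (u : Distribution Y K) (ξ : Dual G K) (i j : Fin ξ.rep.d) :
    distFourier u ξ i j =
      u.1 ⟨fun x => (ξ.rep.onM x)ᴴ i j, conjTranspose_onM_mem_smoothFun ξ.rep i j⟩ := by
  rw [distFourier, Matrix.of_apply, distPair, dif_pos]

theorem distFourier_add (u v : Distribution Y K) :
    distFourier (u + v) = distFourier u + distFourier v := by
  ext ξ i j
  simp only [Pi.add_apply, Matrix.add_apply, distFourier_apply]
  rfl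

theorem distFourier_smul (c : ℂ) (u : Distribution Y K) :
    distFourier (c • u) = c • distFourier u := by
  ext ξ i j
  simp only [Pi.smul_apply, Matrix.smul_apply, distFourier_apply]
  rfl

/-- The two kinds of coefficients are shown to agree only up to I_ξ on the left; a multiplier symbol
absorbs it, by σ(ξ)I_ξ = σ(ξ). -/
theorem distFourier_distOfSmooth (f : smoothFun E K) (ξ : Dual G K) :
    distFourier (distOfSmooth Y f) ξ = ξ.rep.proj * fourier f.1 ξ := by
  have hf : Continuous fun x : G => f.1 x := ContMDiff.continuous f.2
  ext i j
  rw [distFourier_apply, TypeOneRep.proj_mul_apply, fourier, Matrix.of_apply,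
    ← integral_const_mul]
  have hc : Continuous fun x : G => (ξ.rep.onM (x : G ⧸ K))ᴴ i j :=
    ContMDiff.continuous (conjTranspose_onM_mem_smoothFun (E := E) ξ.rep i j)
  refine (integral_haarM (measurable_of_continuous_lift (hf.mul hc))).trans ?_
  refine integral_congr_ae (Filter.Eventually.of_forall fun x => ?_)
  simp only [Matrix.conjTranspose_apply, TypeOneRep.onM_mk, TypeOneRep.mat_mul_proj_apply,
    star_mul, TypeOneRep.star_proj_apply]
  ring

/-- A Fourier series with coefficients of polynomial growth converges to a distribution. -/
theorem exists_distribution_hasSum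
    (hB : ∀ (g : G) (X Z : GroupLieAlgebra 𝓘(ℝ, E) G), B (Ad g X) (Ad g Z) = B X Z)
    (hY : ∀ i j, B (Y i) (Y j) = if i = j then 1 else 0)
    {a : MatFamily G K} {p q : ℕ} {C : ℝ} (hC : 0 ≤ C) (ha : ∀ (ξ : Dual G K) (i j : Fin ξ.rep.d),
      ‖a ξ i j‖ ≤ C * (ξ.rep.d ^ p * (1 + eigenvalue Y ξ.rep) ^ q)) :
    ∃ v : Distribution Y K, ∀ φ : smoothFun E K, HasSum (termPairing a φ.1) (v.1 φ) := by
  -- The three extra powers of d come from `norm_termPairing_le`. The exponent M fixes how many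
  -- integrations by parts are made, so the limit is a distribution of order at most 2M.
  obtain ⟨M, g, hg, hg0, hgle⟩ := exists_summable_majorant Y K hB hY (p + 3) q
  have hcont : ∀ φ : smoothFun E K, Continuous fun x : G => φ.1 (x : G ⧸ K) :=
    fun φ => ContMDiff.continuous φ.2
  have hbound : ∀ (φ : smoothFun E K) (A : ℝ), (∀ w : List (Fin n), w.length ≤ 2 * M →
      ∀ x : G, ‖iterLieDeriv Y w (fun y : G => φ.1 (y : G ⧸ K)) x‖ ≤ A) →
      ∀ ξ, ‖termPairing a φ.1 ξ‖ ≤ C * (1 + n) ^ M * A * g ξ := fun φ A hA ξ => by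
    have h0 := (ξ.rep.eigenvalue_spec Y hB hY).1
    have hpos : 0 < (1 + eigenvalue Y ξ.rep) ^ M := by positivity
    have hA0 : 0 ≤ A := (norm_nonneg _).trans (hA [] (Nat.zero_le _) 1)
    have h1 := norm_termPairing_le a (hcont φ) ξ
      (α := (1 + n) ^ M * A / (1 + eigenvalue Y ξ.rep) ^ M) (fun i j => by
        rw [le_div_iff₀' hpos]
        exact pow_mul_norm_integral_mul_mat_le Y hB hY ξ.rep M φ.2 hA i j) (ha ξ)
    refine h1.trans ?_
    have h2 : (ξ.rep.d : ℝ) ^ (p + 3) * (1 + eigenvalue Y ξ.rep) ^ q /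
        (1 + eigenvalue Y ξ.rep) ^ M ≤ g ξ := (div_le_iff₀ hpos).2 (hgle ξ)
    calc _ = C * (1 + n) ^ M * A * ((ξ.rep.d : ℝ) ^ (p + 3) * (1 + eigenvalue Y ξ.rep) ^ q /
        (1 + eigenvalue Y ξ.rep) ^ M) := by ring
      _ ≤ _ := mul_le_mul_of_nonneg_left h2 (by positivity)
  have hsum : ∀ φ : smoothFun E K, Summable (termPairing a φ.1) := fun φ => by
    obtain ⟨A, -, hA⟩ := exists_norm_iterLieDeriv_le Y φ.2 (2 * M)
    exact Summable.of_norm_bounded (hg.mul_left _) (hbound φ A hA)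
  refine ⟨⟨{ toFun := fun φ => ∑' ξ, termPairing a φ.1 ξ
             map_add' := fun φ ψ => ?_
             map_smul' := fun c φ => ?_ }, 2 * M, C * (1 + n) ^ M * ∑' ξ, g ξ,
    fun φ A hA => ?_⟩, fun φ => (hsum φ).hasSum⟩
  · rw [← (hsum φ).tsum_add (hsum ψ)]
    exact tsum_congr fun ξ => termPairing_add_right a (hcont φ) (hcont ψ) ξ
  · rw [RingHom.id_apply, smul_eq_mul, ← tsum_mul_left]
    exact tsum_congr fun ξ => termPairing_smul_right a c φ.1 ξ
  · refine (tsum_of_norm_bounded (hg.hasSum.mul_left _) (hbound φ A hA)).trans_eq ?_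
    ring

/-- A multiplier whose symbol has polynomial growth acts on distributions. -/
theorem exists_multiplier
    (hB : ∀ (g : G) (X Z : GroupLieAlgebra 𝓘(ℝ, E) G), B (Ad g X) (Ad g Z) = B X Z)
    (hY : ∀ i j, B (Y i) (Y j) = if i = j then 1 else 0)
    {σ : MatFamily G K} {C : ℝ} (hC : 0 ≤ C)
    (hσ : ∀ (ξ : Dual G K) (i j : Fin ξ.rep.d), ‖σ ξ i j‖ ≤ C * ξ.rep.d) :
    ∃ T : Distribution Y K →ₗ[ℂ] Distribution Y K, ∀ (u : Distribution Y K) (φ : smoothFun E K),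
      HasSum (termPairing (fun ξ => σ ξ * distFourier u ξ) φ.1) ((T u).1 φ) := by
  have h : ∀ u : Distribution Y K, ∃ v : Distribution Y K, ∀ φ : smoothFun E K,
      HasSum (termPairing (fun ξ => σ ξ * distFourier u ξ) φ.1) (v.1 φ) := fun u => by
    obtain ⟨N, D, hD, hu⟩ := exists_norm_distFourier_le Y hB hY u
    -- Of the two powers of d, one comes from the symbol and one from the matrix product.
    refine exists_distribution_hasSum hB hY (p := 2) (q := N) (mul_nonneg hC hD) fun ξ i j =>
      (norm_mul_apply_le (hσ ξ) (hu ξ) i j).trans_eq ?_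
    ring
  choose T hT using h
  have hcont : ∀ φ : smoothFun E K, Continuous fun x : G => φ.1 (x : G ⧸ K) :=
    fun φ => ContMDiff.continuous φ.2
  -- T was chosen separately for each u; it is linear because its values are sums of series linear
  -- in u, and sums are unique.
  refine ⟨{ toFun := T, map_add' := fun u v => ?_, map_smul' := fun c u => ?_ }, hT⟩
  · refine Subtype.ext (LinearMap.ext fun φ => (hT (u + v) φ).unique ?_)
    have h1 := (hT u φ).add (hT v φ)
    simp_rw [← termPairing_add_left _ _ (hcont φ)] at h1
    rw [distFourier_add]
    simp only [Pi.add_apply, Matrix.mul_add]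
    exact h1
  · refine Subtype.ext (LinearMap.ext fun φ => (hT (c • u) φ).unique ?_)
    have h1 := (hT u φ).mul_left c
    simp_rw [← termPairing_smul_left] at h1
    rw [distFourier_smul]
    simp only [Pi.smul_apply, Matrix.mul_smul]
    exact h1

/-- Test with a conjugated coefficient of η: orthogonality removes every term of the series except
the one at η. -/
theorem distFourier_eq_of_hasSum {v : Distribution Y K} {a : MatFamily G K}
    (hv : ∀ φ : smoothFun E K, HasSum (termPairing a φ.1) (v.1 φ)) (η : Dual G K) :
    distFourier v η = η.rep.proj * a η := by
  ext i j
  rw [distFourier_apply]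
  refine (hv _).unique ?_
  rw [← termPairing_conjTranspose_onM_self]
  exact hasSum_single η fun ξ hξ => termPairing_conjTranspose_onM_of_ne a hξ i j

/-- `Op(σ)f` is a uniformly convergent series. -/
theorem exists_summable_bound_Op
    (hB : ∀ (g : G) (X Z : GroupLieAlgebra 𝓘(ℝ, E) G), B (Ad g X) (Ad g Z) = B X Z)
    (hY : ∀ i j, B (Y i) (Y j) = if i = j then 1 else 0)
    {σ : MatFamily G K} {C : ℝ} (hC : 0 ≤ C)
    (hσ : ∀ (ξ : Dual G K) (i j : Fin ξ.rep.d), ‖σ ξ i j‖ ≤ C * ξ.rep.d) (f : smoothFun E K) :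
    ∃ g : Dual G K → ℝ, Summable g ∧ ∀ (ξ : Dual G K) (x : G),
      ‖(ξ.rep.d : ℂ) * (ξ.rep.onM (x : G ⧸ K) * (σ ξ * fourier f.1 ξ)).trace‖ ≤ g ξ := by
  -- The five powers of d: one from the prefactor, two from the trace, one from the inner matrix
  -- product, one from the symbol.
  obtain ⟨M, g, hg, hg0, hgle⟩ := exists_summable_majorant Y K hB hY 5 0
  obtain ⟨A, hA0, hA⟩ := exists_norm_iterLieDeriv_le Y f.2 (2 * M)
  refine ⟨fun ξ => C * (1 + n) ^ M * A * g ξ, hg.mul_left _, fun ξ x => ?_⟩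
  have h0 := (ξ.rep.eigenvalue_spec Y hB hY).1
  have hpos : 0 < (1 + eigenvalue Y ξ.rep) ^ M := by positivity
  have h1 : ∀ i j, ‖fourier f.1 ξ i j‖ ≤ (1 + n) ^ M * A / (1 + eigenvalue Y ξ.rep) ^ M :=
    fun i j => by
      rw [le_div_iff₀' hpos]
      exact pow_mul_norm_integral_mul_conjTranspose_mat_le Y hB hY ξ.rep M f.2 hA i j
  have h2 : ∀ i j, ‖ξ.rep.onM (x : G ⧸ K) i j‖ ≤ 1 := fun i j =>
    ξ.rep.norm_mat_mul_apply_le ξ.rep.l2_opNorm_proj_le i j x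
  have h3 := norm_trace_mul_le h2 (norm_mul_apply_le (hσ ξ) h1)
  rw [norm_mul, Complex.norm_natCast]
  refine (mul_le_mul_of_nonneg_left h3 (Nat.cast_nonneg _)).trans ?_
  have h4 : (ξ.rep.d : ℝ) ^ 5 * (1 + eigenvalue Y ξ.rep) ^ 0 /
      (1 + eigenvalue Y ξ.rep) ^ M ≤ g ξ := (div_le_iff₀ hpos).2 (hgle ξ)
  calc _ = C * (1 + n) ^ M * A * ((ξ.rep.d : ℝ) ^ 5 * (1 + eigenvalue Y ξ.rep) ^ 0 /
      (1 + eigenvalue Y ξ.rep) ^ M) := by ring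
    _ ≤ _ := mul_le_mul_of_nonneg_left h4 (by positivity)

/-- The pairing of `Op(σ)f` with a smooth function can be computed term by term. -/
theorem integrable_Op_mul_and_hasSum
    (hB : ∀ (g : G) (X Z : GroupLieAlgebra 𝓘(ℝ, E) G), B (Ad g X) (Ad g Z) = B X Z)
    (hY : ∀ i j, B (Y i) (Y j) = if i = j then 1 else 0)
    {σ : MatFamily G K} {C : ℝ} (hC : 0 ≤ C)
    (hσ : ∀ (ξ : Dual G K) (i j : Fin ξ.rep.d), ‖σ ξ i j‖ ≤ C * ξ.rep.d) (f φ : smoothFun E K) :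
    Integrable (fun x => Op σ f.1 x * φ.1 x) (haarM G K) ∧
      HasSum (termPairing (fun ξ => σ ξ * fourier f.1 ξ) φ.1)
        (∫ x, Op σ f.1 x * φ.1 x ∂(haarM G K)) := by
  obtain ⟨g, hg, hgle⟩ := exists_summable_bound_Op hB hY hC hσ f
  have hφ : Continuous fun x : G => φ.1 (x : G ⧸ K) := ContMDiff.continuous φ.2
  have hOp : Continuous fun x : G => Op σ f.1 (x : G ⧸ K) :=
    continuous_tsum (fun ξ => continuous_const.mul (continuous_trace_onM_mul ξ.rep _)) hg hgle
  have hm : Measurable fun x => Op σ f.1 x * φ.1 x :=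
    measurable_of_continuous_lift (hOp.mul hφ)
  refine ⟨(integrable_map_measure hm.aestronglyMeasurable
    QuotientGroup.measurable_coe.aemeasurable).2 (integrable_of_continuous (hOp.mul hφ)), ?_⟩
  obtain ⟨D, hD⟩ := isCompact_univ.exists_bound_of_continuousOn hφ.continuousOn
  -- Countability of the index set allows the sum and the integral to be exchanged.
  have : Countable (Dual G K) := countable_dual Y K hB hY
  have hD0 : 0 ≤ D := (norm_nonneg _).trans (hD 1 (Set.mem_univ 1))
  have h := hasSum_integral_of_summable_integral_norm (μ := haarG G)
    (F := fun (ξ : Dual G K) (x : G) => φ.1 (x : G ⧸ K) *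
      ((ξ.rep.d : ℂ) * (ξ.rep.onM (x : G ⧸ K) * (σ ξ * fourier f.1 ξ)).trace))
    (fun ξ => integrable_mul_trace hφ ξ.rep _)
    (Summable.of_norm_bounded (hg.mul_left D) fun ξ => by
      have := norm_integral_le_of_norm_le_const (G := ℝ) (μ := haarG G) (C := D * g ξ)
        (f := fun x : G => ‖φ.1 (x : G ⧸ K) *
          ((ξ.rep.d : ℂ) * (ξ.rep.onM (x : G ⧸ K) * (σ ξ * fourier f.1 ξ)).trace)‖)
        (Filter.Eventually.of_forall fun x => by
          rw [norm_norm, norm_mul]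
          exact mul_le_mul (hD x (Set.mem_univ x)) (hgle ξ x) (norm_nonneg _) hD0)
      simpa using this)
  rw [integral_haarM hm]
  have hF : ∀ x : G, Op σ f.1 x * φ.1 x = ∑' ξ : Dual G K, φ.1 (x : G ⧸ K) *
      ((ξ.rep.d : ℂ) * (ξ.rep.onM (x : G ⧸ K) * (σ ξ * fourier f.1 ξ)).trace) := fun x => by
    rw [tsum_mul_left, mul_comm]
    rfl
  simp_rw [hF]
  exact h

end Multiplier

/-! ### From dyadic blocks to Besov norms. -/

theorem besovNorm_le_of_eLpNorm_le {E : Type*} [NormedAddCommGroup E] [NormedSpace ℝ E]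
    {G : Type*} [Group G] [TopologicalSpace G] [IsTopologicalGroup G] [CompactSpace G]
    [ChartedSpace E G] [MeasurableSpace G] [BorelSpace G] {n : ℕ}
    {Y : Module.Basis (Fin n) ℝ (GroupLieAlgebra 𝓘(ℝ, E) G)} {K : Subgroup G}
    {p₁ p₂ : ℝ≥0∞} {C : ℝ≥0} {u v : Distribution Y K}
    (h : ∀ m, eLpNorm (distBlock v m) p₂ (haarM G K) ≤
      C * eLpNorm (distBlock u m) p₁ (haarM G K)) (r : ℝ) {q : ℝ≥0∞} (hq : 0 < q) :
    besovNorm r p₂ q v ≤ C * besovNorm r p₁ q u := by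
  have h' : ∀ m : ℕ, (2 : ℝ≥0∞) ^ ((m : ℝ) * r) * eLpNorm (distBlock v m) p₂ (haarM G K) ≤
      C * ((2 : ℝ≥0∞) ^ ((m : ℝ) * r) * eLpNorm (distBlock u m) p₁ (haarM G K)) := fun m => by
    rw [mul_left_comm]
    gcongr
    exact h m
  unfold besovNorm
  split_ifs with hqt
  · rw [ENNReal.mul_iSup]
    exact iSup_mono h'
  -- Only monotonicity and homogeneity of the ℓ^q quasi-norm are used, so q < 1 needs no separate
  -- treatment.
  · have hq' : 0 < q.toReal := ENNReal.toReal_pos hq.ne' hqt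
    calc _ ≤ (∑' m : ℕ, (C * ((2 : ℝ≥0∞) ^ ((m : ℝ) * r) *
          eLpNorm (distBlock u m) p₁ (haarM G K))) ^ q.toReal) ^ (1 / q.toReal) := by
          gcongr ?_ ^ _
          exact ENNReal.tsum_le_tsum fun m => ENNReal.rpow_le_rpow (h' m) hq'.le
      _ = _ := by
          simp_rw [fun m : ℕ => ENNReal.mul_rpow_of_nonneg (C : ℝ≥0∞) ((2 : ℝ≥0∞) ^ ((m : ℝ) * r) *
            eLpNorm (distBlock u m) p₁ (haarM G K)) hq'.le]
          rw [ENNReal.tsum_mul_left, ENNReal.mul_rpow_of_nonneg _ _ (by positivity),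
            ← ENNReal.rpow_mul, mul_one_div_cancel hq'.ne', ENNReal.rpow_one]

section Besov

variable {E : Type*} [NormedAddCommGroup E] [NormedSpace ℝ E] [FiniteDimensional ℝ E]
  {G : Type*} [Group G] [TopologicalSpace G] [IsTopologicalGroup G] [CompactSpace G] [T2Space G]
  [ChartedSpace E G] [LieGroup 𝓘(ℝ, E) ∞ G] [MeasurableSpace G] [BorelSpace G] {n : ℕ}
  {Y : Module.Basis (Fin n) ℝ (GroupLieAlgebra 𝓘(ℝ, E) G)} {K : Subgroup G}
  {B : LinearMap.BilinForm ℝ (GroupLieAlgebra 𝓘(ℝ, E) G)}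

/-- A Fourier multiplier maps the dyadic blocks of `u` to the dyadic blocks of its image. -/
theorem distBlock_mem_smoothFun_and_Op_distBlock
    (hB : ∀ (g : G) (X Z : GroupLieAlgebra 𝓘(ℝ, E) G), B (Ad g X) (Ad g Z) = B X Z)
    (hY : ∀ i j, B (Y i) (Y j) = if i = j then 1 else 0)
    {σ : MatFamily G K} (hσ : IsMultiplierSymbol σ) {u v : Distribution Y K}
    (huv : ∀ ξ, distFourier v ξ = σ ξ * distFourier u ξ) (m : ℕ) :
    distBlock u m ∈ smoothFun E K ∧ Op σ (distBlock u m) = distBlock v m := by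
  classical
  -- The upper end of the dyadic window already leaves finitely many classes.
  have ha : ∀ ξ ∉ (finite_weight_lt Y K hB hY (2 ^ (m + 1))).toFinset,
      (if (2 : ℝ) ^ m ≤ weight Y ξ ∧ weight Y ξ < (2 : ℝ) ^ (m + 1) then distFourier u ξ else 0) =
        0 := fun ξ hξ => if_neg fun h => hξ ((Set.Finite.mem_toFinset _).2 h.2)
  unfold distBlock
  refine ⟨?_, ?_⟩
  · convert fourierSeries_mem_smoothFun (E := E) ha
  · convert Op_fourierSeries hσ ha using 2
    ext1 ξ
    split_ifs
    · exact huv ξ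
    · exact (Matrix.mul_zero _).symm

end Besov

end HomBesov

end

theorem theorem2p1
    {E : Type*} [NormedAddCommGroup E] [NormedSpace ℝ E] [FiniteDimensional ℝ E]
    {G : Type*} [Group G] [TopologicalSpace G] [IsTopologicalGroup G] [T2Space G] [CompactSpace G]
    [ChartedSpace E G] [LieGroup 𝓘(ℝ, E) ∞ G] [MeasurableSpace G] [BorelSpace G]
    -- an `Ad`-invariant inner product on the Lie algebra and an orthonormal basis of it
    (B : LinearMap.BilinForm ℝ (GroupLieAlgebra 𝓘(ℝ, E) G))
    (hB : ∀ (g : G) (X Z : GroupLieAlgebra 𝓘(ℝ, E) G),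
      B (HomBesov.Ad g X) (HomBesov.Ad g Z) = B X Z)
    {n : ℕ} (Y : Module.Basis (Fin n) ℝ (GroupLieAlgebra 𝓘(ℝ, E) G))
    (hY : ∀ i j, B (Y i) (Y j) = if i = j then 1 else 0)
    (K : Subgroup G) (hK : IsClosed (K : Set G))
    (σ : HomBesov.MatFamily G K) (hσ : HomBesov.IsMultiplierSymbol σ)
    (p₁ p₂ : ℝ≥0∞) (hp₁ : 1 ≤ p₁) (hp₂ : 1 ≤ p₂)
    (hA : HomBesov.IsLpBounded E p₁ p₂ σ) :
    ∃ T : HomBesov.Distribution Y K →ₗ[ℂ] HomBesov.Distribution Y K,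
      -- `T` extends `A = Op(σ)` from smooth functions to distributions ...
      (∀ f φ : HomBesov.smoothFun E K,
        MeasureTheory.Integrable (fun x => HomBesov.Op σ f.1 x * φ.1 x) (HomBesov.haarM G K) ∧
        (T (HomBesov.distOfSmooth Y f)).1 φ =
          ∫ x, HomBesov.Op σ f.1 x * φ.1 x ∂(HomBesov.haarM G K)) ∧
      -- ... as the Fourier multiplier with symbol `σ` ...
      (∀ (u : HomBesov.Distribution Y K) (ξ : HomBesov.Dual G K),
        HomBesov.distFourier (T u) ξ = σ ξ * HomBesov.distFourier u ξ) ∧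
      -- ... and is bounded between the Besov spaces
      ∀ (r : ℝ) (q : ℝ≥0∞), 0 < q → ∃ C : ℝ≥0, ∀ u ∈ HomBesov.besovSpace Y K r p₁ q,
        T u ∈ HomBesov.besovSpace Y K r p₂ q ∧
        HomBesov.besovNorm r p₂ q (T u) ≤ C * HomBesov.besovNorm r p₁ q u := by
  obtain ⟨C, hC, hCσ⟩ := HomBesov.exists_norm_symbol_le hσ hp₂ hA
  obtain ⟨T, hT⟩ := HomBesov.exists_multiplier hB hY hC hCσ
  have hF : ∀ (u : HomBesov.Distribution Y K) (ξ : HomBesov.Dual G K),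
      HomBesov.distFourier (T u) ξ = σ ξ * HomBesov.distFourier u ξ := fun u ξ => by
    rw [HomBesov.distFourier_eq_of_hasSum (hT u), ← Matrix.mul_assoc, hσ.proj_mul]
  refine ⟨T, fun f φ => ?_, hF, fun r q hq => ?_⟩
  · obtain ⟨hi, hs⟩ := HomBesov.integrable_Op_mul_and_hasSum hB hY hC hCσ f φ
    -- Both sides are sums of the same series once σ(ξ) has absorbed I_ξ.
    refine ⟨hi, (hT _ φ).unique ?_⟩
    convert hs using 2
    ext1 ξ
    rw [HomBesov.distFourier_distOfSmooth, ← Matrix.mul_assoc, hσ.mul_proj]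
  -- The L^p constant of A itself serves as the Besov constant, for all r and q.
  · obtain ⟨D, hD⟩ := hA
    have h : ∀ u : HomBesov.Distribution Y K,
        HomBesov.besovNorm r p₂ q (T u) ≤ D * HomBesov.besovNorm r p₁ q u := fun u =>
      HomBesov.besovNorm_le_of_eLpNorm_le (fun m => by
        obtain ⟨hu, hOp⟩ := HomBesov.distBlock_mem_smoothFun_and_Op_distBlock hB hY hσ (hF u) m
        rw [← hOp]
        exact hD _ hu) r hq
    exact ⟨D, fun u hu => ⟨(h u).trans_lt (ENNReal.mul_lt_top ENNReal.coe_lt_top hu), h u⟩⟩
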